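/- An instance of submodular tree orienteering consists of a directed graph $(V,E)$ with $n=|V|$ vertices and edge costs $c:E\to\{0,1,2,\dots\}$ (for instance a complete directed graph whose costs form an asymmetric metric), a root $r^*\in V$, a budget $B\in\{0,1,2,\dots\}$, and a monotone submodular function $f:2^V\to\mathbb{R}_{\ge 0}$. A feasible solution is an out-directed arborescence $T$ in the graph, rooted at $r^*$, with $\sum_{e\in E(T)}c(e)\le B$; it is optimal if it maximizes $f(V(T))$ among the feasible solutions. Algorithms are deterministic programs for a random access machine that accesses $f$ through a value oracle: each operation on numbers and each query of a value $f(S)$ takes unit time. For every constant $\varepsilon>0$ there are a constant $C>0$ and an algorithm such that for every polynomial $p$ there is a constant $D>0$ for which the following holds. For every instance with $f(S)\le p(n)$ for all $S\subseteq V$, and every integer $k$ such that some optimal arborescence $T^*$ has at most $k$ vertices (in particular for $k$ equal to the number of vertices of an optimal arborescence), the algorithm, given the instance and $k$, returns a feasible arborescence $T$ with $$ f(V(T^*)) \;\le\; C\,\rho(k)\, f(V(T)),\qquad \rho(k)=\frac{\log k}{\log\log k}\ \text{ if } k\ge 3,\qquad \rho(k)=1\ \text{ if } k\le 2, $$ within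 time $$ \bigl(2n\,(1+\log(B+1))\bigr)^{D\,(1+\log k)^{1+\varepsilon}} ; $$ that is, it is an $O(\log k/\log\log k)$-approximation algorithm with running time $(n\log B)^{O(\log^{1+\varepsilon}k)}$. -/

import Mathlib

/-! ### The submodular tree orienteering problem -/

namespace STO

/-- An instance of submodular tree orienteering: a finite directed graph with edge costs in
`{0, 1, 2, …}`, a root vertex, a budget and a nonnegative monotone submodular set function on the
vertices.  A complete directed graph (in particular an asymmetric metric) is the case
`edges = Finset.univ`. -/
structure Instance where
  /-- the number of vertices; the vertex set is `Fin n` -/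
  n : ℕ
  /-- the edge set -/
  edges : Finset (Fin n × Fin n)
  /-- the edge costs; only the values at members of `edges` are ever used -/
  cost : Fin n × Fin n → ℕ
  /-- the root -/
  root : Fin n
  /-- the budget -/
  budget : ℕ
  /-- the reward function -/
  f : Finset (Fin n) → ℝ
  f_nonneg : ∀ S, 0 ≤ f S
  f_mono : Monotone f
  f_submodular : ∀ S T, f (S ∪ T) + f (S ∩ T) ≤ f S + f T

/-- A subgraph of a directed graph on `Fin n`, given by its vertices and its edges. -/
structure Subgraph (n : ℕ) where
  verts : Finset (Fin n)
  edges : Finset (Fin n × Fin n)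

/-- `T` is an out-directed arborescence rooted at `r`: the root has no incoming edge, every other
vertex of `T` has exactly one incoming edge, and every vertex of `T` is reachable from `r`
along edges of `T`. -/
structure Subgraph.IsArborescence {n : ℕ} (T : Subgraph n) (r : Fin n) : Prop where
  root_mem : r ∈ T.verts
  edge_mem : ∀ u v, (u, v) ∈ T.edges → u ∈ T.verts ∧ v ∈ T.verts
  root_no_in : ∀ u, (u, r) ∉ T.edges
  unique_in : ∀ v ∈ T.verts, v ≠ r → ∃! u, (u, v) ∈ T.edges
  reachable : ∀ v ∈ T.verts, Relation.ReflTransGen (fun a b => (a, b) ∈ T.edges) r v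

/-- `T` is a feasible solution: an arborescence of the graph rooted at the root of the instance,
whose total edge cost is at most the budget. -/
structure Instance.IsFeasible (I : Instance) (T : Subgraph I.n) : Prop where
  isArborescence : T.IsArborescence I.root
  edges_subset : T.edges ⊆ I.edges
  cost_le : ∑ e ∈ T.edges, I.cost e ≤ I.budget

/-- `T` is an optimal solution: feasible, and of maximum reward among the feasible solutions. -/
def Instance.IsOptimal (I : Instance) (T : Subgraph I.n) : Prop :=
  I.IsFeasible T ∧ ∀ T' : Subgraph I.n, I.IsFeasible T' → I.f T'.verts ≤ I.f T.verts

/-! ### The machine model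

A random access machine in the value-oracle model, programmed in a structured language with
recursive procedures.  Its store has cells for natural numbers and cells for real numbers, with
indirect addressing.  The arithmetic consists of addition, subtraction and halving (so
that numbers grow by at most one bit in each operation); real numbers can only be added,
subtracted and compared.  Every operation and every value query takes one time unit. -/

/-- The store: natural-number cells and real-number cells, both addressed by natural numbers. -/
structure Store where
  nat : ℕ → ℕ
  real : ℕ → ℝ

/-- All cells hold zero. -/
def Store.zero : Store := ⟨fun _ => 0, fun _ => 0⟩

/-- Natural-number expressions. Vertices are the numbers `0, …, n - 1`. -/
inductive NExp where
  /-- a constant -/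
  | lit (c : ℕ)
  /-- the number of vertices of the input graph -/
  | numVerts
  /-- the root of the input -/
  | root
  /-- the budget of the input -/
  | budget
  /-- the parameter `k` that is given to the algorithm together with the instance -/
  | param
  /-- `1` if there is an edge from `u` to `v`, otherwise `0` -/
  | edge (u v : NExp)
  /-- the cost of the edge from `u` to `v` (`0` if there is no such edge) -/
  | cost (u v : NExp)
  /-- the content of the natural-number cell with address `a` -/
  | mem (a : NExp)
  | add (a b : NExp)
  /-- truncated subtraction -/
  | sub (a b : NExp)
  /-- division by two, rounded down -/
  | half (a : NExp)

/-- The number of operations in an expression. -/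
def NExp.size : NExp → ℕ
  | lit _ | numVerts | root | budget | param => 1
  | edge u v | cost u v => 1 + u.size + v.size
  | mem a | half a => 1 + a.size
  | add a b | sub a b => 1 + a.size + b.size

/-- The value of an expression for an instance, a parameter and a store. -/
def NExp.eval (I : Instance) (k : ℕ) (s : Store) : NExp → ℕ
  | lit c => c
  | numVerts => I.n
  | root => I.root
  | budget => I.budget
  | param => k
  | edge u v =>
      if h : u.eval I k s < I.n ∧ v.eval I k s < I.n then
        if ((⟨u.eval I k s, h.1⟩, ⟨v.eval I k s, h.2⟩) : Fin I.n × Fin I.n) ∈ I.edges then 1 else 0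
      else 0
  | cost u v =>
      if h : u.eval I k s < I.n ∧ v.eval I k s < I.n then
        if ((⟨u.eval I k s, h.1⟩, ⟨v.eval I k s, h.2⟩) : Fin I.n × Fin I.n) ∈ I.edges then
          I.cost (⟨u.eval I k s, h.1⟩, ⟨v.eval I k s, h.2⟩)
        else 0
      else 0
  | mem a => s.nat (a.eval I k s)
  | add a b => a.eval I k s + b.eval I k s
  | sub a b => a.eval I k s - b.eval I k s
  | half a => a.eval I k s / 2

/-- Real-number expressions. -/
inductive RExp where
  /-- the content of the real-number cell with address `a` -/
  | mem (a : NExp)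
  /-- a natural number as a real number -/
  | ofNat (a : NExp)
  | add (x y : RExp)
  | sub (x y : RExp)
  /-- the value query: the reward `f S` of the set `S` of vertices `v` for which the
  natural-number cell with address `a + v` is not zero -/
  | value (a : NExp)

/-- The number of operations in an expression. -/
def RExp.size : RExp → ℕ
  | mem a | ofNat a | value a => 1 + a.size
  | add x y | sub x y => 1 + x.size + y.size

/-- The value of an expression for an instance, a parameter and a store. -/
noncomputable def RExp.eval (I : Instance) (k : ℕ) (s : Store) : RExp → ℝ
  | mem a => s.real (a.eval I k s)
  | ofNat a => (a.eval I k s : ℝ)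
  | add x y => x.eval I k s + y.eval I k s
  | sub x y => x.eval I k s - y.eval I k s
  | value a => I.f (Finset.univ.filter fun v : Fin I.n => s.nat (a.eval I k s + v) ≠ 0)

/-- Tests. -/
inductive BExp where
  | natLE (a b : NExp)
  | realLE (x y : RExp)
  | not (p : BExp)
  | and (p q : BExp)

/-- The number of operations in a test. -/
def BExp.size : BExp → ℕ
  | natLE a b => 1 + a.size + b.size
  | realLE x y => 1 + x.size + y.size
  | not p => 1 + p.size
  | and p q => 1 + p.size + q.size

/-- The truth of a test for an instance, a parameter and a store. -/
def BExp.Holds (I : Instance) (k : ℕ) (s : Store) : BExp → Prop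
  | natLE a b => a.eval I k s ≤ b.eval I k s
  | realLE x y => x.eval I k s ≤ y.eval I k s
  | not p => ¬ p.Holds I k s
  | and p q => p.Holds I k s ∧ q.Holds I k s

/-- Commands. -/
inductive Com where
  | skip
  /-- store the value of `e` in the natural-number cell with address `a` -/
  | setNat (a e : NExp)
  /-- store the value of `x` in the real-number cell with address `a` -/
  | setReal (a : NExp) (x : RExp)
  | seq (c₁ c₂ : Com)
  | ite (p : BExp) (c₁ c₂ : Com)
  | loop (p : BExp) (c : Com)
  /-- run the procedure with number `i` on the current store -/
  | call (i : ℕ)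

/-- A program: finitely many procedures, which may call each other, and a main command. -/
structure Program where
  procs : List Com
  main : Com

/-- `Exec I k P c s t s'`: for the instance `I` and the parameter `k`, with the procedures `P`, the
command `c` started in the store `s` halts after `t` time units in the store `s'`. -/
inductive Exec (I : Instance) (k : ℕ) (P : List Com) : Com → Store → ℕ → Store → Prop where
  | skip (s : Store) : Exec I k P .skip s 1 s
  | setNat (a e : NExp) (s : Store) :
      Exec I k P (.setNat a e) s (1 + a.size + e.size)
        ⟨Function.update s.nat (a.eval I k s) (e.eval I k s), s.real⟩
  | setReal (a : NExp) (x : RExp) (s : Store) :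
      Exec I k P (.setReal a x) s (1 + a.size + x.size)
        ⟨s.nat, Function.update s.real (a.eval I k s) (x.eval I k s)⟩
  | seq {c₁ c₂ : Com} {s s' s'' : Store} {t₁ t₂ : ℕ} :
      Exec I k P c₁ s t₁ s' → Exec I k P c₂ s' t₂ s'' →
        Exec I k P (.seq c₁ c₂) s (t₁ + t₂) s''
  | iteTrue {p : BExp} {c₁ c₂ : Com} {s s' : Store} {t : ℕ} :
      p.Holds I k s → Exec I k P c₁ s t s' → Exec I k P (.ite p c₁ c₂) s (1 + p.size + t) s'
  | iteFalse {p : BExp} {c₁ c₂ : Com} {s s' : Store} {t : ℕ} :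
      ¬ p.Holds I k s → Exec I k P c₂ s t s' → Exec I k P (.ite p c₁ c₂) s (1 + p.size + t) s'
  | loopTrue {p : BExp} {c : Com} {s s' s'' : Store} {t₁ t₂ : ℕ} :
      p.Holds I k s → Exec I k P c s t₁ s' → Exec I k P (.loop p c) s' t₂ s'' →
        Exec I k P (.loop p c) s (1 + p.size + t₁ + t₂) s''
  | loopFalse {p : BExp} {c : Com} {s : Store} :
      ¬ p.Holds I k s → Exec I k P (.loop p c) s (1 + p.size) s
  | call {i : ℕ} {c : Com} {s s' : Store} {t : ℕ} :
      P[i]? = some c → Exec I k P c s t s' → Exec I k P (.call i) s (1 + t) s'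

/-- The subgraph that a final store describes through its first `n` natural-number cells: cell `v`
holds `0` if `v` is not a vertex of the subgraph, `1` if it is a vertex without a parent,
and `u + 2` if it is a vertex with parent `u`, that is, if `(u, v)` is an edge. -/
def Store.output {n : ℕ} (s : Store) : Subgraph n where
  verts := Finset.univ.filter fun v => s.nat v ≠ 0
  edges := Finset.univ.filter fun e => s.nat e.2 = e.1 + 2

/-- The program, run on the instance `I` with the parameter `k` from the store that is zero
everywhere, halts after `t` time units and returns the subgraph `T`. -/
def Program.Returns (P : Program) (I : Instance) (k : ℕ) (t : ℕ) (T : Subgraph I.n) : Prop :=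
  ∃ s : Store, Exec I k P.procs P.main Store.zero t s ∧ s.output = T

/-- The function `log k / log log k` (natural logarithms); for `k ≤ 2`, where `log log k` is not a
positive number, it is replaced by `1`. -/
noncomputable def logRatio (k : ℕ) : ℝ :=
  if k ≤ 2 then 1 else Real.log k / Real.log (Real.log k)

end STO

/-! The algorithm is a recursive greedy search. A call receives a root `r`, a set `Y` of vertices
that the tree must contain, a set `X` that is already collected and a target `τ`; it looks for the
cheapest tree at `r` that contains `Y` and brings the reward of `X` together with the tree up to
`τ`. An unknown good tree is cut at a vertex `u` into a small part `P` hanging from `u` and a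
remainder `R` that contains `r` and `u`. The call guesses `u`, the part of `Y` that `P` has to cover
and a target for `P`; it solves `P` recursively, adds what was found to `X`, and then solves `R` for
the same `τ` with `u` as a new required vertex. Since every call minimizes the cost, neither the
budget nor its division between `P` and `R` is guessed.

Suppose calls for `P` lose a factor `p`. By submodularity, replacing `P` by the tree that was found
costs the remainder no more than the gain of `P` plus the gain already banked. The first is about
`p` times the banked gain, so a factor `p + 1` suffices for the whole, and the remainder may again
be solved with factor `p + 1`. Hence a long chain of second calls keeps the same factor and only
passing to `P` lowers it (`second_target_le`, `Attainable.step`).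

Ranks organize this. They are grouped into levels of `J = 8 s` ranks; a second call lowers the rank
by one, a first call drops to the largest multiple of `J` below the rank. One level multiplies the
admissible tree size by `s`, because about `J` pieces of size of order `s ^ i` exhaust a tree of
size of order `s ^ (i + 1)` (`exists_rank_split`). So trees with `k` vertices need about `log k /
log s` levels, and this is the factor. Required vertices carry a weight in the size bound, which
limits them to `J + 7`; their subsets can then be enumerated by numbers below `2 ^ (J + 7)`.

Targets are guessed as multiples of the value `M` of the best single vertex of the optimum, after
the reward is scaled by `2 ^ e`; the total rounding error is then at most half of the optimum
(`rkE_pl`, `le_of_outGood`), whence the factor `2 (d + 2)` for depth `d`. Each rank multiplies the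
time by the number of guesses, so with `2 n` as the base the exponent is of order `s ^ 2 (d + 1)`.
Taking `s` to be about a small power of `log k` gives exponent `O(log ^ (1 + ε) k)` and depth `O(log
k / log log k)`.

The second half of the proof implements the recursion on the machine. For each command, soundness
(`Sol`: what is stored is a genuine tree) and completeness (`Got`: it is at least as cheap as any
attainable one) are carried along with a time bound; `spec_call` puts them together by induction on
the rank. -/

namespace STO

/-! ### Branchings -/

/-- A rooted tree in the left-child right-sibling encoding; the root itself is not recorded.
`node c sub rest` is the tree `rest` with a further child `c` of the root, from which `sub`
hangs. -/
inductive Branching (α : Type) where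
  | nil
  | node (c : α) (sub rest : Branching α)

namespace Branching

variable {α : Type} [DecidableEq α]

/-- The vertices other than the root. -/
def heads : Branching α → Finset α
  | nil => ∅
  | node c sub rest => insert c (sub.heads ∪ rest.heads)

/-- The number of edges. -/
def size : Branching α → ℕ
  | nil => 0
  | node _ sub rest => sub.size + rest.size + 1

/-- The total edge cost, for the root `r`. -/
def cost (w : α × α → ℕ) : α → Branching α → ℕ
  | _, nil => 0
  | r, node c sub rest => w (r, c) + sub.cost w c + rest.cost w r

/-- All edges, for the root `r`, belong to `E`. -/
def Valid (E : Finset (α × α)) : α → Branching α → Prop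
  | _, nil => True
  | r, node c sub rest => (r, c) ∈ E ∧ sub.Valid E c ∧ rest.Valid E r

/-- Only an inequality: the encoding does not force the heads to be distinct. This freedom lets
branchings be cut and extended without side conditions. -/
theorem card_heads_le (b : Branching α) : b.heads.card ≤ b.size := by
  induction b with
  | nil => simp [heads, size]
  | node c sub rest ih₁ ih₂ =>
    have h₁ := Finset.card_insert_le c (sub.heads ∪ rest.heads)
    have h₂ := Finset.card_union_le sub.heads rest.heads
    simp only [heads, size]
    omega

theorem exists_add_leaf (w : α × α → ℕ) (E : Finset (α × α)) (b : Branching α) (r u c : α)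
    (hu : u = r ∨ u ∈ b.heads) (hb : b.Valid E r) (hE : (u, c) ∈ E) :
    ∃ b' : Branching α, b'.heads = insert c b.heads ∧ b'.size = b.size + 1 ∧
      b'.cost w r = b.cost w r + w (u, c) ∧ b'.Valid E r := by
  induction b generalizing r with
  | nil =>
    obtain rfl : u = r := by simpa [heads] using hu
    exact ⟨node c nil nil, by simp [heads], by simp [size], by simp [cost], by simpa [Valid] using hE⟩
  | node x sub rest ih₁ ih₂ =>
    obtain ⟨hx, hsub, hrest⟩ := hb
    by_cases hur : u = r
    · subst hur
      exact ⟨node c nil (node x sub rest), by simp [heads], by simp [size],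
        by simp only [cost]; omega, hE, trivial, hx, hsub, hrest⟩
    by_cases hs : u = x ∨ u ∈ sub.heads
    · obtain ⟨b', h₁, h₂, h₃, h₄⟩ := ih₁ x hs hsub
      refine ⟨node x b' rest, ?_, by simp only [size]; omega, by simp only [cost]; omega,
        hx, h₄, hrest⟩
      simp only [heads, h₁]
      ext y; simp only [Finset.mem_insert, Finset.mem_union]; tauto
    · have hr : u ∈ rest.heads := by
        simp only [heads, Finset.mem_insert, Finset.mem_union] at hu
        tauto
      obtain ⟨b', h₁, h₂, h₃, h₄⟩ := ih₂ r (Or.inr hr) hrest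
      refine ⟨node x sub b', ?_, by simp only [size]; omega, by simp only [cost]; omega,
        hx, hsub, h₄⟩
      simp only [heads, h₁]
      ext y; simp only [Finset.mem_insert, Finset.mem_union]; tauto

/-- A subtree of the binary encoding consists of some children of one vertex `u` with all their
descendants, so it can be cut off at `u`. An edge weighs `1` and a vertex of `N` an extra `q`. A
node weighs at most `1 + q` more than its two subtrees; if it weighs at least `2 t + q`, one of them
still weighs at least `t`, so descending from the top stops at a piece of weight between `t` and `2
t + q - 1`. -/
theorem exists_split (w : α × α → ℕ) (E : Finset (α × α)) (N : Finset α) (q t : ℕ)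
    (b : Branching α) (r : α) (hb : b.Valid E r) (ht : 0 < t)
    (hw : t ≤ b.size + q * (N ∩ b.heads).card) :
    ∃ (u : α) (P R : Branching α), (u = r ∨ u ∈ R.heads) ∧ b.heads = P.heads ∪ R.heads ∧
      b.size = P.size + R.size ∧ b.cost w r = P.cost w u + R.cost w r ∧
      P.Valid E u ∧ R.Valid E r ∧ t ≤ P.size + q * (N ∩ P.heads).card ∧
      P.size + q * (N ∩ P.heads).card + 1 ≤ 2 * t + q := by
  induction b generalizing r with
  | nil => simp [heads, size] at hw; omega
  | node c sub rest ih₁ ih₂ =>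
    by_cases hbig : (node c sub rest).size + q * (N ∩ (node c sub rest).heads).card + 1 ≤ 2 * t + q
    · exact ⟨r, node c sub rest, nil, Or.inl rfl, by simp [heads], by simp [size],
        by simp [cost], hb, trivial, hw, hbig⟩
    obtain ⟨hx, hsub, hrest⟩ := hb
    have hcard : (N ∩ (node c sub rest).heads).card
        ≤ 1 + (N ∩ sub.heads).card + (N ∩ rest.heads).card := by
      have hsub : N ∩ (node c sub rest).heads ⊆ insert c ((N ∩ sub.heads) ∪ (N ∩ rest.heads)) := by
        intro y; simp only [heads, Finset.mem_inter, Finset.mem_insert, Finset.mem_union]; tauto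
      have h₁ := Finset.card_le_card hsub
      have h₂ := Finset.card_insert_le c ((N ∩ sub.heads) ∪ (N ∩ rest.heads))
      have h₃ := Finset.card_union_le (N ∩ sub.heads) (N ∩ rest.heads)
      omega
    have hmul := Nat.mul_le_mul_left q hcard
    rw [mul_add, mul_add] at hmul
    have hsz : (node c sub rest).size = sub.size + rest.size + 1 := rfl
    by_cases hs : t ≤ sub.size + q * (N ∩ sub.heads).card
    · obtain ⟨u, P, R, h₁, h₂, h₃, h₄, h₅, h₆, h₇⟩ := ih₁ c hsub hs
      refine ⟨u, P, node c R rest, ?_, ?_, ?_, ?_, h₅, ⟨hx, h₆, hrest⟩, h₇⟩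
      · right; simp only [heads, Finset.mem_insert, Finset.mem_union]; tauto
      · simp only [heads, h₂]
        ext y; simp only [Finset.mem_insert, Finset.mem_union]; tauto
      · simp only [size]; omega
      · simp only [cost]; omega
    · obtain ⟨u, P, R, h₁, h₂, h₃, h₄, h₅, h₆, h₇⟩ := ih₂ r hrest (by omega)
      refine ⟨u, P, node c sub R, ?_, ?_, ?_, ?_, h₅, ⟨hx, hsub, h₆⟩, h₇⟩
      · rcases h₁ with h₁ | h₁
        · exact Or.inl h₁
        · right; simp only [heads, Finset.mem_insert, Finset.mem_union]; tauto
      · simp only [heads, h₂]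
        ext y; simp only [Finset.mem_insert, Finset.mem_union]; tauto
      · simp only [size]; omega
      · simp only [cost]; omega

end Branching

/-- A feasible solution can be written as a branching. -/
theorem Instance.IsFeasible.exists_branching {I : Instance} {T : Subgraph I.n}
    (hT : I.IsFeasible T) :
    ∃ b : Branching (Fin I.n), b.Valid I.edges I.root ∧ insert I.root b.heads = T.verts ∧
      b.size + 1 ≤ T.verts.card ∧ b.cost I.cost I.root ≤ I.budget := by
  obtain ⟨hA, hE, hc⟩ := hT
  -- Grow the branching by one edge of `T` at a time. Its cost is charged to the edges of `T` that
  -- enter covered vertices.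
  have key : ∀ m : ℕ, m + 1 ≤ T.verts.card → ∃ b : Branching (Fin I.n), b.Valid I.edges I.root ∧
      insert I.root b.heads ⊆ T.verts ∧ (insert I.root b.heads).card = m + 1 ∧ b.size = m ∧
      b.cost I.cost I.root ≤ ∑ e ∈ T.edges.filter (fun e => e.2 ∈ insert I.root b.heads), I.cost e := by
    intro m
    induction m with
    | zero =>
      intro _
      exact ⟨.nil, trivial, by simpa [Branching.heads] using hA.root_mem, by simp [Branching.heads],
        rfl, by simp [Branching.cost]⟩
    | succ m ih =>
      intro hm
      obtain ⟨b, h₁, h₂, h₃, h₄, h₅⟩ := ih (by omega)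
      -- Were there no edge leaving the covered set, reachability from the root would place all of
      -- `T` inside it.
      obtain ⟨x, y, hxy, hx, hy⟩ : ∃ x y, (x, y) ∈ T.edges ∧ x ∈ insert I.root b.heads ∧
          y ∉ insert I.root b.heads := by
        by_contra! hno
        have : T.verts ⊆ insert I.root b.heads := by
          intro v hv
          induction hA.reachable v hv with
          | refl => simp
          | tail _ hst ih => exact hno _ _ hst (ih (hA.edge_mem _ _ hst).1)
        have := Finset.card_le_card this
        omega
      obtain ⟨b', g₁, g₂, g₃, g₄⟩ := b.exists_add_leaf I.cost I.edges I.root x y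
        (by simpa using hx) h₁ (hE hxy)
      have hins : insert I.root b'.heads = insert y (insert I.root b.heads) := by
        rw [g₁, Finset.insert_comm]
      refine ⟨b', g₄, ?_, ?_, by omega, ?_⟩
      · rw [hins]
        exact Finset.insert_subset (hA.edge_mem _ _ hxy).2 h₂
      · rw [hins, Finset.card_insert_of_notMem hy, h₃]
      · rw [g₃, hins]
        -- The vertex `y` was not covered before, so the edge that enters it has not been charged
        -- yet.
        have hnot : (x, y) ∉ T.edges.filter (fun e => e.2 ∈ insert I.root b.heads) := by
          simp only [Finset.mem_filter]; tauto
        have hsub : insert (x, y) (T.edges.filter (fun e => e.2 ∈ insert I.root b.heads)) ⊆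
            T.edges.filter (fun e => e.2 ∈ insert y (insert I.root b.heads)) := by
          intro e he
          rcases Finset.mem_insert.1 he with rfl | he
          · simp [hxy]
          · simp only [Finset.mem_filter, Finset.mem_insert] at he ⊢
            tauto
        have := Finset.sum_le_sum_of_subset (f := I.cost) hsub
        rw [Finset.sum_insert hnot] at this
        omega
  have hpos : 0 < T.verts.card := Finset.card_pos.2 ⟨_, hA.root_mem⟩
  obtain ⟨b, h₁, h₂, h₃, h₄, h₅⟩ := key (T.verts.card - 1) (by omega)
  refine ⟨b, h₁, Finset.eq_of_subset_of_card_le h₂ (by omega), by omega, h₅.trans (le_trans ?_ hc)⟩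
  exact Finset.sum_le_sum_of_subset (Finset.filter_subset _ _)

/-! ### Parent maps -/

section ParentMap
variable {I : Instance}

/-- The vertices of the subgraph described by a parent map, in the encoding of `Store.output`. -/
def pverts (S : Fin I.n → ℕ) : Finset (Fin I.n) := Finset.univ.filter fun v => S v ≠ 0

/-- The edges of the subgraph described by a parent map. -/
def pedges (S : Fin I.n → ℕ) : Finset (Fin I.n × Fin I.n) :=
  Finset.univ.filter fun e => S e.2 = e.1 + 2

theorem mem_pverts {S : Fin I.n → ℕ} {v : Fin I.n} : v ∈ pverts S ↔ S v ≠ 0 := by simp [pverts]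

theorem mem_pedges {S : Fin I.n → ℕ} {e : Fin I.n × Fin I.n} :
    e ∈ pedges S ↔ S e.2 = e.1 + 2 := by simp [pedges]

/-- `S` describes an arborescence of the graph of `I`, rooted at `r`. -/
structure IsParentMap (I : Instance) (r : Fin I.n) (S : Fin I.n → ℕ) : Prop where
  root : S r = 1
  parent : ∀ v, v ≠ r → S v ≠ 0 → ∃ u : Fin I.n, S v = u + 2 ∧ S u ≠ 0 ∧ (u, v) ∈ I.edges
  reach : ∀ v, S v ≠ 0 → Relation.ReflTransGen (fun a b : Fin I.n => S b = a + 2) r v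

/-- A map assigns at most one parent to each vertex, so uniqueness of the incoming edge is
automatic. The code `1` of the root is below every code `u + 2`, so no edge enters it. -/
theorem IsParentMap.isFeasible {S : Fin I.n → ℕ} (h : IsParentMap I I.root S)
    (hc : ∑ e ∈ pedges S, I.cost e ≤ I.budget) : I.IsFeasible ⟨pverts S, pedges S⟩ := by
  have hedge : ∀ u v, (u, v) ∈ pedges S → v ≠ I.root ∧ S u ≠ 0 ∧ S v ≠ 0 ∧ (u, v) ∈ I.edges := by
    intro u v huv
    have hv : S v = u + 2 := by simpa [pedges] using huv
    have hne : v ≠ I.root := by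
      rintro rfl
      have := h.root
      omega
    obtain ⟨u', h₁, h₂, h₃⟩ := h.parent v hne (by omega)
    obtain rfl : u = u' := Fin.ext (by omega)
    exact ⟨hne, h₂, by omega, h₃⟩
  refine ⟨⟨?_, ?_, ?_, ?_, ?_⟩, ?_, hc⟩
  · simp [pverts, h.root]
  · intro u v huv
    obtain ⟨_, h₂, h₃, _⟩ := hedge u v huv
    simp [pverts, h₂, h₃]
  · exact fun u hu => (hedge u _ hu).1 rfl
  · intro v hv hne
    obtain ⟨u, h₁, -, -⟩ := h.parent v hne (by simpa [pverts] using hv)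
    refine ⟨u, by simpa [pedges] using h₁, fun u' hu' => Fin.ext ?_⟩
    have : S v = u' + 2 := by simpa [pedges] using hu'
    omega
  · intro v hv
    have := h.reach v (by simpa [pverts] using hv)
    exact Relation.ReflTransGen.mono (fun a b hab => by simpa [pedges] using hab) _ _ this
  · rintro ⟨u, v⟩ huv
    exact (hedge u v huv).2.2.2

/-- The union of two parent maps, where the first one takes precedence. -/
def pmerge (R P : Fin I.n → ℕ) : Fin I.n → ℕ := fun v => if R v ≠ 0 then R v else P v

theorem pverts_pmerge (R P : Fin I.n → ℕ) : pverts (pmerge R P) = pverts R ∪ pverts P := by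
  ext v
  simp only [mem_pverts, pmerge, Finset.mem_union]
  split_ifs <;> tauto

theorem cost_pmerge_le (R P : Fin I.n → ℕ) :
    ∑ e ∈ pedges (pmerge R P), I.cost e
      ≤ ∑ e ∈ pedges P, I.cost e + ∑ e ∈ pedges R, I.cost e := by
  have hsub : pedges (pmerge R P) ⊆ pedges P ∪ pedges R := by
    intro e
    simp only [mem_pedges, pmerge, Finset.mem_union]
    split_ifs <;> tauto
  have h₁ := Finset.sum_le_sum_of_subset (f := I.cost) hsub
  have h₂ := Finset.sum_union_inter (s₁ := pedges P) (s₂ := pedges R) (f := I.cost)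
  omega

/-- The two trees may overlap, but the overlap does no harm when the tree at `r` takes precedence.
Along a path of `P` from `u`, every vertex of `R` is reached inside `R`, and every other vertex
keeps its edge from `P`. Since `u` lies in `R`, all of `P` stays connected to `r`. -/
theorem IsParentMap.merge {r u : Fin I.n} {R P : Fin I.n → ℕ} (hR : IsParentMap I r R)
    (hP : IsParentMap I u P) (hu : R u ≠ 0) : IsParentMap I r (pmerge R P) := by
  have hreachR : ∀ v, R v ≠ 0 →
      Relation.ReflTransGen (fun a b : Fin I.n => pmerge R P b = a + 2) r v := by
    intro v hv
    refine Relation.ReflTransGen.mono (fun a b hab => ?_) _ _ (hR.reach v hv)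
    simp [pmerge, hab]
  refine ⟨by simp [pmerge, hR.root], ?_, ?_⟩
  · intro v hv hv0
    by_cases h : R v = 0
    · have hPv : P v ≠ 0 := by simpa [pmerge, h] using hv0
      obtain ⟨x, h₁, h₂, h₃⟩ := hP.parent v (fun hvu => hu (hvu ▸ h)) hPv
      refine ⟨x, by simp [pmerge, h, h₁], ?_, h₃⟩
      simp only [pmerge]; split_ifs <;> assumption
    · obtain ⟨x, h₁, h₂, h₃⟩ := hR.parent v hv h
      exact ⟨x, by simp [pmerge, h₁], by simp [pmerge, h₂], h₃⟩
  · intro v hv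
    by_cases h : R v = 0
    · have hPv : P v ≠ 0 := by simpa [pmerge, h] using hv
      clear hv h
      induction hP.reach v hPv with
      | refl => exact hreachR _ hu
      | @tail a b hab hb ih =>
        by_cases hRb : R b = 0
        · have hPa : P a ≠ 0 := by
            by_cases hbu : b = u
            · have := hP.root; rw [hbu] at hb; omega
            · obtain ⟨x, h₁, h₂, h₃⟩ := hP.parent b hbu (by omega)
              obtain rfl : a = x := Fin.ext (by omega)
              exact h₂
          exact (ih hPa).tail (by simp [pmerge, hRb, hb])
        · exact hreachR _ hRb
    · exact hreachR v h

/-- The parent map of the tree that consists of the edge from `r` to `c`, or of the vertex `r`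
alone if `c = r`. -/
def pedge (r c : Fin I.n) : Fin I.n → ℕ :=
  fun v => if v = r then 1 else if v = c then (r : ℕ) + 2 else 0

theorem pverts_pedge (r c : Fin I.n) : pverts (pedge r c) = {r, c} := by
  ext v
  simp only [mem_pverts, pedge, Finset.mem_insert, Finset.mem_singleton]
  split_ifs <;> simp_all

theorem isParentMap_pedge {r c : Fin I.n} (h : c = r ∨ (r, c) ∈ I.edges) :
    IsParentMap I r (pedge r c) := by
  refine ⟨by simp [pedge], ?_, ?_⟩
  · intro v hv hv0
    have hvc : v = c := by
      by_contra hvc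
      simp [pedge, hv, hvc] at hv0
    subst hvc
    exact ⟨r, by simp [pedge, hv], by simp [pedge], by tauto⟩
  · intro v hv0
    by_cases hv : v = r
    · subst hv; exact .refl
    have hvc : v = c := by
      by_contra hvc
      simp [pedge, hv, hvc] at hv0
    subst hvc
    exact .single (by simp [pedge, hv])

theorem cost_pedge_le (r c : Fin I.n) :
    ∑ e ∈ pedges (pedge r c), I.cost e ≤ if c = r then 0 else I.cost (r, c) := by
  have hsub : pedges (pedge r c) ⊆ if c = r then ∅ else {(r, c)} := by
    rintro ⟨x, v⟩ he
    simp only [mem_pedges, pedge] at he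
    split_ifs at he with h₁ h₂
    · omega
    · subst h₂
      rw [if_neg h₁]
      have : r = x := Fin.ext (by omega)
      simp [this]
  have := Finset.sum_le_sum_of_subset (f := I.cost) hsub
  split_ifs at this ⊢ <;> simpa using this

end ParentMap

/-! ### The parameters of a recursion of rank `l` -/

/-- The rank of the first recursive call. -/
def rkPl (J l : ℕ) : ℕ := J * ((l - 1) / J)

/-- The weight of a required vertex, relative to an edge. -/
def rkW (J s l : ℕ) : ℕ := if l ≤ J then 0 else s ^ ((l - 1) / J)

/-- The largest weight of the trees that are considered. -/
def rkCap (J s l : ℕ) : ℕ :=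
  if l ≤ J then l + 1 else (6 + (l - 1) % J) * s ^ ((l - 1) / J) - 1

/-- The approximation factor. -/
def rkA (J l : ℕ) : ℕ := (l + J - 1) / J + 1

/-- The additive error. -/
def rkE (J l : ℕ) : ℕ := if l = 0 then 0 else 2 * ((l - 1) % J + 2) * (J + 2) ^ ((l - 1) / J)

theorem rkPl_le (J l : ℕ) : rkPl J (l + 1) ≤ l := Nat.mul_div_le _ _

/-- The machine has no division, so each frame stores the rank of its first recursive call. This is
how that number is updated when the first call is made; `rkPl_eq` serves the second call. -/
theorem rkPl_rkPl_succ {J : ℕ} (hJ : 0 < J) (l : ℕ) : rkPl J (rkPl J (l + 1)) = rkPl J (l + 1) - J := by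
  simp only [rkPl, Nat.add_sub_cancel]
  generalize l / J = i
  cases i with
  | zero => simp
  | succ i =>
    rw [Nat.mul_succ, Nat.add_sub_cancel, Nat.add_sub_assoc hJ, Nat.mul_add_div hJ,
      Nat.div_eq_of_lt (by omega), Nat.add_zero]

theorem rk_level {J : ℕ} (hJ : 0 < J) {i j : ℕ} (hj : j < J) :
    (J * i + j) / J = i ∧ (J * i + j) % J = j := by
  rw [Nat.mul_add_div hJ, Nat.mul_add_mod, Nat.div_eq_of_lt hj, Nat.mod_eq_of_lt hj]
  simp

theorem exists_rk_level {J : ℕ} (hJ : 0 < J) (l : ℕ) : ∃ i j, j < J ∧ l = J * i + j :=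
  ⟨l / J, l % J, Nat.mod_lt _ hJ, (Nat.div_add_mod l J).symm⟩

theorem rkPl_eq {J : ℕ} (hJ : 0 < J) (l : ℕ) :
    rkPl J l = if l = rkPl J (l + 1) then rkPl J (l + 1) - J else rkPl J (l + 1) := by
  split_ifs with h
  · conv_lhs => rw [h]
    exact rkPl_rkPl_succ hJ l
  · obtain ⟨i, j, hj, rfl⟩ := exists_rk_level hJ l
    simp only [rkPl, Nat.add_sub_cancel, (rk_level hJ hj).1] at h ⊢
    rw [Nat.add_sub_assoc (by omega), (rk_level hJ (by omega)).1]

/-! ### The parameters at the positive rank `J * i + j + 1`: level `i`, position `j < J`. -/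

section
variable {J s i j : ℕ} (hJ : 0 < J) (hj : j < J)
include hJ hj

theorem rkPl_level : rkPl J (J * i + j + 1) = J * i := by
  simp [rkPl, (rk_level hJ hj).1]

theorem rkW_level : rkW J s (J * i + j + 1) = if i = 0 then 0 else s ^ i := by
  simp only [rkW, Nat.add_sub_cancel, (rk_level hJ hj).1]
  rcases Nat.eq_zero_or_pos i with rfl | hi
  · rw [if_pos (by omega), if_pos rfl]
  · have : J * 1 ≤ J * i := Nat.mul_le_mul_left _ hi
    rw [if_neg (by omega), if_neg (by omega)]

theorem rkCap_level : rkCap J s (J * i + j + 1) = if i = 0 then j + 2 else (6 + j) * s ^ i - 1 := by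
  simp only [rkCap, Nat.add_sub_cancel, (rk_level hJ hj).1, (rk_level hJ hj).2]
  rcases Nat.eq_zero_or_pos i with rfl | hi
  · rw [if_pos (by omega), if_pos rfl]; omega
  · have : J * 1 ≤ J * i := Nat.mul_le_mul_left _ hi
    rw [if_neg (by omega), if_neg (by omega)]

theorem rkA_level : rkA J (J * i + j + 1) = i + 2 := by
  have : J * i + j + 1 + J - 1 = J * (i + 1) + j := by rw [Nat.mul_succ]; omega
  rw [rkA, this, (rk_level hJ hj).1]

theorem rkE_level : rkE J (J * i + j + 1) = 2 * (j + 2) * (J + 2) ^ i := by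
  simp [rkE, (rk_level hJ hj).1, (rk_level hJ hj).2]

end

theorem rkA_mul {J : ℕ} (hJ : 0 < J) (i : ℕ) : rkA J (J * i) = i + 1 := by
  rw [rkA, Nat.add_sub_assoc hJ, (rk_level hJ (by omega)).1]

theorem rkA_mono (J : ℕ) {l l' : ℕ} (h : l ≤ l') : rkA J l ≤ rkA J l' := by
  simp only [rkA]
  gcongr

/-- The point of the levels: the factor exceeds that of the first call by exactly one, whatever the
position inside the level, so second calls inside the level do not increase it. -/
theorem rkA_pl {J : ℕ} (hJ : 0 < J) (l : ℕ) : rkA J (l + 1) = rkA J (rkPl J (l + 1)) + 1 := by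
  obtain ⟨i, j, hj, rfl⟩ := exists_rk_level hJ l
  rw [rkPl_level hJ hj, rkA_level hJ hj, rkA_mul hJ]

/-- The rank `J * (i + 1)` in the form of the level lemmas. -/
theorem mul_succ_eq {J : ℕ} (hJ : 0 < J) (i : ℕ) : J * (i + 1) = J * i + (J - 1) + 1 := by
  rw [Nat.mul_succ]; omega

theorem rkE_mul_succ {J : ℕ} (hJ : 0 < J) (i : ℕ) :
    rkE J (J * (i + 1)) = 2 * (J + 1) * (J + 2) ^ i := by
  rw [mul_succ_eq hJ, rkE_level hJ (by omega)]
  rw [show J - 1 + 2 = J + 1 by omega]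

/-- The recurrence for the rounding error: the error of the second call, one grid step times the
factor of the first call, and the error of the first call. -/
theorem rkE_pl {J : ℕ} (hJ : 0 < J) (l : ℕ) :
    rkE J l + rkA J (rkPl J (l + 1)) + rkE J (rkPl J (l + 1)) ≤ rkE J (l + 1) := by
  obtain ⟨i, j, hj, rfl⟩ := exists_rk_level hJ l
  rw [rkPl_level hJ hj, rkE_level hJ hj, rkA_mul hJ]
  -- Each rank of level `i` adds the same amount, at most `2 * (J + 2) ^ i`; the `J` ranks of a
  -- level therefore multiply the error by about `J + 2`.
  have hE : i + 1 + rkE J (J * i) ≤ 2 * (J + 2) ^ i := by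
    cases i with
    | zero => simp [rkE]
    | succ i =>
      rw [rkE_mul_succ hJ]
      have h : i + 1 < 2 ^ (i + 1) := Nat.lt_two_pow_self
      have h' : 2 ^ i ≤ (J + 2) ^ i := Nat.pow_le_pow_left (by omega) i
      rw [pow_succ] at h
      rw [pow_succ]
      nlinarith
  cases j with
  | zero =>
    have : rkE J (J * i) ≤ 2 * (J + 2) ^ i := by omega
    simp only [Nat.add_zero, Nat.zero_add]
    nlinarith
  | succ j =>
    rw [show J * i + (j + 1) = J * i + j + 1 from rfl, rkE_level hJ (by omega)]
    nlinarith

theorem rkE_add_rkA_le {J : ℕ} (hJ : 0 < J) (i : ℕ) :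
    rkE J (J * (i + 1)) + rkA J (J * (i + 1)) ≤ 2 * (J + 2) ^ (i + 1) := by
  rw [rkE_mul_succ hJ, rkA_mul hJ]
  have h : i + 1 < 2 ^ (i + 1) := Nat.lt_two_pow_self
  have h' : 2 ^ i ≤ (J + 2) ^ i := Nat.pow_le_pow_left (by omega) i
  rw [pow_succ] at h
  rw [pow_succ]
  nlinarith

/-- The least weight of the tree of the first recursive call. -/
def rkT (J s l : ℕ) : ℕ := if l ≤ J then 1 else 2 * s ^ ((l - 1) / J)

theorem rkT_level {J s i j : ℕ} (hJ : 0 < J) (hj : j < J) :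
    rkT J s (J * i + j + 1) = if i = 0 then 1 else 2 * s ^ i := by
  simp only [rkT, Nat.add_sub_cancel, (rk_level hJ hj).1]
  rcases Nat.eq_zero_or_pos i with rfl | hi
  · rw [if_pos (by omega), if_pos rfl]
  · have : J * 1 ≤ J * i := Nat.mul_le_mul_left _ hi
    rw [if_neg (by omega), if_neg (by omega)]

theorem rkT_pos {J s : ℕ} (hs : 0 < s) (l : ℕ) : 0 < rkT J s l := by
  rw [rkT]; split_ifs <;> positivity

/-! ### Size bookkeeping: both pieces of a split fit their recursive calls. -/

section
variable {J s : ℕ} (hs : 0 < s) (hJ : 8 * s = J)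
include hs hJ

/-- This is where `J = 8 s` enters: the capacity grows by `s ^ i` with each of the `J` ranks of
level `i`, in total by `8 * s ^ (i + 1)`. Five units of the next level are needed: a piece cut with
threshold `t = 2 * s ^ (i + 1)` and vertex weight `s ^ (i + 1)` weighs less than `2 t + s ^ (i +
1)`. -/
theorem rkCap_mul_succ (i : ℕ) : 5 * s ^ (i + 1) ≤ rkCap J s (J * (i + 1)) := by
  have hJ0 : 0 < J := by omega
  rw [mul_succ_eq hJ0, rkCap_level hJ0 (by omega)]
  have hp : 0 < s ^ i := by positivity
  split_ifs with h
  · subst h; simp; omega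
  · have : (6 + (J - 1)) * s ^ i = 5 * s ^ i + J * s ^ i := by
      rw [← Nat.add_mul]; congr 1; omega
    rw [this, ← hJ, pow_succ]
    have : s ^ i * s = s * s ^ i := mul_comm _ _
    rw [this, mul_assoc]
    generalize s * s ^ i = q
    omega

theorem rkW_mono {l l' : ℕ} (h : l ≤ l') : rkW J s l ≤ rkW J s l' := by
  have hJ0 : 0 < J := by omega
  simp only [rkW]
  split_ifs
  · exact le_rfl
  · exact Nat.zero_le _
  · omega
  · exact Nat.pow_le_pow_right hs (Nat.div_le_div_right (by omega))

theorem rk_first (l : ℕ) :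
    2 * rkT J s (l + 1) + rkW J s (l + 1) ≤ rkCap J s (rkPl J (l + 1)) + 1 := by
  have hJ0 : 0 < J := by omega
  obtain ⟨i, j, hj, rfl⟩ := exists_rk_level hJ0 l
  rw [rkPl_level hJ0 hj, rkT_level hJ0 hj, rkW_level hJ0 hj]
  cases i with
  | zero => simp [rkCap]
  | succ i =>
    have := rkCap_mul_succ hs hJ i
    simp only [Nat.add_eq_zero_iff, one_ne_zero, and_false, if_false]
    omega

/-- The remainder loses weight at least `rkT` and gains one required vertex of weight `rkW`. On
positive levels the net loss is `s ^ i`, the amount by which the capacity falls with the rank; on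
level zero a single edge is removed and required vertices weigh nothing. The second inequality is
for a tree too light to be cut, which already fits the smaller rank. -/
theorem rk_second (l : ℕ) :
    rkCap J s (l + 1) + rkW J s (l + 1) ≤ rkCap J s l + rkT J s (l + 1) ∧
      rkT J s (l + 1) ≤ rkCap J s l + 1 := by
  have hJ0 : 0 < J := by omega
  obtain ⟨i, j, hj, rfl⟩ := exists_rk_level hJ0 l
  rw [rkT_level hJ0 hj, rkW_level hJ0 hj, rkCap_level hJ0 hj]
  have hp : 0 < s ^ i := by positivity
  cases i with
  | zero =>
    simp only [Nat.mul_zero, Nat.zero_add, if_true]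
    rw [rkCap, if_pos (by omega)]
    omega
  | succ i =>
    simp only [Nat.add_eq_zero_iff, one_ne_zero, and_false, if_false]
    cases j with
    | zero =>
      have := rkCap_mul_succ hs hJ i
      simp only [Nat.add_zero]
      omega
    | succ j =>
      rw [show J * (i + 1) + (j + 1) = J * (i + 1) + j + 1 from rfl, rkCap_level hJ0 (by omega)]
      simp only [Nat.add_eq_zero_iff, one_ne_zero, and_false, if_false]
      rw [show 6 + (j + 1) = (6 + j) + 1 by omega, Nat.add_mul, one_mul]
      have : 6 * s ^ (i + 1) ≤ (6 + j) * s ^ (i + 1) := Nat.mul_le_mul_right _ (by omega)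
      omega

/-- The reason for weighting required vertices: their number stays bounded in terms of `J`, although
each second call adds one. On level zero the weight is zero, and the number of edges gives the
bound. -/
theorem rkW_mul_le (l c b : ℕ) (hb : c ≤ b) (h : b + rkW J s (l + 1) * c ≤ rkCap J s (l + 1)) :
    c ≤ J + 6 := by
  have hJ0 : 0 < J := by omega
  obtain ⟨i, j, hj, rfl⟩ := exists_rk_level hJ0 l
  rw [rkW_level hJ0 hj, rkCap_level hJ0 hj] at h
  split_ifs at h with hi
  · omega
  · have hp : 0 < s ^ i := by positivity
    have : s ^ i * c ≤ s ^ i * (6 + j) := by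
      rw [mul_comm _ (6 + j)]; omega
    have := Nat.le_of_mul_le_mul_left this hp
    omega

end

/-! ### The analysis of one level of the recursion -/

section
variable (I : Instance) (F : Finset (Fin I.n) → ℝ) (M : ℝ) (N J s : ℕ)

/-- A recursive call of rank `l` has to find a tree of cost at most `c`. -/
def Attainable (l : ℕ) (r : Fin I.n) (Y X : Finset (Fin I.n)) (τ : ℝ) (c : ℕ) : Prop :=
  ∃ b : Branching (Fin I.n), b.Valid I.edges r ∧ b.cost I.cost r ≤ c ∧ Y ⊆ insert r b.heads ∧
    b.size + rkW J s l * (Y.erase r).card ≤ rkCap J s l ∧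
    F (X ∪ insert r b.heads) < F X + N * M ∧
    (τ ≤ F X ∨ rkA J l * (τ - F X) + rkE J l * M ≤ F (X ∪ insert r b.heads) - F X)

variable {I F M N J s}

/-- At rank `0` the capacity is one, so the witness is the root alone or a single edge; the factor
is one and the error zero, so it meets the target itself. -/
theorem Attainable.base (hF : Monotone F) {r : Fin I.n} {Y X : Finset (Fin I.n)} {τ : ℝ} {c : ℕ}
    (h : Attainable I F M N J s 0 r Y X τ c) (hJ : 0 < J) :
    ∃ x : Fin I.n, (x = r ∨ (r, x) ∈ I.edges) ∧ (if x = r then 0 else I.cost (r, x)) ≤ c ∧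
      Y ⊆ {r, x} ∧ τ ≤ F (X ∪ {r, x}) := by
  obtain ⟨b, h₁, h₂, h₃, h₄, -, h₅⟩ := h
  have hA : rkA J 0 = 1 := by
    have := rkA_mul hJ 0
    simpa using this
  have hτ : τ ≤ F (X ∪ insert r b.heads) := by
    rcases h₅ with h₅ | h₅
    · exact h₅.trans (hF Finset.subset_union_left)
    · simp only [hA, rkE, if_true] at h₅
      push_cast at h₅
      linarith
  simp only [rkW, rkCap, Nat.zero_le, if_true] at h₄
  cases b with
  | nil =>
    refine ⟨r, Or.inl rfl, by simp, ?_, ?_⟩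
    · simpa [Branching.heads] using h₃
    · simpa [Branching.heads] using hτ
  | node x sub rest =>
    simp only [Branching.size] at h₄
    have hsub : sub = .nil := by
      cases sub with
      | nil => rfl
      | node _ _ _ => simp only [Branching.size] at h₄; omega
    have hrest : rest = .nil := by
      cases rest with
      | nil => rfl
      | node _ _ _ => simp only [Branching.size] at h₄; omega
    subst hsub hrest
    refine ⟨x, Or.inr h₁.1, ?_, ?_, ?_⟩
    · simp only [Branching.cost] at h₂
      split_ifs <;> omega
    · simpa [Branching.heads] using h₃
    · simpa [Branching.heads] using hτ

/-- Cuts the tree of an attainable call into trees for its two recursive calls. The requirement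
handed to `P` consists of the vertices of `Y` it happens to contain; `u` becomes a requirement of
`R`, so that the two trees can be joined. -/
theorem exists_rank_split (hs : 0 < s) (hJ : 8 * s = J) {l : ℕ} {r : Fin I.n}
    {Y : Finset (Fin I.n)} {b : Branching (Fin I.n)} (hv : b.Valid I.edges r)
    (herase : Y.erase r ⊆ b.heads)
    (hsz : b.size + rkW J s (l + 1) * (Y.erase r).card ≤ rkCap J s (l + 1)) :
      ∃ (u : Fin I.n) (P R : Branching (Fin I.n)), (u = r ∨ u ∈ R.heads) ∧
        b.heads = P.heads ∪ R.heads ∧ b.size = P.size + R.size ∧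
        b.cost I.cost r = P.cost I.cost u + R.cost I.cost r ∧ P.Valid I.edges u ∧
        R.Valid I.edges r ∧
        P.size + rkW J s (l + 1) * (Y.erase r ∩ P.heads).card ≤ rkCap J s (rkPl J (l + 1)) ∧
        R.size + rkW J s (l + 1) * ((insert u (Y \ (Y.erase r ∩ P.heads))).erase r).card ≤ rkCap J s l := by
  set w := rkW J s (l + 1) with hw
  set t := rkT J s (l + 1) with ht
  have hsec := rk_second hs hJ l
  by_cases hbig : t ≤ b.size + w * (Y.erase r ∩ b.heads).card
  · obtain ⟨u, P, R, h₁, h₂, h₃, h₄, h₅, h₆, h₇, h₈⟩ :=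
      b.exists_split I.cost I.edges (Y.erase r) w t r hv (rkT_pos hs _) hbig
    refine ⟨u, P, R, h₁, h₂, h₃, h₄, h₅, h₆, ?_, ?_⟩
    · have := rk_first hs hJ l
      omega
    -- The new required vertex `u` is the only one that does not come from `Y`, so it adds at most
    -- one weight.
    · have hins : ((insert u (Y \ (Y.erase r ∩ P.heads))).erase r).card + (Y.erase r ∩ P.heads).card
          ≤ (Y.erase r).card + 1 := by
        have h₉ : (insert u (Y \ (Y.erase r ∩ P.heads))).erase r ⊆
            insert u (Y.erase r \ (Y.erase r ∩ P.heads)) := by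
          intro y
          simp only [Finset.mem_erase, Finset.mem_insert, Finset.mem_sdiff, Finset.mem_inter]
          tauto
        have h₁₀ := (Finset.card_le_card h₉).trans (Finset.card_insert_le _ _)
        have h₁₁ := Finset.card_sdiff_add_card_eq_card
          (Finset.inter_subset_left (s₁ := Y.erase r) (s₂ := P.heads))
        omega
      have hmul := Nat.mul_le_mul_left w hins
      rw [Nat.mul_add, Nat.mul_add, mul_one] at hmul
      omega
  -- A tree lighter than the threshold is not cut: `P` is empty and hangs from `r`.
  · refine ⟨r, .nil, b, Or.inl rfl, by simp [Branching.heads], by simp [Branching.size],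
      by simp [Branching.cost], trivial, hv, by simp [Branching.size, Branching.heads], ?_⟩
    have : (insert r (Y \ (Y.erase r ∩ (Branching.nil : Branching (Fin I.n)).heads))).erase r
        = Y.erase r := by
      simp only [Branching.heads, Finset.inter_empty, Finset.sdiff_empty]
      ext y; simp only [Finset.mem_erase, Finset.mem_insert]; tauto
    rw [this]
    rw [Finset.inter_eq_left.2 herase] at hbig
    omega

/-- Take `v` as the floor of `(g - e * M) / (p * M)`, the largest target in units of `M` that a call
with factor `p` and error `e` is sure to reach from gain `g`. The natural floor is `0` when the
quotient is negative; then `v = 0` is harmless, being a target that is already met. -/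
theorem exists_grid_point {M g p e : ℝ} {N : ℕ} (hM : 0 < M) (hp1 : 1 ≤ p) (he : 0 ≤ e)
    (hg : 0 ≤ g) (hgN : g < N * M) :
    ∃ v : ℕ, v < N ∧ (v = 0 ∨ p * (v * M) + e * M ≤ g) ∧ g ≤ p * ((v + 1) * M) + e * M := by
  refine ⟨⌊(g - e * M) / (p * M)⌋₊, ?_, ?_, ?_⟩
  · have hN0 : 0 < N := by
      rcases Nat.eq_zero_or_pos N with h0 | h0
      · rw [h0] at hgN; simp at hgN; linarith
      · exact h0
    rw [Nat.floor_lt' hN0.ne', div_lt_iff₀ (by positivity)]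
    have : (N : ℝ) * M ≤ N * (p * M) := by
      gcongr
      nlinarith
    have : (0 : ℝ) ≤ e * M := by positivity
    linarith
  · rcases Nat.eq_zero_or_pos ⌊(g - e * M) / (p * M)⌋₊ with h0 | h0
    · exact Or.inl h0
    · right
      have := Nat.floor_le (a := (g - e * M) / (p * M)) (by
        by_contra hneg
        rw [Nat.floor_of_nonpos (by linarith)] at h0
        omega)
      rw [le_div_iff₀ (by positivity)] at this
      linarith
  · have := (Nat.lt_floor_add_one ((g - e * M) / (p * M))).le
    rw [div_le_iff₀ (by positivity)] at this
    linarith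

theorem marginal_le_marginal {F : Finset (Fin I.n) → ℝ} (hF : Monotone F)
    (hsub : ∀ S T, F (S ∪ T) + F (S ∩ T) ≤ F S + F T) {X X' : Finset (Fin I.n)} (hX : X ⊆ X')
    (A : Finset (Fin I.n)) : F (X' ∪ A) - F X' ≤ F (X ∪ A) - F X := by
  have h1 := hsub (X ∪ A) X'
  have h2 : X ∪ A ∪ X' = X' ∪ A := by
    rw [Finset.union_right_comm, Finset.union_eq_right.2 hX]
  have h3 : X ⊆ (X ∪ A) ∩ X' := Finset.subset_inter Finset.subset_union_left hX
  rw [h2] at h1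
  linarith [hF h3]

/-- Giving up `A` costs at most the gain of `A` over `X`, since its gain over the larger set `X' ∪
B` is no larger. With `A` the vertices of `P`, `B` those of `R` and `X'` enlarged by whatever tree
was found instead of `P`, this bounds what `R` still offers. -/
theorem le_union_of_marginal {F : Finset (Fin I.n) → ℝ} (hF : Monotone F)
    (hsub : ∀ S T, F (S ∪ T) + F (S ∩ T) ≤ F S + F T) {X X' : Finset (Fin I.n)} (hX : X ⊆ X')
    (A B : Finset (Fin I.n)) :
    F (X ∪ (A ∪ B)) - (F (X ∪ A) - F X) ≤ F (X' ∪ B) := by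
  have h1 := marginal_le_marginal hF hsub (hX.trans (Finset.subset_union_left (s₂ := B))) A
  have h2 : X ∪ (A ∪ B) ⊆ X' ∪ B ∪ A := by
    intro y
    simp only [Finset.mem_union]
    have := @hX y
    tauto
  linarith [hF h2]

/-- The accounting of the greedy step. From `x` to `x'` the first call has banked `x' - x`, at least
`v * M`. Of the `p + 1` copies of this gain in the main inequality, `p` copies pay for the lost gain
`g` up to rounding, and one pays for measuring from `x'` instead of `x`. So the factor `p + 1`
remains available for `τ - x'`. -/
theorem second_target_le {M p a e e' e'' v x x' τ g y y' : ℝ} (hM : 0 < M) (hp : 1 ≤ p)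
    (ha : a ≤ p + 1) (he : e + p + e' ≤ e'') (hgain : x + v * M ≤ x') (hτ : x' ≤ τ)
    (hmain : (p + 1) * (τ - x) + e'' * M ≤ y - x) (hg : g ≤ p * ((v + 1) * M) + e' * M)
    (hy : y - g ≤ y') : a * (τ - x') + e * M ≤ y' - x' := by
  have h₁ : a * (τ - x') ≤ (p + 1) * (τ - x') := mul_le_mul_of_nonneg_right ha (by linarith)
  have h₂ : p * (v * M) ≤ p * (x' - x) := mul_le_mul_of_nonneg_left (by linarith) (by linarith)
  have h₃ := mul_le_mul_of_nonneg_right he hM.le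
  linarith

/-- Some guess works. The second call must be attainable for every `X'` that meets the first target,
because the tree that the first call returns is not the witness `P`. -/
theorem Attainable.step (hF : Monotone F)
    (hsub : ∀ S T, F (S ∪ T) + F (S ∩ T) ≤ F S + F T) (hM : 0 < M)
    (hs : 0 < s) (hJ : 8 * s = J) {l : ℕ} {r : Fin I.n} {Y X : Finset (Fin I.n)} {τ : ℝ} {c : ℕ}
    (h : Attainable I F M N J s (l + 1) r Y X τ c) :
    Y.card ≤ J + 7 ∧ ∃ (u : Fin I.n) (YP : Finset (Fin I.n)) (v cP cR : ℕ), YP ⊆ Y ∧ v < N ∧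
      cP + cR ≤ c ∧
      Attainable I F M N J s (rkPl J (l + 1)) u YP X (F X + v * M) cP ∧
      ∀ X', X ⊆ X' → F X + v * M ≤ F X' →
        Attainable I F M N J s l r (insert u (Y \ YP)) X' τ cR := by
  have hJ0 : 0 < J := by omega
  obtain ⟨b, hv, hc, hY, hsz, hN, hτ⟩ := h
  have herase : Y.erase r ⊆ b.heads := by
    intro y hy
    have := hY (Finset.mem_of_mem_erase hy)
    rcases Finset.mem_insert.1 this with h | h
    · exact absurd h (Finset.ne_of_mem_erase hy)
    · exact h
  have hcard : (Y.erase r).card ≤ b.size := (Finset.card_le_card herase).trans b.card_heads_le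
  have hYcard : Y.card ≤ (Y.erase r).card + 1 := by
    have := Finset.pred_card_le_card_erase (s := Y) (a := r)
    omega
  refine ⟨hYcard.trans (by have := rkW_mul_le hs hJ l _ _ hcard hsz; omega), ?_⟩
  obtain ⟨u, P, R, hu, hheads, hsize, hcost, hvP, hvR, hPcap, hRcap⟩ :=
    exists_rank_split hs hJ hv herase hsz
  set p := rkA J (rkPl J (l + 1)) with hp
  set ep := rkE J (rkPl J (l + 1)) with hep
  set gP := F (X ∪ insert u P.heads) - F X with hgP
  have hgP0 : 0 ≤ gP := sub_nonneg.2 (hF Finset.subset_union_left)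
  have hp1 : (1 : ℝ) ≤ p := by
    have : 1 ≤ p := Nat.le_add_left _ _
    exact_mod_cast this
  have hPb : insert u P.heads ⊆ insert r b.heads := by
    rw [hheads]
    intro y
    simp only [Finset.mem_insert, Finset.mem_union]
    rintro (rfl | hy)
    · tauto
    · tauto
  have hgPN : gP < N * M := by
    have h2 : F (X ∪ insert u P.heads) ≤ F (X ∪ insert r b.heads) :=
      hF (Finset.union_subset_union_right hPb)
    linarith
  obtain ⟨v, hvN, hv1, hv2⟩ : ∃ v : ℕ, v < N ∧ (v = 0 ∨ p * (v * M) + ep * M ≤ gP) ∧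
      gP ≤ p * ((v + 1) * M) + ep * M := exists_grid_point hM hp1 (Nat.cast_nonneg _) hgP0 hgPN
  refine ⟨u, Y.erase r ∩ P.heads, v, P.cost I.cost u, R.cost I.cost r, ?_, hvN, by omega,
    ⟨P, hvP, le_rfl, ?_, ?_, by linarith, ?_⟩, ?_⟩
  · exact Finset.inter_subset_left.trans (Finset.erase_subset _ _)
  · exact Finset.inter_subset_right.trans (Finset.subset_insert _ _)
  · refine le_trans (Nat.add_le_add_left (Nat.mul_le_mul ?_ ?_) _) hPcap
    · exact rkW_mono hs hJ ((rkPl_le J l).trans (Nat.le_succ l))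
    · exact Finset.card_le_card (Finset.erase_subset _ _)
  · rcases hv1 with h0 | h1
    · left; simp [h0]
    · right
      rw [add_sub_cancel_left]
      exact h1
  · intro X' hX' hgain
    have hRb : insert r R.heads ⊆ insert r b.heads := by
      rw [hheads]
      exact Finset.insert_subset_insert _ Finset.subset_union_right
    have hunion : insert u P.heads ∪ insert r R.heads = insert r b.heads := by
      rw [hheads]
      ext y
      simp only [Finset.mem_insert, Finset.mem_union]
      constructor
      · rintro ((rfl | h) | (h | h)) <;> tauto
      · tauto
    have hdim := marginal_le_marginal hF hsub hX' (insert r R.heads)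
    have hrest := le_union_of_marginal hF hsub hX' (insert u P.heads) (insert r R.heads)
    rw [hunion] at hrest
    refine ⟨R, hvR, le_rfl, ?_, ?_, ?_, ?_⟩
    · intro y hy
      rcases Finset.mem_insert.1 hy with rfl | hy
      · simpa using hu
      · rw [Finset.mem_sdiff, Finset.mem_inter] at hy
        by_cases hyr : y = r
        · exact hyr ▸ Finset.mem_insert_self _ _
        have h1 := Finset.mem_of_mem_insert_of_ne (hY hy.1) hyr
        rw [hheads, Finset.mem_union] at h1
        exact Finset.mem_insert_of_mem
          (h1.resolve_left fun h => hy.2 ⟨Finset.mem_erase.2 ⟨hyr, hy.1⟩, h⟩)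
    · exact le_trans (Nat.add_le_add_left
        -- Required vertices weigh no more at lower ranks, so the bound obtained with the weight of
        -- rank `l + 1` suffices.
        (Nat.mul_le_mul_right _ (rkW_mono hs hJ (Nat.le_succ l))) _) hRcap
    · have h2 : F (X ∪ insert r R.heads) ≤ F (X ∪ insert r b.heads) :=
        hF (Finset.union_subset_union_right hRb)
      linarith
    -- If the first tree has already reached `τ`, only the required vertices remain to be collected;
    -- otherwise `F X' ≤ τ`, which the accounting needs.
    · by_cases hdone : τ ≤ F X'
      · exact Or.inl hdone
      right
      have hτX : ¬ τ ≤ F X := fun h => hdone (h.trans (hF hX'))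
      have hmain := hτ.resolve_left hτX
      have hApl : (rkA J (l + 1) : ℝ) = p + 1 := by
        exact_mod_cast rkA_pl hJ0 l
      have hE : (rkE J l : ℝ) + p + ep ≤ rkE J (l + 1) := by
        exact_mod_cast rkE_pl hJ0 l
      have hAl : (rkA J l : ℝ) ≤ p + 1 := by
        rw [← hApl]
        exact_mod_cast rkA_mono J (Nat.le_succ l)
      rw [hApl] at hmain
      exact second_target_le hM hp1 hAl hE hgain (not_le.1 hdone).le hmain hv2 hrest

end

/-! ### Reasoning about programs -/

section
variable (I : Instance) (k : ℕ) (P : List Com)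

/-- The command `c`, started in the store `s`, halts within time `T` in a store with
property `Q`. -/
def Runs (c : Com) (s : Store) (T : ℕ) (Q : Store → Prop) : Prop :=
  ∃ t s', Exec I k P c s t s' ∧ t ≤ T ∧ Q s'

variable {I k P}

theorem Runs.mono {c : Com} {s : Store} {T T' : ℕ} {Q Q' : Store → Prop}
    (h : Runs I k P c s T Q) (hT : T ≤ T') (hQ : ∀ s', Q s' → Q' s') : Runs I k P c s T' Q' := by
  obtain ⟨t, s', h₁, h₂, h₃⟩ := h
  exact ⟨t, s', h₁, h₂.trans hT, hQ _ h₃⟩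

theorem Runs.skip {s : Store} {T : ℕ} {Q : Store → Prop} (hT : 1 ≤ T) (hQ : Q s) :
    Runs I k P .skip s T Q := ⟨1, s, .skip s, hT, hQ⟩

theorem Runs.seq {c₁ c₂ : Com} {s : Store} {T T₁ T₂ : ℕ} {Q₁ Q : Store → Prop}
    (h₁ : Runs I k P c₁ s T₁ Q₁) (h₂ : ∀ s', Q₁ s' → Runs I k P c₂ s' T₂ Q) (hT : T₁ + T₂ ≤ T) :
    Runs I k P (.seq c₁ c₂) s T Q := by
  obtain ⟨t₁, s₁, e₁, l₁, q₁⟩ := h₁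
  obtain ⟨t₂, s₂, e₂, l₂, q₂⟩ := h₂ s₁ q₁
  exact ⟨_, s₂, .seq e₁ e₂, by omega, q₂⟩

theorem Runs.setNat {a e : NExp} {s : Store} {T A V : ℕ} (hA : a.eval I k s = A)
    (hV : e.eval I k s = V) (hT : 1 + a.size + e.size ≤ T) :
    Runs I k P (.setNat a e) s T (fun s' => s'.real = s.real ∧ s'.nat A = V ∧
      ∀ b, b ≠ A → s'.nat b = s.nat b) := by
  refine ⟨_, _, .setNat a e s, hT, rfl, ?_, ?_⟩
  · simp [hA, hV]
  · intro b hb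
    simp [hA, hb]

theorem Runs.setReal {a : NExp} {x : RExp} {s : Store} {T A : ℕ} {V : ℝ}
    (hA : a.eval I k s = A) (hV : x.eval I k s = V) (hT : 1 + a.size + x.size ≤ T) :
    Runs I k P (.setReal a x) s T (fun s' => s'.nat = s.nat ∧ s'.real A = V ∧
      ∀ b, b ≠ A → s'.real b = s.real b) := by
  refine ⟨_, _, .setReal a x s, hT, rfl, ?_, ?_⟩
  · simp [hA, hV]
  · intro b hb
    simp [hA, hb]

theorem Runs.ite {p : BExp} {c₁ c₂ : Com} {s : Store} {T T' : ℕ} {Q : Store → Prop}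
    (h₁ : p.Holds I k s → Runs I k P c₁ s T' Q) (h₂ : ¬ p.Holds I k s → Runs I k P c₂ s T' Q)
    (hT : 1 + p.size + T' ≤ T) : Runs I k P (.ite p c₁ c₂) s T Q := by
  by_cases hp : p.Holds I k s
  · obtain ⟨t, s', e, l, q⟩ := h₁ hp
    exact ⟨_, s', .iteTrue hp e, by omega, q⟩
  · obtain ⟨t, s', e, l, q⟩ := h₂ hp
    exact ⟨_, s', .iteFalse hp e, by omega, q⟩

theorem Runs.call {i : ℕ} {c : Com} {s : Store} {T T' : ℕ} {Q : Store → Prop}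
    (hc : P[i]? = some c) (h : Runs I k P c s T' Q) (hT : 1 + T' ≤ T) :
    Runs I k P (.call i) s T Q := by
  obtain ⟨t, s', e, l, q⟩ := h
  exact ⟨_, s', .call hc e, by omega, q⟩

end

/-- `for i = 0, …, b - 1 do c`; the loop variable is kept in the cell with address `i`. -/
def forN (i b : NExp) (c : Com) : Com :=
  .seq (.setNat i (.lit 0)) (.loop (.natLE (.add (.mem i) (.lit 1)) b)
    (.seq c (.setNat i (.add (.mem i) (.lit 1)))))

section
variable {I : Instance} {k : ℕ} {P : List Com}

/-- The address of the counter is an expression that may depend on the frame pointer, hence the body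
has to preserve both the address and the counter. The invariant for `x + 1` is demanded only after
the increment. -/
theorem Runs.forN {i b : NExp} {c : Com} {s : Store} (Inv : ℕ → Store → Prop) {ia N Tb T : ℕ}
    {Q : Store → Prop} (hi : i.eval I k s = ia)
    (h0 : ∀ s', s'.real = s.real → s'.nat ia = 0 → (∀ b, b ≠ ia → s'.nat b = s.nat b) → Inv 0 s')
    (hinv : ∀ x s', Inv x s' → i.eval I k s' = ia ∧ s'.nat ia = x ∧ b.eval I k s' = N)
    (hbody : ∀ x s', x < N → Inv x s' → Runs I k P c s' Tb (fun s₁ =>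
      i.eval I k s₁ = ia ∧ s₁.nat ia = x ∧ ∀ s₂, s₂.real = s₁.real → s₂.nat ia = x + 1 →
        (∀ b, b ≠ ia → s₂.nat b = s₁.nat b) → Inv (x + 1) s₂))
    (hQ : ∀ s', Inv N s' → Q s') (hT : (N + 1) * (Tb + 3 * i.size + b.size + 9) ≤ T) :
    Runs I k P (STO.forN i b c) s T Q := by
  have hloop : ∀ m x s', x + m = N → Inv x s' →
      Runs I k P (.loop (.natLE (.add (.mem i) (.lit 1)) b)
        (.seq c (.setNat i (.add (.mem i) (.lit 1))))) s'
        (m * (Tb + 3 * i.size + b.size + 9) + (5 + i.size + b.size)) Q := by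
    intro m
    induction m with
    | zero =>
      intro x s' hx hs'
      obtain ⟨g₁, g₂, g₃⟩ := hinv x s' hs'
      refine ⟨_, s', .loopFalse ?_, ?_, hQ _ (by rwa [show x = N by omega] at hs')⟩
      · simp only [BExp.Holds, NExp.eval, g₁, g₂, g₃]; omega
      · simp only [BExp.size, NExp.size]; omega
    | succ m ih =>
      intro x s' hx hs'
      obtain ⟨g₁, g₂, g₃⟩ := hinv x s' hs'
      obtain ⟨t₁, s₁, e₁, l₁, q₁, q₂, q₃⟩ := hbody x s' (by omega) hs'
      obtain ⟨t₂, s₂, e₂, l₂, r₁, r₂, r₃⟩ := Runs.setNat (P := P) (e := .add (.mem i) (.lit 1))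
        (V := x + 1) q₁ (by simp [NExp.eval, q₁, q₂]) le_rfl
      obtain ⟨t₃, s₃, e₃, l₃, q⟩ := ih (x + 1) s₂ (by omega) (q₃ _ r₁ r₂ r₃)
      refine ⟨_, s₃, .loopTrue ?_ (.seq e₁ e₂) e₃, ?_, q⟩
      · simp only [BExp.Holds, NExp.eval, g₁, g₂, g₃]; omega
      · simp only [BExp.size, NExp.size] at l₂ ⊢
        rw [Nat.add_mul]
        omega
  refine Runs.seq (Runs.setNat hi rfl le_rfl) (fun s' hs' => hloop N 0 s' (by omega) ?_) ?_
  · exact h0 s' hs'.1 hs'.2.1 hs'.2.2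
  · simp only [NExp.size]
    rw [Nat.add_mul] at hT
    omega

end

/-! ### Addresses -/

/-- `j` times the number of vertices. -/
def nmul : ℕ → NExp
  | 0 => .lit 0
  | j + 1 => .add .numVerts (nmul j)

/-- The address of the global variable `c`. The cells below `n` hold the output. -/
def glob (c : ℕ) : NExp := .add .numVerts (.lit c)

/-- The value of the global variable `c`. -/
def gv (c : ℕ) : NExp := .mem (glob c)

/-- The address `c + j * n`, relative to the frame pointer, which is the global variable `0`. -/
def loc (c j : ℕ) : NExp := .add (gv 0) (.add (.lit c) (nmul j))

/-- The element `v` of the array that starts at `a`. -/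
def elt (a v : NExp) : NExp := .mem (.add a v)

/-- Equality of natural numbers. -/
def eqB (a b : NExp) : BExp := .and (.natLE a b) (.natLE b a)

/-- Disjunction. -/
def orB (p q : BExp) : BExp := .not (.and (.not p) (.not q))

/-- The set of vertices that is described by the array of indicators at `a`. -/
def setAt (n : ℕ) (m : ℕ → ℕ) (a : ℕ) : Finset (Fin n) := Finset.univ.filter fun v => m (a + v) ≠ 0

theorem mem_setAt {n : ℕ} {m : ℕ → ℕ} {a : ℕ} {v : Fin n} : v ∈ setAt n m a ↔ m (a + v) ≠ 0 := by
  simp [setAt]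

theorem setAt_congr {n : ℕ} {m m' : ℕ → ℕ} {a a' : ℕ} (h : ∀ v, v < n → m (a + v) = m' (a' + v)) :
    setAt n m a = setAt n m' a' := by
  ext v
  simp only [mem_setAt, h v v.2]

section
variable {I : Instance} {k : ℕ} {P : List Com} {s : Store}

theorem eval_nmul (j : ℕ) : (nmul j).eval I k s = j * I.n := by
  induction j with
  | zero => simp [nmul, NExp.eval]
  | succ j ih => simp only [nmul, NExp.eval, ih]; ring

/-- Memory layout: after the `n` output cells come `64` global variables, then an array of length
`n` for value queries, and from `2 * n + 64` on the frames of the recursion. -/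
theorem eval_glob (c : ℕ) : (glob c).eval I k s = I.n + c := rfl

theorem eval_gv (c : ℕ) : (gv c).eval I k s = s.nat (I.n + c) := rfl

/-- A frame has `16` scalar cells and five arrays of length `n`; array `j` starts at offset `16 + j
* n`. The next frame starts at offset `16 + 5 * n`, so its cell `c` has offset `16 + c + 5 * n` and
its array `j` has offset `32 + (5 + j) * n`. The arrays hold `Y`, `X`, the best tree, the tree of
the first call, and the requirement of the second call. -/
theorem eval_loc (c j : ℕ) : (loc c j).eval I k s = s.nat (I.n + 0) + (c + j * I.n) := by
  simp [loc, NExp.eval, eval_nmul, eval_gv]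

theorem eval_add (a b : NExp) : (NExp.add a b).eval I k s = a.eval I k s + b.eval I k s := rfl

theorem eval_elt (a v : NExp) : (elt a v).eval I k s = s.nat (a.eval I k s + v.eval I k s) := rfl

theorem holds_eqB (a b : NExp) : (eqB a b).Holds I k s ↔ a.eval I k s = b.eval I k s := by
  simp only [eqB, BExp.Holds]; omega

theorem holds_orB (p q : BExp) : (orB p q).Holds I k s ↔ p.Holds I k s ∨ q.Holds I k s := by
  simp only [orB, BExp.Holds]; tauto

end

/-! ### Auxiliary commands -/

/-- `for v do dst[v] := if p then e₁ else e₂`, where `v` is the global variable `8`. -/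
def fill (dst : NExp) (p : BExp) (e₁ e₂ : NExp) : Com :=
  forN (glob 8) .numVerts
    (.ite p (.setNat (.add dst (gv 8)) e₁) (.setNat (.add dst (gv 8)) e₂))

/-- Set the global variable `12` to `1` if `p` holds for some vertex `v`, otherwise to `0`; here `v`
is the global variable `8`. -/
def check (p : BExp) : Com :=
  .seq (.setNat (glob 12) (.lit 0)) (forN (glob 8) .numVerts
    (.ite p (.setNat (glob 12) (.lit 1)) .skip))

/-- Set the real number cell `1` to `2 ^ e` times the reward of the set described by the array at
global variable `64`, where `e` is the global variable `4`. -/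
def evalF : Com :=
  .seq (.setReal (.lit 1) (.value (glob 64)))
    (forN (glob 9) (gv 4) (.setReal (.lit 1) (.add (.mem (.lit 1)) (.mem (.lit 1)))))

section
variable {I : Instance} {k : ℕ} {P : List Com} {s : Store}

/-- The array must avoid the counter cell `8`. Sources are read while the array is being
overwritten, so the hypothesis is stated for stores that differ from the initial one only there and
at the counter. -/
theorem runs_fill {dst : NExp} {p : BExp} {e₁ e₂ : NExp} {A T : ℕ} (val : ℕ → ℕ)
    (hA : I.n + 8 < A ∨ A + I.n ≤ I.n + 8)
    (h : ∀ s' v, v < I.n → s'.real = s.real →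
      (∀ a, ¬ (A ≤ a ∧ a < A + I.n) → a ≠ I.n + 8 → s'.nat a = s.nat a) → s'.nat (I.n + 8) = v →
      dst.eval I k s' = A ∧ (p.Holds I k s' → e₁.eval I k s' = val v) ∧
        (¬ p.Holds I k s' → e₂.eval I k s' = val v))
    (hT : (I.n + 1) * (dst.size + p.size + e₁.size + e₂.size + 30) ≤ T) :
    Runs I k P (fill dst p e₁ e₂) s T (fun s' => s'.real = s.real ∧
      (∀ v, v < I.n → s'.nat (A + v) = val v) ∧
      ∀ a, ¬ (A ≤ a ∧ a < A + I.n) → a ≠ I.n + 8 → s'.nat a = s.nat a) := by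
  refine Runs.forN (fun x s' => s'.real = s.real ∧ s'.nat (I.n + 8) = x ∧
      (∀ v, v < x → s'.nat (A + v) = val v) ∧
      ∀ a, ¬ (A ≤ a ∧ a < A + I.n) → a ≠ I.n + 8 → s'.nat a = s.nat a)
    (N := I.n) (ia := I.n + 8) (Tb := 1 + p.size + (dst.size + e₁.size + e₂.size + 6)) rfl ?_ ?_ ?_ ?_ ?_
  · intro s' h₁ h₂ h₃
    exact ⟨h₁, h₂, fun v hv => by omega, fun a _ ha => h₃ a ha⟩
  · rintro x s' ⟨-, h₂, -, -⟩
    exact ⟨rfl, h₂, rfl⟩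
  · rintro x s' hx ⟨h₁, h₂, h₃, h₄⟩
    obtain ⟨g₁, g₂, g₃⟩ := h s' x hx h₁ h₄ h₂
    have hdst : (NExp.add dst (gv 8)).eval I k s' = A + x := by
      simp only [NExp.eval, g₁, eval_gv, h₂]
    have key : ∀ s₁ : Store, (s₁.real = s'.real ∧ s₁.nat (A + x) = val x ∧
        ∀ b, b ≠ A + x → s₁.nat b = s'.nat b) → ((glob 8).eval I k s₁ = I.n + 8 ∧
        s₁.nat (I.n + 8) = x ∧ ∀ s₂ : Store, s₂.real = s₁.real → s₂.nat (I.n + 8) = x + 1 →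
        (∀ b, b ≠ I.n + 8 → s₂.nat b = s₁.nat b) → (s₂.real = s.real ∧ s₂.nat (I.n + 8) = x + 1 ∧
      (∀ v, v < x + 1 → s₂.nat (A + v) = val v) ∧
      ∀ a, ¬ (A ≤ a ∧ a < A + I.n) → a ≠ I.n + 8 → s₂.nat a = s.nat a)) := by
      rintro s₁ ⟨k₁, k₂, k₃⟩
      refine ⟨rfl, by rw [k₃ _ (by omega), h₂], fun s₂ m₁ m₂ m₃ => ⟨by rw [m₁, k₁, h₁], m₂, ?_, ?_⟩⟩
      · intro v hv
        rw [m₃ _ (by omega)]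
        by_cases hvx : v = x
        · rw [hvx, k₂]
        · rw [k₃ _ (by omega), h₃ v (by omega)]
      · intro a ha ha'
        rw [m₃ _ ha', k₃ _ (by omega), h₄ a ha ha']
    refine Runs.ite (T' := dst.size + e₁.size + e₂.size + 6) (fun hp => ?_) (fun hp => ?_) le_rfl
    · exact (Runs.setNat hdst (g₂ hp) (by simp only [NExp.size, gv, glob]; omega)).mono le_rfl key
    · exact (Runs.setNat hdst (g₃ hp) (by simp only [NExp.size, gv, glob]; omega)).mono le_rfl key
  · rintro s' ⟨h₁, -, h₃, h₄⟩
    exact ⟨h₁, h₃, h₄⟩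
  · refine le_trans (Nat.mul_le_mul_left _ ?_) hT
    simp only [glob, NExp.size]
    omega

theorem runs_check {p : BExp} {T : ℕ} (q : ℕ → Prop)
    (h : ∀ s' v, v < I.n → s'.real = s.real →
      (∀ a, a ≠ I.n + 12 → a ≠ I.n + 8 → s'.nat a = s.nat a) → s'.nat (I.n + 8) = v →
      (p.Holds I k s' ↔ q v)) (hT : (I.n + 2) * (p.size + 40) ≤ T) :
    Runs I k P (check p) s T (fun s' => s'.real = s.real ∧
      (s'.nat (I.n + 12) = 0 ↔ ∀ v, v < I.n → ¬ q v) ∧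
      ∀ a, a ≠ I.n + 12 → a ≠ I.n + 8 → s'.nat a = s.nat a) := by
  refine Runs.seq (T₁ := 5) (T₂ := (I.n + 1) * (p.size + 40))
    (Runs.setNat rfl rfl (by simp [glob, NExp.size])) ?_ ?_
  swap
  · refine le_trans ?_ hT
    rw [Nat.add_mul, Nat.add_mul]
    omega
  rintro s₀ ⟨a₁, a₂, a₃⟩
  have ha₂ : s₀.nat (I.n + 12) = 0 := a₂
  refine Runs.forN (fun x s' => s'.real = s.real ∧ s'.nat (I.n + 8) = x ∧
      (s'.nat (I.n + 12) = 0 ↔ ∀ v, v < x → ¬ q v) ∧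
      ∀ a, a ≠ I.n + 12 → a ≠ I.n + 8 → s'.nat a = s.nat a)
    (N := I.n) (ia := I.n + 8) (Tb := p.size + 10) rfl ?_ ?_ ?_ ?_ ?_
  · intro s' h₁ h₂ h₃
    refine ⟨by rw [h₁, a₁], h₂, ?_, fun a ha ha' => by rw [h₃ a ha']; exact a₃ a ha⟩
    rw [h₃ _ (by omega), ha₂]
    simp
  · rintro x s' ⟨-, h₂, -, -⟩
    exact ⟨rfl, h₂, rfl⟩
  · rintro x s' hx ⟨h₁, h₂, h₃, h₄⟩
    have g := h s' x hx h₁ h₄ h₂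
    refine Runs.ite (T' := 5) (fun hp => ?_) (fun hp => ?_) (by omega)
    · refine (Runs.setNat rfl rfl (by simp [glob, NExp.size])).mono le_rfl ?_
      rintro s₁ ⟨k₁, k₂, k₃⟩
      have k₂' : s₁.nat (I.n + 12) = 1 := k₂
      have k₃' : ∀ b, b ≠ I.n + 12 → s₁.nat b = s'.nat b := k₃
      refine ⟨rfl, by rw [k₃' _ (by omega), h₂],
        fun s₂ m₁ m₂ m₃ => ⟨by rw [m₁, k₁, h₁], m₂, ?_, ?_⟩⟩
      · rw [m₃ _ (by omega), k₂']
        simp only [one_ne_zero, false_iff, not_forall]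
        exact ⟨x, Nat.lt_succ_self x, not_not.2 (g.1 hp)⟩
      · intro a ha ha'
        rw [m₃ _ ha', k₃' _ ha, h₄ a ha ha']
    · refine Runs.skip (by omega) ⟨rfl, h₂, fun s₂ m₁ m₂ m₃ => ⟨by rw [m₁, h₁], m₂, ?_, ?_⟩⟩
      · rw [m₃ _ (by omega), h₃]
        constructor
        · intro hall v hv
          rcases Nat.lt_succ_iff_lt_or_eq.1 hv with hv | rfl
          · exact hall v hv
          · exact fun hq => hp (g.2 hq)
        · exact fun hall v hv => hall v (by omega)
      · intro a ha ha'
        rw [m₃ _ ha', h₄ a ha ha']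
  · rintro s' ⟨h₁, -, h₃, h₄⟩
    exact ⟨h₁, h₃, h₄⟩
  · refine Nat.mul_le_mul_left _ ?_
    simp only [glob, NExp.size]
    omega

theorem runs_evalF {e T : ℕ} (he : s.nat (I.n + 4) = e) (hT : (e + 2) * 50 ≤ T) :
    Runs I k P evalF s T (fun s' => (∀ a, a ≠ I.n + 9 → s'.nat a = s.nat a) ∧
      s'.real 1 = 2 ^ e * I.f (setAt I.n s.nat (I.n + 64)) ∧
      ∀ a, a ≠ 1 → s'.real a = s.real a) := by
  refine Runs.seq (T₁ := 6) (T₂ := (e + 1) * 50)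
    (Runs.setReal rfl rfl (by simp [glob, NExp.size, RExp.size])) ?_ (by omega)
  rintro s₀ ⟨a₁, a₂, a₃⟩
  refine Runs.forN (fun x s' => (∀ a, a ≠ I.n + 9 → s'.nat a = s.nat a) ∧ s'.nat (I.n + 9) = x ∧
      s'.real 1 = 2 ^ x * I.f (setAt I.n s.nat (I.n + 64)) ∧
      ∀ a, a ≠ 1 → s'.real a = s.real a)
    (N := e) (ia := I.n + 9) (Tb := 8) rfl ?_ ?_ ?_ ?_ ?_
  · intro s' h₁ h₂ h₃
    refine ⟨fun a ha => by rw [h₃ a ha, a₁], h₂, ?_, fun a ha => by rw [h₁]; exact a₃ a ha⟩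
    rw [h₁]
    refine Eq.trans a₂ ?_
    rw [pow_zero, one_mul]
    rfl
  · rintro x s' ⟨h₁, h₂, -, -⟩
    exact ⟨rfl, h₂, by rw [eval_gv, h₁ _ (by omega), he]⟩
  · rintro x s' hx ⟨h₁, h₂, h₃, h₄⟩
    refine (Runs.setReal rfl rfl (by simp [NExp.size, RExp.size])).mono le_rfl ?_
    rintro s₁ ⟨k₁, k₂, k₃⟩
    refine ⟨rfl, by rw [k₁, h₂], fun s₂ m₁ m₂ m₃ =>
      ⟨fun a ha => by rw [m₃ a ha, k₁, h₁ a ha], m₂, ?_,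
        fun a ha => by rw [m₁]; exact (k₃ a ha).trans (h₄ a ha)⟩⟩
    rw [m₁]
    refine Eq.trans k₂ ?_
    simp only [RExp.eval, NExp.eval, h₃, pow_succ]
    ring
  · rintro s' ⟨h₁, -, h₃, h₄⟩
    exact ⟨h₁, h₃, h₄⟩
  · refine Nat.mul_le_mul_left _ ?_
    simp [glob, gv, NExp.size]

end

/-! ### Subsets encoded by numbers -/

/-- What is left of `m` when one bit has been consumed for each nonzero entry of `y` before `v`. -/
def maskAt (y : ℕ → ℕ) (m : ℕ) : ℕ → ℕ
  | 0 => m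
  | v + 1 => if y v ≠ 0 then maskAt y m v / 2 else maskAt y m v

theorem maskAt_congr {y y' : ℕ → ℕ} (m : ℕ) {v : ℕ} (h : ∀ x, x < v → y x = y' x) :
    maskAt y m v = maskAt y' m v := by
  induction v with
  | zero => rfl
  | succ v ih =>
    simp only [maskAt, h v (Nat.lt_succ_self v), ih fun x hx => h x (by omega)]

/-- The definition peels off the last index; this peels off the first, which is where the lowest bit
of `m` belongs. -/
theorem maskAt_shift (y : ℕ → ℕ) (m v : ℕ) :
    maskAt y m (v + 1) = maskAt (fun x => y (x + 1)) (if y 0 ≠ 0 then m / 2 else m) v := by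
  induction v with
  | zero => rfl
  | succ v ih =>
    rw [maskAt, ih]
    rfl

/-- Bits are consumed only at nonzero entries of `y`, so the size of the number depends on the
number of these entries and not on `n`. Hence it suffices to try a number of masks that depends on
`J` alone. -/
theorem exists_mask (n : ℕ) (y : ℕ → ℕ) (b : ℕ → Prop) :
    ∃ m, m < 2 ^ Nat.count (fun v => y v ≠ 0) n ∧
      ∀ v, v < n → y v ≠ 0 → (maskAt y m v % 2 = 1 ↔ b v) := by
  induction n generalizing y b with
  | zero => exact ⟨0, by simp, fun v hv => by omega⟩
  | succ n ih =>
    obtain ⟨m, hm, h⟩ := ih (fun v => y (v + 1)) (fun v => b (v + 1))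
    rw [Nat.count_succ']
    by_cases hy : y 0 ≠ 0
    · obtain ⟨i, hi, hib⟩ : ∃ i, i < 2 ∧ (i = 1 ↔ b 0) := by
        by_cases hb : b 0
        · exact ⟨1, by simp [hb]⟩
        · exact ⟨0, by simp [hb]⟩
      refine ⟨2 * m + i, ?_, ?_⟩
      · rw [if_pos hy, pow_succ]; omega
      · intro v hv hyv
        cases v with
        | zero => rw [maskAt, ← hib]; omega
        | succ v =>
          rw [maskAt_shift, if_pos hy, show (2 * m + i) / 2 = m by omega]
          exact h v (by omega) hyv
    · refine ⟨m, by rw [if_neg hy]; exact hm, ?_⟩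
      intro v hv hyv
      cases v with
      | zero => exact absurd hyv hy
      | succ v =>
        rw [maskAt_shift, if_neg hy]
        exact h v (by omega) hyv

theorem count_eq_card_setAt (n : ℕ) (m : ℕ → ℕ) (a : ℕ) :
    Nat.count (fun v => m (a + v) ≠ 0) n = (setAt n m a).card := by
  rw [Nat.count_eq_card_filter_range]
  refine (Finset.card_nbij (fun v : Fin n => (v : ℕ)) ?_ ?_ ?_).symm
  · intro v hv
    have := mem_setAt.1 hv
    simp [this]
  · exact fun v _ w _ h => Fin.ext h
  · intro v hv
    simp only [Finset.coe_filter, Finset.mem_range, Set.mem_ofPred_eq] at hv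
    exact ⟨⟨v, hv.1⟩, mem_setAt.2 hv.2, rfl⟩

theorem exists_mask_finset {n : ℕ} (m : ℕ → ℕ) (a q : ℕ) (A : Finset (Fin n))
    (hq : (setAt n m a).card ≤ q) :
    ∃ x, x < 2 ^ q ∧ ∀ v : Fin n, m (a + v) ≠ 0 →
      (maskAt (fun v => m (a + v)) x v % 2 = 1 ↔ v ∈ A) := by
  obtain ⟨x, h₁, h₂⟩ := exists_mask n (fun v => m (a + v)) (fun v => ∃ h : v < n, (⟨v, h⟩ : Fin n) ∈ A)
  rw [count_eq_card_setAt] at h₁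
  refine ⟨x, h₁.trans_le (Nat.pow_le_pow_right (by omega) hq), fun v hv => ?_⟩
  rw [h₂ v v.2 hv]
  exact ⟨fun ⟨_, h⟩ => h, fun h => ⟨v.2, h⟩⟩

/-! ### The recursive procedure -/

/-- Distribute the set in array `0` of the frame, according to the number in cell `3` of the frame, to
array `0` of the next frame and array `4` of the frame. -/
def distribute : Com :=
  .seq (.setNat (glob 13) (.mem (loc 3 0))) (forN (glob 8) .numVerts
    (.ite (.natLE (.lit 1) (elt (loc 16 0) (gv 8)))
      -- With halving as the only division, the lowest bit is the number minus twice its half.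
      (.seq (.setNat (.add (loc 32 5) (gv 8)) (.sub (gv 13) (.add (.half (gv 13)) (.half (gv 13)))))
        (.seq (.setNat (.add (loc 16 4) (gv 8)) (.sub (.lit 1) (elt (loc 32 5) (gv 8))))
          (.setNat (glob 13) (.half (gv 13)))))
      (.seq (.setNat (.add (loc 32 5) (gv 8)) (.lit 0))
        (.setNat (.add (loc 16 4) (gv 8)) (.lit 0)))))

section
variable {I : Instance} {k : ℕ} {P : List Com} {s : Store}

theorem runs_distribute {fp T : ℕ} (hfp : s.nat (I.n + 0) = fp) (hlow : 2 * I.n + 64 ≤ fp)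
    (hT : (I.n + 2) * 170 ≤ T) :
    Runs I k P distribute s T (fun s' => s'.real = s.real ∧
      (∀ v, v < I.n → s'.nat (fp + (32 + 5 * I.n) + v) =
        if s.nat (fp + 16 + v) ≠ 0 then maskAt (fun v => s.nat (fp + 16 + v)) (s.nat (fp + 3)) v % 2
        else 0) ∧
      (∀ v, v < I.n → s'.nat (fp + (16 + 4 * I.n) + v) =
        if s.nat (fp + 16 + v) ≠ 0 then
          1 - maskAt (fun v => s.nat (fp + 16 + v)) (s.nat (fp + 3)) v % 2 else 0) ∧
      ∀ a, a ≠ I.n + 8 → a ≠ I.n + 13 →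
        ¬ (fp + (32 + 5 * I.n) ≤ a ∧ a < fp + (32 + 5 * I.n) + I.n) →
        ¬ (fp + (16 + 4 * I.n) ≤ a ∧ a < fp + (16 + 4 * I.n) + I.n) → s'.nat a = s.nat a) := by
  set y : ℕ → ℕ := fun v => s.nat (fp + 16 + v) with hy
  set m := s.nat (fp + 3) with hm
  refine Runs.seq (T₁ := 20) (T₂ := (I.n + 1) * 170)
    (Runs.setNat (V := m) rfl (by simp only [NExp.eval, eval_loc, hfp, hm]; simp)
      (by simp [glob, loc, gv, nmul, NExp.size])) ?_ ?_
  swap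
  · refine le_trans ?_ hT
    rw [Nat.add_mul, Nat.add_mul]
    omega
  rintro s₀ ⟨a₁, a₂, a₃⟩
  have ha₂ : s₀.nat (I.n + 13) = m := a₂
  have ha₃ : ∀ b, b ≠ I.n + 13 → s₀.nat b = s.nat b := a₃
  refine Runs.forN (fun x s' => s'.real = s.real ∧ s'.nat (I.n + 8) = x ∧
      s'.nat (I.n + 13) = maskAt y m x ∧
      (∀ v, v < x → s'.nat (fp + (32 + 5 * I.n) + v) = if y v ≠ 0 then maskAt y m v % 2 else 0) ∧
      (∀ v, v < x → s'.nat (fp + (16 + 4 * I.n) + v) =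
        if y v ≠ 0 then 1 - maskAt y m v % 2 else 0) ∧
      ∀ a, a ≠ I.n + 8 → a ≠ I.n + 13 →
        ¬ (fp + (32 + 5 * I.n) ≤ a ∧ a < fp + (32 + 5 * I.n) + I.n) →
        ¬ (fp + (16 + 4 * I.n) ≤ a ∧ a < fp + (16 + 4 * I.n) + I.n) → s'.nat a = s.nat a)
    (N := I.n) (ia := I.n + 8) (Tb := 140) rfl ?_ ?_ ?_ ?_ ?_
  · intro s' h₁ h₂ h₃
    refine ⟨by rw [h₁, a₁], h₂, by rw [h₃ _ (by omega), ha₂]; rfl, fun v hv => by omega,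
      fun v hv => by omega, fun a b₁ b₂ _ _ => by rw [h₃ a b₁, ha₃ a b₂]⟩
  · rintro x s' ⟨-, h₂, -⟩
    exact ⟨rfl, h₂, rfl⟩
  · rintro x s' hx ⟨h₁, h₂, h₃, h₄, h₅, h₆⟩
    have f' : s'.nat (I.n + 0) = fp := by
      rw [h₆ _ (by omega) (by omega) (by omega) (by omega), hfp]
    have hyx : s'.nat (fp + 16 + x) = y x := h₆ _ (by omega) (by omega) (by omega) (by omega)
    have hp : (BExp.natLE (.lit 1) (elt (loc 16 0) (gv 8))).Holds I k s' ↔ y x ≠ 0 := by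
      simp only [BExp.Holds, NExp.eval, eval_elt, eval_loc, eval_gv, h₂, f']
      simp only [Nat.zero_mul, Nat.add_zero, hyx]
      omega
    have key : ∀ (s₁ : Store) (i j q : ℕ), s₁.real = s'.real →
        s₁.nat (fp + (32 + 5 * I.n) + x) = i → s₁.nat (fp + (16 + 4 * I.n) + x) = j →
        s₁.nat (I.n + 13) = q → i = (if y x ≠ 0 then maskAt y m x % 2 else 0) →
        j = (if y x ≠ 0 then 1 - maskAt y m x % 2 else 0) → q = maskAt y m (x + 1) →
        (∀ a, a ≠ fp + (32 + 5 * I.n) + x → a ≠ fp + (16 + 4 * I.n) + x → a ≠ I.n + 13 →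
          s₁.nat a = s'.nat a) → ((glob 8).eval I k s₁ = I.n + 8 ∧
        s₁.nat (I.n + 8) = x ∧ ∀ s₂ : Store, s₂.real = s₁.real → s₂.nat (I.n + 8) = x + 1 →
        (∀ b, b ≠ I.n + 8 → s₂.nat b = s₁.nat b) → (s₂.real = s.real ∧ s₂.nat (I.n + 8) = x + 1 ∧
      s₂.nat (I.n + 13) = maskAt y m (x + 1) ∧
      (∀ v, v < x + 1 → s₂.nat (fp + (32 + 5 * I.n) + v) =
        if y v ≠ 0 then maskAt y m v % 2 else 0) ∧
      (∀ v, v < x + 1 → s₂.nat (fp + (16 + 4 * I.n) + v) =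
        if y v ≠ 0 then 1 - maskAt y m v % 2 else 0) ∧
      ∀ a, a ≠ I.n + 8 → a ≠ I.n + 13 →
        ¬ (fp + (32 + 5 * I.n) ≤ a ∧ a < fp + (32 + 5 * I.n) + I.n) →
        ¬ (fp + (16 + 4 * I.n) ≤ a ∧ a < fp + (16 + 4 * I.n) + I.n) → s₂.nat a = s.nat a)) := by
      intro s₁ i j q k₁ k₂ k₃ k₄ k₅ k₆ k₇ k₈
      refine ⟨rfl, by rw [k₈ _ (by omega) (by omega) (by omega), h₂], fun s₂ m₁ m₂ m₃ =>
        ⟨by rw [m₁, k₁, h₁], m₂, by rw [m₃ _ (by omega), k₄, k₇], ?_, ?_, ?_⟩⟩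
      · intro v hv
        rw [m₃ _ (by omega)]
        by_cases hvx : v = x
        · rw [hvx, k₂, k₅]
        · rw [k₈ _ (by omega) (by omega) (by omega), h₄ v (by omega)]
      · intro v hv
        rw [m₃ _ (by omega)]
        by_cases hvx : v = x
        · rw [hvx, k₃, k₆]
        · rw [k₈ _ (by omega) (by omega) (by omega), h₅ v (by omega)]
      · intro a b₁ b₂ b₃ b₄
        rw [m₃ _ b₁, k₈ _ (by omega) (by omega) b₂, h₆ a b₁ b₂ b₃ b₄]
    refine Runs.ite (T' := 120) (fun h => ?_) (fun h => ?_)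
      (by simp [BExp.size, elt, glob, loc, gv, nmul, NExp.size])
    · have hyx0 := hp.1 h
      refine Runs.seq (T₁ := 50) (T₂ := 70) (Runs.setNat (A := fp + (32 + 5 * I.n) + x)
        (V := maskAt y m x % 2) ?_ ?_ ?_) ?_ (by omega)
      · simp only [NExp.eval, eval_loc, eval_gv, f', h₂]
      · simp only [NExp.eval, eval_gv, h₃]; omega
      · simp [glob, loc, gv, nmul, NExp.size]
      rintro s₁ ⟨b₁, b₂, b₃⟩
      have f₁ : s₁.nat (I.n + 0) = fp := by rw [b₃ _ (by omega), f']
      have c₁ : s₁.nat (I.n + 8) = x := by rw [b₃ _ (by omega), h₂]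
      refine Runs.seq (T₁ := 50) (T₂ := 20) (Runs.setNat (A := fp + (16 + 4 * I.n) + x)
        (V := 1 - maskAt y m x % 2) ?_ ?_ ?_) ?_ (by omega)
      · simp only [NExp.eval, eval_loc, eval_gv, f₁, c₁]
      · simp only [NExp.eval, eval_elt, eval_loc, eval_gv, f₁, c₁, b₂]
      · simp [glob, elt, loc, gv, nmul, NExp.size]
      rintro s₂ ⟨d₁, d₂, d₃⟩
      refine (Runs.setNat (A := I.n + 13) (V := maskAt y m x / 2) rfl ?_
        (by simp [glob, gv, NExp.size])).mono le_rfl ?_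
      · simp only [NExp.eval, eval_gv]
        rw [d₃ _ (by omega), b₃ _ (by omega), h₃]
      rintro s₃ ⟨e₁, e₂, e₃⟩
      refine key s₃ (maskAt y m x % 2) (1 - maskAt y m x % 2) (maskAt y m x / 2)
        (by rw [e₁, d₁, b₁]) (by rw [e₃ _ (by omega), d₃ _ (by omega), b₂])
        (by rw [e₃ _ (by omega), d₂]) e₂ (by rw [if_pos hyx0]) (by rw [if_pos hyx0])
        (by rw [maskAt, if_pos hyx0]) ?_
      intro a g₁ g₂ g₃
      rw [e₃ _ g₃, d₃ _ g₂, b₃ _ g₁]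
    · have hyx0 : ¬ y x ≠ 0 := fun h' => h (hp.2 h')
      refine Runs.seq (T₁ := 50) (T₂ := 50) (Runs.setNat (A := fp + (32 + 5 * I.n) + x)
        (V := 0) ?_ rfl ?_) ?_ (by omega)
      · simp only [NExp.eval, eval_loc, eval_gv, f', h₂]
      · simp [glob, loc, gv, nmul, NExp.size]
      rintro s₁ ⟨b₁, b₂, b₃⟩
      have f₁ : s₁.nat (I.n + 0) = fp := by rw [b₃ _ (by omega), f']
      have c₁ : s₁.nat (I.n + 8) = x := by rw [b₃ _ (by omega), h₂]
      refine (Runs.setNat (A := fp + (16 + 4 * I.n) + x) (V := 0) ?_ rfl ?_).mono le_rfl ?_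
      · simp only [NExp.eval, eval_loc, eval_gv, f₁, c₁]
      · simp [glob, loc, gv, nmul, NExp.size]
      rintro s₂ ⟨d₁, d₂, d₃⟩
      refine key s₂ 0 0 (maskAt y m x)
        (by rw [d₁, b₁]) (by rw [d₃ _ (by omega), b₂]) d₂
        (by rw [d₃ _ (by omega), b₃ _ (by omega), h₃]) (by rw [if_neg hyx0]) (by rw [if_neg hyx0])
        (by rw [maskAt, if_neg hyx0]) ?_
      intro a g₁ g₂ g₃
      rw [d₃ _ g₂, b₃ _ g₁]
  · rintro s' ⟨h₁, -, -, h₄, h₅, h₆⟩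
    exact ⟨h₁, h₄, h₅, h₆⟩
  · refine Nat.mul_le_mul_left _ ?_
    simp [glob, NExp.size]

end

/-- The address `c`, relative to the frame pointer. -/
def var (c : ℕ) : NExp := .add (gv 0) (.lit c)

theorem eval_var {I : Instance} {k : ℕ} {s : Store} (c : ℕ) :
    (var c).eval I k s = s.nat (I.n + 0) + c := rfl

/-- The treatment of the single edge from the root to the vertex in global variable `10`, or of the
root alone if these coincide. -/
def baseBody : Com :=
  .ite (orB (eqB (gv 10) (.mem (var 0))) (.natLE (.lit 1) (.edge (.mem (var 0)) (gv 10))))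
    (.seq (.ite (eqB (gv 10) (.mem (var 0))) (.setNat (glob 11) (.lit 0))
      (.setNat (glob 11) (.cost (.mem (var 0)) (gv 10))))
    (.seq (check (.and (.natLE (.lit 1) (elt (loc 16 0) (gv 8)))
      (.not (orB (eqB (gv 8) (.mem (var 0))) (eqB (gv 8) (gv 10))))))
    (.seq (fill (glob 64) (orB (.natLE (.lit 1) (elt (loc 16 1) (gv 8)))
      (orB (eqB (gv 8) (.mem (var 0))) (eqB (gv 8) (gv 10)))) (.lit 1) (.lit 0))
    (.seq evalF
    (.ite (.and (.natLE (gv 12) (.lit 0)) (.and (.realLE (.mem (gv 0)) (.mem (.lit 1)))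
        (orB (.natLE (.mem (var 6)) (.lit 0)) (.natLE (.add (gv 11) (.lit 2)) (.mem (var 6))))))
      (.seq (.setNat (var 6) (.add (gv 11) (.lit 1)))
      (.seq (fill (loc 16 2) (eqB (gv 8) (gv 10)) (.add (.mem (var 0)) (.lit 2)) (.lit 0))
        -- The entry of the root is written last, so that it is right also when the chosen vertex is
        -- the root itself.
        (.setNat (.add (loc 16 2) (.mem (var 0))) (.lit 1))))
      .skip))))) .skip

/-- The procedure for rank `0`. -/
def baseCom : Com := .seq (.setNat (var 6) (.lit 0)) (forN (glob 10) .numVerts baseBody)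

section
variable {I : Instance} {k : ℕ} {P : List Com} {F : Finset (Fin I.n) → ℝ}

/-- The reward function, multiplied by `2 ^ e`. -/
def scaled (I : Instance) (e : ℕ) : Finset (Fin I.n) → ℝ := fun S => 2 ^ e * I.f S

/-- The values of the global variables. -/
structure Globals (I : Instance) (fp J N W e : ℕ) (M : ℝ) (s : Store) : Prop where
  frame : s.nat (I.n + 0) = fp
  period : s.nat (I.n + 1) = J
  targets : s.nat (I.n + 2) = N
  masks : s.nat (I.n + 3) = W
  scale : s.nat (I.n + 4) = e
  unit : s.real 0 = M
  low : 2 * I.n + 64 ≤ fp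

/-- The stores agree on the global variables, on all older frames and on the input part of the
frame at `fp`. -/
structure Same (I : Instance) (fp : ℕ) (s₀ s : Store) : Prop where
  nat : ∀ a, a < I.n + 8 ∨ (2 * I.n + 64 ≤ a ∧ a < fp + 3) ∨ (fp + 16 ≤ a ∧ a < fp + 16 + 2 * I.n) →
    s.nat a = s₀.nat a
  real : ∀ a, a ≤ fp → a ≠ 1 → s.real a = s₀.real a

/-- The parent map in the frame at `fp`. -/
def treeAt (I : Instance) (fp : ℕ) (s : Store) : Fin I.n → ℕ :=
  fun v => s.nat (fp + (16 + 2 * I.n) + v)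

/-- If cell `6` of the frame at `fp` is not zero, it is one more than a bound on the cost of
the tree in the frame, which has the required properties. -/
def Sol (I : Instance) (F : Finset (Fin I.n) → ℝ) (r : Fin I.n) (Y X : Finset (Fin I.n)) (τ : ℝ)
    (fp : ℕ) (s : Store) : Prop :=
  s.nat (fp + 6) ≠ 0 → IsParentMap I r (treeAt I fp s) ∧ Y ⊆ pverts (treeAt I fp s) ∧
    τ ≤ F (X ∪ pverts (treeAt I fp s)) ∧
    ∑ e ∈ pedges (treeAt I fp s), I.cost e + 1 ≤ s.nat (fp + 6)

/-- A tree of cost at most `c` has been found. -/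
def Got (fp : ℕ) (s : Store) (c : ℕ) : Prop := s.nat (fp + 6) ≠ 0 ∧ s.nat (fp + 6) ≤ c + 1

theorem Sol.congr {r : Fin I.n} {Y X : Finset (Fin I.n)} {τ : ℝ} {fp fp' : ℕ} {s s' : Store}
    (h : Sol I F r Y X τ fp s) (h6 : s'.nat (fp' + 6) = s.nat (fp + 6))
    (ht : ∀ v, v < I.n → s'.nat (fp' + (16 + 2 * I.n) + v) = s.nat (fp + (16 + 2 * I.n) + v)) :
    Sol I F r Y X τ fp' s' := by
  have : treeAt I fp' s' = treeAt I fp s := funext fun v => ht v v.2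
  simpa only [Sol, this, h6] using h

/-- Three independent facts about one candidate: earlier successes are not lost, the stored tree
stays correct, and this candidate, if it qualifies, is matched in cost. Only the last depends on the
candidate, so a loop over all candidates accumulates it. -/
theorem runs_baseBody {s₀ s : Store} {fp J N W e T : ℕ} {M : ℝ} {r c : Fin I.n}
    (hg : Globals I fp J N W e M s₀) (hs : Same I fp s₀ s) (hr : s₀.nat fp = r)
    (hc : s.nat (I.n + 10) = c) (hT : (I.n + 2) * 400 + (e + 2) * 50 ≤ T) :
    Runs I k P baseBody s T (fun s' => Same I fp s₀ s' ∧ s'.nat (I.n + 10) = c ∧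
      (∀ d, Got fp s d → Got fp s' d) ∧
      (Sol I (scaled I e) r (setAt I.n s₀.nat (fp + (16 + 0 * I.n)))
        (setAt I.n s₀.nat (fp + (16 + 1 * I.n))) (s₀.real fp) fp s →
      Sol I (scaled I e) r (setAt I.n s₀.nat (fp + (16 + 0 * I.n)))
        (setAt I.n s₀.nat (fp + (16 + 1 * I.n))) (s₀.real fp) fp s') ∧
      ((c = r ∨ (r, c) ∈ I.edges) → setAt I.n s₀.nat (fp + (16 + 0 * I.n)) ⊆ {r, c} →
        s₀.real fp ≤ scaled I e (setAt I.n s₀.nat (fp + (16 + 1 * I.n)) ∪ {r, c}) →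
        Got fp s' (if c = r then 0 else I.cost (r, c)))) := by
  have hlow := hg.low
  set Y := setAt I.n s₀.nat (fp + (16 + 0 * I.n)) with hY
  set X := setAt I.n s₀.nat (fp + (16 + 1 * I.n)) with hX
  have hrn := r.2
  have hcn := c.2
  have f : s.nat (I.n + 0) = fp := by rw [hs.nat _ (by omega), hg.frame]
  have fr : s.nat (fp + 0) = r := by rw [hs.nat _ (by omega)]; exact hr
  refine Runs.ite (T' := (I.n + 2) * 400 + (e + 2) * 50 - 50) (fun hp => ?_) (fun hp => ?_) ?_
  rotate_left
  · refine Runs.skip (by omega) ⟨hs, hc, fun d h => h, fun h => h, fun h _ _ => absurd ?_ hp⟩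
    rw [holds_orB, holds_eqB]
    simp only [BExp.Holds, NExp.eval, eval_gv, eval_var, f, fr, hc]
    rcases h with h | h
    · left; rw [h]
    · right; simp [h]
  · simp only [orB, eqB, BExp.size, NExp.size, gv, glob, var]
    omega
  have hedge : c = r ∨ (r, c) ∈ I.edges := by
    rw [holds_orB, holds_eqB] at hp
    simp only [BExp.Holds, NExp.eval, eval_gv, eval_var, f, fr, hc] at hp
    rcases hp with h | h
    · exact Or.inl (Fin.ext h)
    · right
      by_contra hno
      simp [hno] at h
  -- the cost
  set w := (if c = r then 0 else I.cost (r, c)) with hw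
  refine Runs.seq (T₁ := 50) (T₂ := (I.n + 2) * 400 + (e + 2) * 50 - 100)
    (Q₁ := fun s' => s'.real = s.real ∧ s'.nat (I.n + 11) = w ∧
      ∀ b, b ≠ I.n + 11 → s'.nat b = s.nat b) ?_ ?_ (by omega)
  · refine Runs.ite (T' := 20) (fun h => ?_) (fun h => ?_) (by
      simp [eqB, BExp.size, NExp.size, gv, glob, var])
    all_goals
      rw [holds_eqB] at h
      simp only [NExp.eval, eval_gv, eval_var, f, fr, hc] at h
    · exact Runs.setNat rfl (by rw [hw, if_pos (Fin.ext h)]; rfl) (by simp [glob, NExp.size])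
    · have hne : c ≠ r := fun h' => h (by rw [h'])
      refine Runs.setNat rfl ?_ (by simp [glob, gv, var, NExp.size])
      simp only [NExp.eval, eval_gv, eval_var, f, fr, hc]
      simp [hw, hne, hedge.resolve_left hne]
  rintro s₁ ⟨a₁, a₂, a₃⟩
  -- the required vertices
  refine Runs.seq (T₁ := (I.n + 2) * 140) (T₂ := (I.n + 2) * 260 + (e + 2) * 50 - 100)
    (runs_check (fun v => s₀.nat (fp + (16 + 0 * I.n) + v) ≠ 0 ∧ v ≠ r ∧ v ≠ c) ?_ ?_) ?_ (by omega)
  · intro s' v hv h₁ h₂ h₃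
    have f' : s'.nat (I.n + 0) = fp := by rw [h₂ _ (by omega) (by omega), a₃ _ (by omega), f]
    have fr' : s'.nat (fp + 0) = r := by rw [h₂ _ (by omega) (by omega), a₃ _ (by omega), fr]
    have fc' : s'.nat (I.n + 10) = c := by rw [h₂ _ (by omega) (by omega), a₃ _ (by omega), hc]
    have fy' : s'.nat (fp + (16 + 0 * I.n) + v) = s₀.nat (fp + (16 + 0 * I.n) + v) := by
      rw [h₂ _ (by omega) (by omega), a₃ _ (by omega), hs.nat _ (by omega)]
    have e₁ : (BExp.natLE (.lit 1) (elt (loc 16 0) (gv 8))).Holds I k s' ↔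
        s₀.nat (fp + (16 + 0 * I.n) + v) ≠ 0 := by
      simp only [BExp.Holds, NExp.eval, eval_elt, eval_loc, eval_gv, h₃, f', fy']
      omega
    have e₂ : (BExp.not (orB (eqB (gv 8) (.mem (var 0))) (eqB (gv 8) (gv 10)))).Holds I k s' ↔
        v ≠ r ∧ v ≠ c := by
      rw [BExp.Holds, holds_orB, holds_eqB, holds_eqB]
      simp only [NExp.eval, eval_var, eval_gv, h₃, f', fr', fc']
      omega
    rw [BExp.Holds, e₁, e₂]
  · refine Nat.mul_le_mul_left _ ?_
    simp [orB, eqB, BExp.size, NExp.size, gv, glob, var, elt, loc, nmul]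
  rintro s₂ ⟨b₁, b₂, b₃⟩
  have hcheck : s₂.nat (I.n + 12) = 0 ↔ Y ⊆ {r, c} := by
    rw [b₂]
    constructor
    · intro h v hv
      by_contra hno
      simp only [Finset.mem_insert, Finset.mem_singleton, not_or] at hno
      exact h v v.2 ⟨mem_setAt.1 hv, fun h => hno.1 (Fin.ext h), fun h => hno.2 (Fin.ext h)⟩
    · rintro h v hv ⟨h₁, h₂, h₃⟩
      have := h (mem_setAt.2 h₁ : (⟨v, hv⟩ : Fin I.n) ∈ Y)
      simp only [Finset.mem_insert, Finset.mem_singleton] at this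
      rcases this with h | h
      · exact h₂ (congrArg Fin.val h)
      · exact h₃ (congrArg Fin.val h)
  -- the set whose reward is queried
  refine Runs.seq (T₁ := (I.n + 1) * 140) (T₂ := (I.n + 2) * 120 + (e + 2) * 50 - 100)
    (runs_fill (A := I.n + 64)
      (fun v => if s₀.nat (fp + (16 + 1 * I.n) + v) ≠ 0 ∨ v = r ∨ v = c then 1 else 0)
      (by omega) ?_ ?_) ?_ (by omega)
  · intro s' v hv h₁ h₂ h₃
    have f' : s'.nat (I.n + 0) = fp := by
      rw [h₂ _ (by omega) (by omega), b₃ _ (by omega) (by omega), a₃ _ (by omega), f]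
    have fr' : s'.nat (fp + 0) = r := by
      rw [h₂ _ (by omega) (by omega), b₃ _ (by omega) (by omega), a₃ _ (by omega), fr]
    have fc' : s'.nat (I.n + 10) = c := by
      rw [h₂ _ (by omega) (by omega), b₃ _ (by omega) (by omega), a₃ _ (by omega), hc]
    have fy' : s'.nat (fp + (16 + 1 * I.n) + v) = s₀.nat (fp + (16 + 1 * I.n) + v) := by
      rw [h₂ _ (by omega) (by omega), b₃ _ (by omega) (by omega), a₃ _ (by omega),
        hs.nat _ (by omega)]
    have e₁ : (orB (.natLE (.lit 1) (elt (loc 16 1) (gv 8)))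
        (orB (eqB (gv 8) (.mem (var 0))) (eqB (gv 8) (gv 10)))).Holds I k s' ↔
        (s₀.nat (fp + (16 + 1 * I.n) + v) ≠ 0 ∨ v = r ∨ v = c) := by
      rw [holds_orB, holds_orB, holds_eqB, holds_eqB, BExp.Holds]
      simp only [NExp.eval, eval_elt, eval_loc, eval_var, eval_gv, h₃, f', fr', fc', fy']
      omega
    rw [e₁]
    exact ⟨rfl, fun h => by rw [if_pos h]; rfl, fun h => by rw [if_neg h]; rfl⟩
  · refine Nat.mul_le_mul_left _ ?_
    simp [orB, eqB, BExp.size, NExp.size, gv, glob, var, elt, loc, nmul]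
  rintro s₃ ⟨d₁, d₂, d₃⟩
  have hset : setAt I.n s₃.nat (I.n + 64) = X ∪ {r, c} := by
    ext v
    rw [mem_setAt, d₂ v v.2]
    simp only [Finset.mem_union, hX, mem_setAt, Finset.mem_insert, Finset.mem_singleton, Fin.ext_iff]
    split_ifs with h
    · exact iff_of_true one_ne_zero h
    · exact iff_of_false (not_not.2 rfl) h
  refine Runs.seq (T₁ := (e + 2) * 50) (T₂ := (I.n + 2) * 120 - 100)
    (runs_evalF (e := e) ?_ le_rfl) ?_ (by omega)
  · rw [d₃ _ (by omega) (by omega), b₃ _ (by omega) (by omega), a₃ _ (by omega),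
      hs.nat _ (by omega), hg.scale]
  rintro s₄ ⟨e₁, e₂, e₃⟩
  rw [hset] at e₂
  -- summary of the store
  have q : ∀ a, ¬ (I.n + 64 ≤ a ∧ a < I.n + 64 + I.n) → a ≠ I.n + 8 → a ≠ I.n + 9 → a ≠ I.n + 11 →
      a ≠ I.n + 12 → s₄.nat a = s.nat a := by
    intro a h₁ h₂ h₃ h₄ h₅
    rw [e₁ _ h₃, d₃ _ h₁ h₂, b₃ _ h₅ h₂, a₃ _ h₄]
  have qr : ∀ a, a ≠ 1 → s₄.real a = s.real a := by
    intro a ha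
    rw [e₃ _ ha, d₁, b₁, a₁]
  have f₄ : s₄.nat (I.n + 0) = fp := by
    rw [q _ (by omega) (by omega) (by omega) (by omega) (by omega), f]
  have fr₄ : s₄.nat (fp + 0) = r := by
    rw [q _ (by omega) (by omega) (by omega) (by omega) (by omega), fr]
  have fc₄ : s₄.nat (I.n + 10) = c := by
    rw [q _ (by omega) (by omega) (by omega) (by omega) (by omega), hc]
  have fw₄ : s₄.nat (I.n + 11) = w := by
    rw [e₁ _ (by omega), d₃ _ (by omega) (by omega), b₃ _ (by omega) (by omega), a₂]
  have f12 : s₄.nat (I.n + 12) = s₂.nat (I.n + 12) := by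
    rw [e₁ _ (by omega), d₃ _ (by omega) (by omega)]
  have f6 : s₄.nat (fp + 6) = s.nat (fp + 6) :=
    q _ (by omega) (by omega) (by omega) (by omega) (by omega)
  have fτ : s₄.real fp = s₀.real fp := by
    rw [qr _ (by omega), hs.real _ le_rfl (by omega)]
  have htest : (BExp.and (.natLE (gv 12) (.lit 0)) (.and (.realLE (.mem (gv 0)) (.mem (.lit 1)))
        (orB (.natLE (.mem (var 6)) (.lit 0))
          (.natLE (.add (gv 11) (.lit 2)) (.mem (var 6)))))).Holds I k s₄ ↔
      Y ⊆ {r, c} ∧ s₀.real fp ≤ scaled I e (X ∪ {r, c}) ∧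
        (s.nat (fp + 6) = 0 ∨ w + 2 ≤ s.nat (fp + 6)) := by
    rw [← hcheck, ← f12]
    simp only [BExp.Holds, holds_orB, NExp.eval, RExp.eval, eval_var, eval_gv, f₄, fw₄, f6, fτ, e₂, scaled,
      Nat.le_zero]
  refine Runs.ite (T' := (I.n + 2) * 120 - 150) (fun h => ?_) (fun h => ?_) ?_
  rotate_left
  · refine Runs.skip (by omega) ⟨⟨?_, ?_⟩, fc₄, ?_, ?_, ?_⟩
    · intro a ha
      rw [q _ (by omega) (by omega) (by omega) (by omega) (by omega), hs.nat a ha]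
    · intro a ha ha1
      rw [qr _ ha1, hs.real a ha ha1]
    · intro d hd
      simpa only [Got, f6] using hd
    · refine fun hsol => hsol.congr f6 fun v hv => ?_
      exact q _ (by omega) (by omega) (by omega) (by omega) (by omega)
    · intro _ h₁ h₂
      rw [htest] at h
      have h₃ : ¬ (s.nat (fp + 6) = 0 ∨ w + 2 ≤ s.nat (fp + 6)) := fun h' => h ⟨h₁, h₂, h'⟩
      rw [Got, f6]
      omega
  · simp only [orB, BExp.size, NExp.size, RExp.size, gv, glob, var]
    omega
  rw [htest] at h
  refine Runs.seq (T₁ := 15) (T₂ := (I.n + 2) * 120 - 165) (Runs.setNat (A := fp + 6) (V := w + 1)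
    (by rw [eval_var, f₄]) (by simp only [NExp.eval, eval_gv, fw₄])
    (by simp [NExp.size, gv, glob, var])) ?_ (by omega)
  rintro s₅ ⟨g₁, g₂, g₃⟩
  refine Runs.seq (T₁ := (I.n + 1) * 80) (T₂ := 30) (runs_fill (A := fp + (16 + 2 * I.n))
    (fun v => if v = c then r + 2 else 0) (by omega) ?_ ?_) ?_ (by omega)
  · intro s' v hv h₁ h₂ h₃
    have f' : s'.nat (I.n + 0) = fp := by
      rw [h₂ _ (by omega) (by omega), g₃ _ (by omega), f₄]
    have fr' : s'.nat (fp + 0) = r := by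
      rw [h₂ _ (by omega) (by omega), g₃ _ (by omega), fr₄]
    have fc' : s'.nat (I.n + 10) = c := by
      rw [h₂ _ (by omega) (by omega), g₃ _ (by omega), fc₄]
    rw [holds_eqB]
    simp only [NExp.eval, eval_loc, eval_var, eval_gv, h₃, f', fr', fc']
    exact ⟨trivial, fun h => by rw [if_pos h], fun h => by rw [if_neg h]⟩
  · refine Nat.mul_le_mul_left _ ?_
    simp [eqB, BExp.size, NExp.size, gv, glob, var, loc, nmul]
  rintro s₆ ⟨i₁, i₂, i₃⟩
  refine (Runs.setNat (A := fp + (16 + 2 * I.n) + r) (V := 1) ?_ rfl ?_).mono le_rfl ?_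
  · simp only [NExp.eval, eval_loc, eval_var]
    rw [i₃ _ (by omega) (by omega), g₃ _ (by omega), f₄, i₃ _ (by omega) (by omega),
      g₃ _ (by omega), fr₄]
  · simp [NExp.size, gv, glob, var, loc, nmul]
  rintro s₇ ⟨j₁, j₂, j₃⟩
  have htree : treeAt I fp s₇ = pedge r c := by
    funext v
    have hv := v.2
    simp only [treeAt, pedge]
    by_cases hvr : v = r
    · rw [if_pos hvr, hvr, j₂]
    · have : (v : ℕ) ≠ r := fun h => hvr (Fin.ext h)
      rw [if_neg hvr, j₃ _ (by omega), i₂ v v.2]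
      by_cases hvc : v = c
      · rw [if_pos hvc, if_pos (congrArg Fin.val hvc)]
      · rw [if_neg hvc, if_neg fun h => hvc (Fin.ext h)]
  have hbest : s₇.nat (fp + 6) = w + 1 := by
    rw [j₃ _ (by omega), i₃ _ (by omega) (by omega), g₂]
  refine ⟨⟨?_, ?_⟩, ?_, ?_, ?_, ?_⟩
  · intro a ha
    rw [j₃ _ (by omega), i₃ _ (by omega) (by omega), g₃ _ (by omega),
      q _ (by omega) (by omega) (by omega) (by omega) (by omega), hs.nat a ha]
  · intro a ha ha1
    rw [j₁, i₁, g₁, qr _ ha1, hs.real a ha ha1]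
  · rw [j₃ _ (by omega), i₃ _ (by omega) (by omega), g₃ _ (by omega), fc₄]
  · rintro d ⟨hd₁, hd₂⟩
    rw [Got, hbest]
    omega
  · rintro - -
    rw [htree, hbest, pverts_pedge]
    exact ⟨isParentMap_pedge hedge, h.1, h.2.1, by have := cost_pedge_le r c; omega⟩
  · rintro - - -
    rw [Got, hbest]
    omega

end

/-- Call the procedure with the next frame. -/
def callNext : Com :=
  .seq (.setNat (glob 0) (loc 16 5)) (.seq (.call 0)
    (.setNat (glob 0) (.sub (gv 0) (.add (.lit 16) (nmul 5)))))

/-- `for v do dst[v] := e`, where `v` is the global variable `8`. -/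
def assign (dst e : NExp) : Com := fill dst (.natLE (.lit 0) (.lit 0)) e (.lit 0)

/-! ### The interface of a recursive call. -/

section
variable {I : Instance} {k : ℕ} {P : List Com}

/-- What the procedure achieves in time `T` for rank `l`. -/
def Spec (I : Instance) (k : ℕ) (P : List Com) (J s N W e : ℕ) (M : ℝ) (l T : ℕ) (c : Com) : Prop :=
  ∀ (s₀ : Store) (fp : ℕ) (r : Fin I.n), Globals I fp J N W e M s₀ → s₀.nat fp = r →
    s₀.nat (fp + 1) = l → s₀.nat (fp + 2) = rkPl J l →
    Runs I k P c s₀ T (fun s' => Same I fp s₀ s' ∧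
      Sol I (scaled I e) r (setAt I.n s₀.nat (fp + (16 + 0 * I.n)))
        (setAt I.n s₀.nat (fp + (16 + 1 * I.n))) (s₀.real fp) fp s' ∧
      ∀ c, Attainable I (scaled I e) M N J s l r (setAt I.n s₀.nat (fp + (16 + 0 * I.n)))
        (setAt I.n s₀.nat (fp + (16 + 1 * I.n))) (s₀.real fp) c → Got fp s' c)

theorem Spec.mono {J s N W e l T T' : ℕ} {M : ℝ} {c : Com} (h : Spec I k P J s N W e M l T c)
    (hT : T ≤ T') : Spec I k P J s N W e M l T' c :=
  fun s₀ fp r h₁ h₂ h₃ h₄ => (h s₀ fp r h₁ h₂ h₃ h₄).mono hT fun _ h => h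

theorem Globals.congr {fp fp' J N W e : ℕ} {M : ℝ} {s s' : Store} (h : Globals I fp J N W e M s)
    (hf : s'.nat (I.n + 0) = fp') (hle : fp ≤ fp')
    (hn : ∀ a, I.n + 0 < a → a < I.n + 8 → s'.nat a = s.nat a) (hr : s'.real 0 = s.real 0) :
    Globals I fp' J N W e M s' :=
  ⟨hf, by rw [hn _ (by omega) (by omega), h.period], by rw [hn _ (by omega) (by omega), h.targets],
    by rw [hn _ (by omega) (by omega), h.masks], by rw [hn _ (by omega) (by omega), h.scale],
    by rw [hr, h.unit], h.low.trans hle⟩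

theorem Same.globals {fp J N W e : ℕ} {M : ℝ} {s₀ s : Store} (hs : Same I fp s₀ s)
    (h : Globals I fp J N W e M s₀) : Globals I fp J N W e M s :=
  h.congr (by rw [hs.nat _ (by omega), h.frame]) le_rfl
    (fun a _ h₂ => hs.nat a (Or.inl h₂)) (hs.real 0 (Nat.zero_le _) (by omega))

theorem Same.trans {fp : ℕ} {s₀ s₁ s₂ : Store} (h₁ : Same I fp s₀ s₁) (h₂ : Same I fp s₁ s₂) :
    Same I fp s₀ s₂ :=
  ⟨fun a ha => (h₂.nat a ha).trans (h₁.nat a ha),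
    fun a ha ha1 => (h₂.real a ha ha1).trans (h₁.real a ha ha1)⟩

/-- The frame pointer is advanced and later moved back by subtraction, so no stack is needed: a
callee leaves all older frames unchanged. -/
theorem runs_callNext {J s N W e l T fp fp' : ℕ} {M : ℝ}
    (hspec : Spec I k P J s N W e M l T (.call 0)) {s₀ : Store} {r : Fin I.n}
    (hg : Globals I fp J N W e M s₀) (hfp : fp' = fp + (16 + 5 * I.n))
    (h₀ : s₀.nat fp' = r) (h₁ : s₀.nat (fp' + 1) = l) (h₂ : s₀.nat (fp' + 2) = rkPl J l)
    {T' : ℕ} (hT : T + 70 ≤ T') :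
    Runs I k P callNext s₀ T' (fun s' =>
      (∀ a, a < I.n + 8 ∨ (2 * I.n + 64 ≤ a ∧ a < fp') → s'.nat a = s₀.nat a) ∧
      (∀ a, a ≤ fp' → a ≠ 1 → s'.real a = s₀.real a) ∧
      Sol I (scaled I e) r (setAt I.n s₀.nat (fp' + (16 + 0 * I.n)))
        (setAt I.n s₀.nat (fp' + (16 + 1 * I.n))) (s₀.real fp') fp' s' ∧
      ∀ c, Attainable I (scaled I e) M N J s l r (setAt I.n s₀.nat (fp' + (16 + 0 * I.n)))
        (setAt I.n s₀.nat (fp' + (16 + 1 * I.n))) (s₀.real fp') c → Got fp' s' c) := by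
  have hlow := hg.low
  refine Runs.seq (T₁ := 30) (T₂ := T + 40) (Runs.setNat (A := I.n + 0) (V := fp') rfl
    (by rw [eval_loc, hg.frame, hfp]) (by simp [glob, loc, gv, nmul, NExp.size])) ?_ (by omega)
  rintro s₁ ⟨a₁, a₂, a₃⟩
  have hY : ∀ j, setAt I.n s₁.nat (fp' + (16 + j * I.n)) = setAt I.n s₀.nat (fp' + (16 + j * I.n)) :=
    fun j => setAt_congr fun v hv => a₃ _ (by omega)
  refine Runs.seq (T₁ := T) (T₂ := 40) (hspec s₁ fp' r (hg.congr a₂ (by omega)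
    (fun a h _ => a₃ a (by omega)) (by rw [a₁])) (by rw [a₃ _ (by omega), h₀])
    (by rw [a₃ _ (by omega), h₁]) (by rw [a₃ _ (by omega), h₂])) ?_ (by omega)
  rintro s₂ ⟨b₁, b₂, b₃⟩
  rw [hY, hY, a₁] at b₂
  refine (Runs.setNat (A := I.n + 0) (V := fp) rfl ?_
    (by simp [glob, gv, nmul, NExp.size])).mono le_rfl ?_
  · simp only [NExp.eval, eval_gv, eval_nmul]
    rw [b₁.nat _ (by omega), a₂]
    omega
  rintro s₃ ⟨c₁, c₂, c₃⟩
  refine ⟨?_, ?_, ?_, ?_⟩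
  · intro a ha
    by_cases h0 : a = I.n + 0
    · rw [h0, c₂, hg.frame]
    · rw [c₃ _ h0, b₁.nat _ (by omega), a₃ _ h0]
  · intro a ha ha1
    rw [c₁, b₁.real a ha ha1, a₁]
  · exact b₂.congr (c₃ _ (by omega)) fun v hv => c₃ _ (by omega)
  · intro c hc
    have := b₃ c (by rwa [hY, hY, a₁])
    rwa [Got, c₃ _ (by omega)]

theorem runs_assign {s : Store} {dst ex : NExp} {A T : ℕ} (val : ℕ → ℕ)
    (hA : I.n + 8 < A ∨ A + I.n ≤ I.n + 8)
    (h : ∀ s' v, v < I.n → s'.real = s.real →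
      (∀ a, ¬ (A ≤ a ∧ a < A + I.n) → a ≠ I.n + 8 → s'.nat a = s.nat a) → s'.nat (I.n + 8) = v →
      dst.eval I k s' = A ∧ ex.eval I k s' = val v)
    (hT : (I.n + 1) * (dst.size + ex.size + 34) ≤ T) :
    Runs I k P (assign dst ex) s T (fun s' => s'.real = s.real ∧
      (∀ v, v < I.n → s'.nat (A + v) = val v) ∧
      ∀ a, ¬ (A ≤ a ∧ a < A + I.n) → a ≠ I.n + 8 → s'.nat a = s.nat a) := by
  refine runs_fill val hA (fun s' v h₁ h₂ h₃ h₄ => ?_) ?_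
  · obtain ⟨g₁, g₂⟩ := h s' v h₁ h₂ h₃ h₄
    exact ⟨g₁, fun _ => g₂, fun hn => absurd (le_refl 0) hn⟩
  · refine le_trans (Nat.mul_le_mul_left _ ?_) hT
    simp only [BExp.size, NExp.size]
    omega

end

/-- Prepare the next frame for the first recursive call, and compute the set of required vertices
of the second one. -/
def prepareFirst : Com :=
  .seq distribute
  (.seq (.setNat (.add (loc 16 4) (.mem (var 4))) (.lit 1))
  (.seq (assign (loc 32 6) (elt (loc 16 1) (gv 8)))
  (.seq (.setNat (loc 16 5) (.mem (var 4)))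
  (.seq (.setNat (loc 17 5) (.mem (var 2)))
  (.seq (.setNat (loc 18 5) (.sub (.mem (var 2)) (gv 1)))
    (.setReal (loc 16 5) (.mem (var 1))))))))

/-- Save the result of the first recursive call, and prepare the next frame for the second one. -/
def prepareSecond : Com :=
  -- The second call reuses the frame of the first, so the cost and the tree that were found there
  -- are saved first.
  .seq (.setNat (var 7) (.mem (loc 22 5)))
  (.seq (assign (loc 16 3) (elt (loc 32 7) (gv 8)))
  -- Only the nonzero pattern of an array matters, so the sum represents the union of `X` with the
  -- vertices of the first tree.
  (.seq (assign (loc 32 6) (.add (elt (loc 16 1) (gv 8)) (elt (loc 16 3) (gv 8))))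
  (.seq (assign (loc 32 5) (elt (loc 16 4) (gv 8)))
  (.seq (.setNat (loc 16 5) (.mem (var 0)))
  (.seq (.setNat (loc 17 5) (.sub (.mem (var 1)) (.lit 1)))
  -- When the new rank is itself the stored multiple of `J`, the second call opens the level below,
  -- as in `rkPl_eq`.
  (.seq (.ite (eqB (.sub (.mem (var 1)) (.lit 1)) (.mem (var 2)))
      (.setNat (loc 18 5) (.sub (.mem (var 2)) (gv 1)))
      (.setNat (loc 18 5) (.mem (var 2))))
    (.setReal (loc 16 5) (.mem (gv 0)))))))))

/-- Combine the results of the two recursive calls. -/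
def combine : Com :=
  .ite (.and (.natLE (.lit 1) (.mem (loc 22 5))) (orB (.natLE (.mem (var 6)) (.lit 0))
      -- Both summands are costs plus one, while the best value is a cost plus one: the comparison
      -- is strict improvement.
      (.natLE (.add (.mem (var 7)) (.mem (loc 22 5))) (.mem (var 6)))))
    (.seq (.setNat (var 6) (.sub (.add (.mem (var 7)) (.mem (loc 22 5))) (.lit 1)))
      (fill (loc 16 2) (.natLE (.lit 1) (elt (loc 32 7) (gv 8))) (elt (loc 32 7) (gv 8))
        (elt (loc 16 3) (gv 8))))
    .skip

/-- The treatment of one guess. -/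
def guessBody : Com :=
  .seq prepareFirst (.seq callNext (.ite (.natLE (.lit 1) (.mem (loc 22 5)))
    (.seq prepareSecond (.seq callNext combine)) .skip))

section
variable {I : Instance} {k : ℕ} {P : List Com}

/-- The subset of the set at address `a` that is encoded by `m`. -/
def maskSet (I : Instance) (s : Store) (a m : ℕ) : Finset (Fin I.n) :=
  (setAt I.n s.nat a).filter fun v => maskAt (fun x => s.nat (a + x)) m v % 2 = 1

theorem runs_prepareFirst {J N W e fp fp' m T : ℕ} {M : ℝ} {s₀ s : Store}
    (hg : Globals I fp J N W e M s₀) (hs : Same I fp s₀ s) (hfp : fp' = fp + (16 + 5 * I.n))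
    (hm : s.nat (fp + 3) = m) {u : Fin I.n} (hu : s.nat (fp + 4) = u)
    (hT : (I.n + 2) * 400 ≤ T) :
    Runs I k P prepareFirst s T (fun s' =>
      (s'.nat fp' = u ∧ s'.nat (fp' + 1) = s₀.nat (fp + 2) ∧ s'.nat (fp' + 2) = s₀.nat (fp + 2) - J ∧
        s'.real fp' = s.real (fp + 1)) ∧
      setAt I.n s'.nat (fp' + (16 + 0 * I.n)) = maskSet I s₀ (fp + (16 + 0 * I.n)) m ∧
      setAt I.n s'.nat (fp' + (16 + 1 * I.n)) = setAt I.n s₀.nat (fp + (16 + 1 * I.n)) ∧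
      setAt I.n s'.nat (fp + (16 + 4 * I.n)) = insert u
        (setAt I.n s₀.nat (fp + (16 + 0 * I.n)) \ maskSet I s₀ (fp + (16 + 0 * I.n)) m) ∧
      (∀ a, a < I.n + 8 ∨ (2 * I.n + 64 ≤ a ∧ a < fp + (16 + 4 * I.n)) → s'.nat a = s.nat a) ∧
      ∀ a, a ≠ fp' → s'.real a = s.real a) := by
  have hlow := hg.low
  have hun := u.2
  have f : s.nat (I.n + 0) = fp := by rw [hs.nat _ (by omega), hg.frame]
  refine Runs.seq (T₁ := (I.n + 2) * 170) (T₂ := (I.n + 2) * 230) (runs_distribute f hlow le_rfl) ?_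
    (by omega)
  rintro s₁ ⟨a₁, a₂, a₃, a₄⟩
  have hmask : ∀ v, v < I.n → maskAt (fun v => s.nat (fp + 16 + v)) (s.nat (fp + 3)) v =
      maskAt (fun x => s₀.nat (fp + (16 + 0 * I.n) + x)) m v := by
    intro v hv
    rw [hm]
    refine maskAt_congr m fun x hx => ?_
    rw [hs.nat _ (by omega), show fp + 16 + x = fp + (16 + 0 * I.n) + x by omega]
  have hy : ∀ v, v < I.n → s.nat (fp + 16 + v) = s₀.nat (fp + (16 + 0 * I.n) + v) := by
    intro v hv
    rw [hs.nat _ (by omega), show fp + 16 + v = fp + (16 + 0 * I.n) + v by omega]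
  have f₁ : s₁.nat (I.n + 0) = fp := by
    rw [a₄ _ (by omega) (by omega) (by omega) (by omega), f]
  have fu₁ : s₁.nat (fp + 4) = u := by
    rw [a₄ _ (by omega) (by omega) (by omega) (by omega), hu]
  refine Runs.seq (T₁ := 35) (T₂ := (I.n + 2) * 230 - 35) (Runs.setNat
    (A := fp + (16 + 4 * I.n) + u) (V := 1) ?_ rfl ?_) ?_ (by omega)
  · simp only [NExp.eval, eval_loc, eval_var, f₁, fu₁]
  · simp [NExp.size, gv, glob, var, loc, nmul]
  rintro s₂ ⟨b₁, b₂, b₃⟩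
  refine Runs.seq (T₁ := (I.n + 1) * 90) (T₂ := 140) (runs_assign (A := fp + (32 + 6 * I.n))
    (fun v => s₀.nat (fp + (16 + 1 * I.n) + v)) (by omega) ?_ ?_) ?_ (by omega)
  · intro s' v hv h₁ h₂ h₃
    have f' : s'.nat (I.n + 0) = fp := by
      rw [h₂ _ (by omega) (by omega), b₃ _ (by omega), f₁]
    rw [eval_elt]
    simp only [eval_loc, eval_gv, f', h₃, true_and]
    rw [h₂ _ (by omega) (by omega), b₃ _ (by omega),
      a₄ _ (by omega) (by omega) (by omega) (by omega), hs.nat _ (by omega)]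
  · refine Nat.mul_le_mul_left _ ?_
    simp [NExp.size, gv, glob, elt, loc, nmul]
  rintro s₃ ⟨c₁, c₂, c₃⟩
  have q₃ : ∀ a, a < I.n + 8 ∨ (2 * I.n + 64 ≤ a ∧ a < fp + (16 + 4 * I.n)) → s₃.nat a = s.nat a := by
    intro a ha
    rw [c₃ _ (by omega) (by omega), b₃ _ (by omega),
      a₄ _ (by omega) (by omega) (by omega) (by omega)]
  refine Runs.seq (T₁ := 35) (T₂ := 105) (Runs.setNat (A := fp') (V := u) ?_ ?_ ?_) ?_ (by omega)
  · rw [eval_loc, q₃ _ (by omega), f, hfp]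
  · simp only [NExp.eval, eval_var]
    rw [q₃ (I.n + 0) (by omega), f, q₃ _ (by omega), hu]
  · simp [NExp.size, gv, glob, var, loc, nmul]
  rintro s₄ ⟨d₁, d₂, d₃⟩
  have f₄ : s₄.nat (I.n + 0) = fp := by rw [d₃ _ (by omega), q₃ _ (by omega), f]
  refine Runs.seq (T₁ := 35) (T₂ := 70) (Runs.setNat (A := fp' + 1) (V := s₀.nat (fp + 2)) ?_ ?_ ?_) ?_
    (by omega)
  · rw [eval_loc, f₄, hfp]; omega
  · simp only [NExp.eval, eval_var, f₄]
    rw [d₃ _ (by omega), q₃ _ (by omega), hs.nat _ (by omega)]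
  · simp [NExp.size, gv, glob, var, loc, nmul]
  rintro s₅ ⟨e₁, e₂, e₃⟩
  have f₅ : s₅.nat (I.n + 0) = fp := by rw [e₃ _ (by omega), f₄]
  refine Runs.seq (T₁ := 40) (T₂ := 30) (Runs.setNat (A := fp' + 2) (V := s₀.nat (fp + 2) - J) ?_ ?_
    ?_) ?_ (by omega)
  · rw [eval_loc, f₅, hfp]; omega
  · simp only [NExp.eval, eval_var, eval_gv, f₅]
    rw [e₃ _ (by omega), d₃ _ (by omega), q₃ _ (by omega), hs.nat _ (by omega), e₃ _ (by omega),
      d₃ _ (by omega), q₃ _ (by omega), hs.nat _ (by omega), hg.period]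
  · simp [NExp.size, gv, glob, var, loc, nmul]
  rintro s₆ ⟨g₁, g₂, g₃⟩
  have q₆ : ∀ a, a < fp' → s₆.nat a = s₃.nat a := by
    intro a ha
    rw [g₃ _ (by omega), e₃ _ (by omega), d₃ _ (by omega)]
  have hreal : s₆.real = s.real := by rw [g₁, e₁, d₁, c₁, b₁, a₁]
  refine (Runs.setReal (A := fp') (V := s.real (fp + 1)) ?_ ?_ ?_).mono le_rfl ?_
  · rw [eval_loc, q₆ _ (by omega), q₃ _ (by omega), f, hfp]
  · simp only [RExp.eval, eval_var, hreal]
    rw [q₆ (I.n + 0) (by omega), q₃ _ (by omega), f]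
  · simp [NExp.size, RExp.size, gv, glob, var, loc, nmul]
  rintro s₇ ⟨i₁, i₂, i₃⟩
  refine ⟨⟨?_, ?_, ?_, i₂⟩, ?_, ?_, ?_, ?_, ?_⟩
  · rw [i₁, g₃ _ (by omega), e₃ _ (by omega), d₂]
  · rw [i₁, g₃ _ (by omega), e₂]
  · rw [i₁, g₂]
  · ext v
    have hv := v.2
    have h₁ : s₇.nat (fp' + (16 + 0 * I.n) + v) = s₁.nat (fp + (32 + 5 * I.n) + v) := by
      rw [show fp' + (16 + 0 * I.n) + v = fp + (32 + 5 * I.n) + v by omega, i₁, g₃ _ (by omega),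
        e₃ _ (by omega), d₃ _ (by omega), c₃ _ (by omega) (by omega), b₃ _ (by omega)]
    rw [mem_setAt, h₁, a₂ v hv, hmask v hv, hy v hv, maskSet, Finset.mem_filter, mem_setAt]
    split_ifs with h
    · simp only [h, ne_eq, not_false_eq_true, true_and]
      omega
    · exact iff_of_false (not_not.2 rfl) fun h' => h h'.1
  · ext v
    have hv := v.2
    rw [mem_setAt, mem_setAt, show fp' + (16 + 1 * I.n) + v = fp + (32 + 6 * I.n) + v by omega,
      i₁, g₃ _ (by omega), e₃ _ (by omega), d₃ _ (by omega), c₂ v hv]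
  · ext v
    have hv := v.2
    have h₁ : s₇.nat (fp + (16 + 4 * I.n) + v) = s₂.nat (fp + (16 + 4 * I.n) + v) := by
      rw [i₁, q₆ _ (by omega), c₃ _ (by omega) (by omega)]
    rw [mem_setAt, h₁]
    by_cases hvu : v = u
    · rw [hvu, b₂]; simp
    · have : (v : ℕ) ≠ u := fun h => hvu (Fin.ext h)
      rw [b₃ _ (by omega), a₃ v hv, hmask v hv, hy v hv, Finset.mem_insert, Finset.mem_sdiff,
        maskSet, Finset.mem_filter, mem_setAt]
      simp only [hvu, false_or]
      split_ifs with h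
      · simp only [h, ne_eq, not_false_eq_true, true_and]
        omega
      · exact iff_of_false (not_not.2 rfl) fun h' => h h'.1
  · intro a ha
    rw [i₁, q₆ _ (by omega), q₃ _ ha]
  · intro a ha
    rw [i₃ _ ha, hreal]

theorem runs_prepareSecond {J N W e fp fp' T : ℕ} {M : ℝ} {s₀ s : Store}
    (hg : Globals I fp J N W e M s₀) (hs : Same I fp s₀ s) (hfp : fp' = fp + (16 + 5 * I.n))
    (hT : (I.n + 2) * 500 ≤ T) :
    Runs I k P prepareSecond s T (fun s' =>
      (s'.nat fp' = s₀.nat fp ∧ s'.nat (fp' + 1) = s₀.nat (fp + 1) - 1 ∧ s'.nat (fp' + 2) =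
        (if s₀.nat (fp + 1) - 1 = s₀.nat (fp + 2) then s₀.nat (fp + 2) - J else s₀.nat (fp + 2)) ∧
        s'.real fp' = s₀.real fp) ∧
      s'.nat (fp + 7) = s.nat (fp' + 6) ∧
      (∀ v, v < I.n → s'.nat (fp + (16 + 3 * I.n) + v) = s.nat (fp' + (16 + 2 * I.n) + v)) ∧
      setAt I.n s'.nat (fp' + (16 + 0 * I.n)) = setAt I.n s.nat (fp + (16 + 4 * I.n)) ∧
      setAt I.n s'.nat (fp' + (16 + 1 * I.n)) = setAt I.n s₀.nat (fp + (16 + 1 * I.n)) ∪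
        pverts (treeAt I fp' s) ∧
      (∀ a, a < I.n + 8 ∨ (2 * I.n + 64 ≤ a ∧ a < fp + 7) ∨
        (fp + 16 ≤ a ∧ a < fp + (16 + 3 * I.n)) → s'.nat a = s.nat a) ∧
      ∀ a, a ≠ fp' → s'.real a = s.real a) := by
  have hlow := hg.low
  have f : s.nat (I.n + 0) = fp := by rw [hs.nat _ (by omega), hg.frame]
  refine Runs.seq (T₁ := 35) (T₂ := (I.n + 2) * 500 - 35) (Runs.setNat (A := fp + 7)
    (V := s.nat (fp' + 6)) ?_ ?_ ?_) ?_ (by omega)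
  · rw [eval_var, f]
  · simp only [NExp.eval, eval_loc, f]
    congr 1
    omega
  · simp [NExp.size, gv, glob, var, loc, nmul]
  rintro s₁ ⟨a₁, a₂, a₃⟩
  have f₁ : s₁.nat (I.n + 0) = fp := by rw [a₃ _ (by omega), f]
  refine Runs.seq (T₁ := (I.n + 1) * 100) (T₂ := (I.n + 2) * 400 - 35) (runs_assign
    (A := fp + (16 + 3 * I.n)) (fun v => s.nat (fp' + (16 + 2 * I.n) + v)) (by omega) ?_ ?_) ?_
    (by omega)
  · intro s' v hv h₁ h₂ h₃
    have f' : s'.nat (I.n + 0) = fp := by rw [h₂ _ (by omega) (by omega), f₁]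
    rw [eval_elt]
    simp only [eval_loc, eval_gv, f', h₃, true_and]
    rw [h₂ _ (by omega) (by omega), a₃ _ (by omega)]
    congr 1
    omega
  · refine Nat.mul_le_mul_left _ ?_
    simp [NExp.size, gv, glob, elt, loc, nmul]
  rintro s₂ ⟨b₁, b₂, b₃⟩
  have f₂ : s₂.nat (I.n + 0) = fp := by rw [b₃ _ (by omega) (by omega), f₁]
  refine Runs.seq (T₁ := (I.n + 1) * 110) (T₂ := (I.n + 2) * 290 - 35) (runs_assign
    (A := fp + (32 + 6 * I.n))
    (fun v => s₀.nat (fp + (16 + 1 * I.n) + v) + s.nat (fp' + (16 + 2 * I.n) + v)) (by omega) ?_ ?_)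
    ?_ (by omega)
  · intro s' v hv h₁ h₂ h₃
    have f' : s'.nat (I.n + 0) = fp := by rw [h₂ _ (by omega) (by omega), f₂]
    simp only [NExp.eval, eval_elt, eval_loc, eval_gv, f', h₃, true_and]
    rw [h₂ (fp + (16 + 1 * I.n) + v) (by omega) (by omega), b₃ _ (by omega) (by omega),
      a₃ _ (by omega), hs.nat _ (by omega), h₂ _ (by omega) (by omega), b₂ v hv]
  · refine Nat.mul_le_mul_left _ ?_
    simp [NExp.size, gv, glob, elt, loc, nmul]
  rintro s₃ ⟨c₁, c₂, c₃⟩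
  have f₃ : s₃.nat (I.n + 0) = fp := by rw [c₃ _ (by omega) (by omega), f₂]
  refine Runs.seq (T₁ := (I.n + 1) * 100) (T₂ := (I.n + 2) * 190 - 35) (runs_assign
    (A := fp + (32 + 5 * I.n)) (fun v => s.nat (fp + (16 + 4 * I.n) + v)) (by omega) ?_ ?_) ?_
    (by omega)
  · intro s' v hv h₁ h₂ h₃
    have f' : s'.nat (I.n + 0) = fp := by rw [h₂ _ (by omega) (by omega), f₃]
    rw [eval_elt]
    simp only [eval_loc, eval_gv, f', h₃, true_and]
    rw [h₂ _ (by omega) (by omega), c₃ _ (by omega) (by omega), b₃ _ (by omega) (by omega),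
      a₃ _ (by omega)]
  · refine Nat.mul_le_mul_left _ ?_
    simp [NExp.size, gv, glob, elt, loc, nmul]
  rintro s₄ ⟨d₁, d₂, d₃⟩
  have q : ∀ a, a < I.n + 8 ∨ (2 * I.n + 64 ≤ a ∧ a < fp + 7) ∨
        (fp + 16 ≤ a ∧ a < fp + (16 + 3 * I.n)) → s₄.nat a = s.nat a := by
    intro a ha
    rw [d₃ _ (by omega) (by omega), c₃ _ (by omega) (by omega), b₃ _ (by omega) (by omega),
      a₃ _ (by omega)]
  have hr₄ : s₄.real = s.real := by rw [d₁, c₁, b₁, a₁]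
  refine Runs.seq (T₁ := 35) (T₂ := 150) (Runs.setNat (A := fp') (V := s₀.nat fp)
    ?_ ?_ ?_) ?_ (by omega)
  · rw [eval_loc, q _ (by omega), f, hfp]
  · simp only [NExp.eval, eval_var]
    rw [q (I.n + 0) (by omega), f, q _ (by omega), hs.nat _ (by omega)]
    rfl
  · simp [NExp.size, gv, glob, var, loc, nmul]
  rintro s₅ ⟨e₁, e₂, e₃⟩
  have f₅ : s₅.nat (I.n + 0) = fp := by rw [e₃ _ (by omega), q _ (by omega), f]
  refine Runs.seq (T₁ := 35) (T₂ := 110) (Runs.setNat (A := fp' + 1)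
    (V := s₀.nat (fp + 1) - 1) ?_ ?_ ?_) ?_ (by omega)
  · rw [eval_loc, f₅, hfp]; omega
  · simp only [NExp.eval, eval_var, f₅]
    rw [e₃ _ (by omega), q _ (by omega), hs.nat _ (by omega)]
  · simp [NExp.size, gv, glob, var, loc, nmul]
  rintro s₆ ⟨g₁, g₂, g₃⟩
  have f₆ : s₆.nat (I.n + 0) = fp := by rw [g₃ _ (by omega), f₅]
  have fl : s₆.nat (fp + 1) = s₀.nat (fp + 1) := by
    rw [g₃ _ (by omega), e₃ _ (by omega), q _ (by omega), hs.nat _ (by omega)]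
  have fpl : s₆.nat (fp + 2) = s₀.nat (fp + 2) := by
    rw [g₃ _ (by omega), e₃ _ (by omega), q _ (by omega), hs.nat _ (by omega)]
  have fJ : s₆.nat (I.n + 1) = J := by
    rw [g₃ _ (by omega), e₃ _ (by omega), q _ (by omega), hs.nat _ (by omega), hg.period]
  refine Runs.seq (T₁ := 80) (T₂ := 30) (Q₁ := fun s' => s'.real = s₆.real ∧ s'.nat (fp' + 2) =
    (if s₀.nat (fp + 1) - 1 = s₀.nat (fp + 2) then s₀.nat (fp + 2) - J else s₀.nat (fp + 2)) ∧
    ∀ b, b ≠ fp' + 2 → s'.nat b = s₆.nat b) ?_ ?_ (by omega)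
  · have hA : (loc 18 5).eval I k s₆ = fp' + 2 := by rw [eval_loc, f₆, hfp]; omega
    refine Runs.ite (T' := 40) (fun h => ?_) (fun h => ?_)
      (by simp [eqB, BExp.size, NExp.size, gv, glob, var])
    all_goals
      rw [holds_eqB] at h
      simp only [NExp.eval, eval_var, f₆, fl, fpl] at h
    · rw [if_pos h]
      exact Runs.setNat hA (by simp only [NExp.eval, eval_var, eval_gv, f₆, fpl, fJ])
        (by simp [NExp.size, gv, glob, var, loc, nmul])
    · rw [if_neg h]
      exact Runs.setNat hA (by simp only [NExp.eval, eval_var, f₆, fpl])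
        (by simp [NExp.size, gv, glob, var, loc, nmul])
  rintro s₇ ⟨i₁, i₂, i₃⟩
  refine (Runs.setReal (A := fp') (V := s₀.real fp) ?_ ?_ ?_).mono
    le_rfl ?_
  · rw [eval_loc, i₃ _ (by omega), f₆, hfp]
  · simp only [RExp.eval, eval_gv]
    rw [i₁, g₁, e₁, hr₄, i₃ _ (by omega), f₆, hs.real _ le_rfl (by omega)]
  · simp [NExp.size, RExp.size, gv, glob, loc, nmul]
  rintro s₈ ⟨j₁, j₂, j₃⟩
  have q' : ∀ a, a ≠ fp' → a ≠ fp' + 1 → a ≠ fp' + 2 → s₈.nat a = s₄.nat a := by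
    intro a h₁ h₂ h₃
    rw [j₁, i₃ _ h₃, g₃ _ h₂, e₃ _ h₁]
  refine ⟨⟨?_, ?_, ?_, j₂⟩, ?_, ?_, ?_, ?_, ?_, ?_⟩
  · rw [j₁, i₃ _ (by omega), g₃ _ (by omega), e₂]
  · rw [j₁, i₃ _ (by omega), g₂]
  · rw [j₁, i₂]
  · rw [q' _ (by omega) (by omega) (by omega), d₃ _ (by omega) (by omega),
      c₃ _ (by omega) (by omega), b₃ _ (by omega) (by omega), a₂]
  · intro v hv
    rw [q' _ (by omega) (by omega) (by omega), d₃ _ (by omega) (by omega),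
      c₃ _ (by omega) (by omega), b₂ v hv]
  · refine setAt_congr fun v hv => ?_
    rw [q' _ (by omega) (by omega) (by omega),
      show fp' + (16 + 0 * I.n) + v = fp + (32 + 5 * I.n) + v by omega, d₂ v hv]
  · ext v
    have hv := v.2
    rw [Finset.mem_union, mem_setAt, mem_setAt, mem_pverts, q' _ (by omega) (by omega) (by omega),
      show fp' + (16 + 1 * I.n) + v = fp + (32 + 6 * I.n) + v by omega, d₃ _ (by omega) (by omega),
      c₂ v hv, treeAt]
    omega
  · intro a ha
    rw [q' _ (by omega) (by omega) (by omega), q _ ha]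
  · intro a ha
    rw [j₃ _ ha, i₁, g₁, e₁, hr₄]

end

/-! ### Joining the two trees of a guess. -/

section
variable {I : Instance} {k : ℕ} {P : List Com}

theorem runs_combine {fp fp' T : ℕ} {s : Store} (f : s.nat (I.n + 0) = fp)
    (hlow : 2 * I.n + 64 ≤ fp) (hfp : fp' = fp + (16 + 5 * I.n)) (hT : (I.n + 2) * 200 ≤ T) :
    Runs I k P combine s T (fun s' => s'.real = s.real ∧
      (∀ a, a ≠ fp + 6 → ¬ (fp + (16 + 2 * I.n) ≤ a ∧ a < fp + (16 + 2 * I.n) + I.n) →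
        a ≠ I.n + 8 → s'.nat a = s.nat a) ∧
      ((s.nat (fp' + 6) ≠ 0 ∧
          (s.nat (fp + 6) = 0 ∨ s.nat (fp + 7) + s.nat (fp' + 6) ≤ s.nat (fp + 6)) ∧
          s'.nat (fp + 6) = s.nat (fp + 7) + s.nat (fp' + 6) - 1 ∧
          treeAt I fp s' = pmerge (treeAt I fp' s) (fun v => s.nat (fp + (16 + 3 * I.n) + v))) ∨
        (¬ (s.nat (fp' + 6) ≠ 0 ∧
          (s.nat (fp + 6) = 0 ∨ s.nat (fp + 7) + s.nat (fp' + 6) ≤ s.nat (fp + 6))) ∧ s' = s))) := by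
  have e22 : (NExp.mem (loc 22 5)).eval I k s = s.nat (fp' + 6) := by
    simp only [NExp.eval, eval_loc, f]
    congr 1
    omega
  have htest : (BExp.and (.natLE (.lit 1) (.mem (loc 22 5))) (orB (.natLE (.mem (var 6)) (.lit 0))
      (.natLE (.add (.mem (var 7)) (.mem (loc 22 5))) (.mem (var 6))))).Holds I k s ↔
      (s.nat (fp' + 6) ≠ 0 ∧
          (s.nat (fp + 6) = 0 ∨ s.nat (fp + 7) + s.nat (fp' + 6) ≤ s.nat (fp + 6))) := by
    simp only [BExp.Holds, holds_orB, eval_add, e22]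
    simp only [NExp.eval, eval_var, f]
    omega
  refine Runs.ite (T' := (I.n + 1) * 150 + 50) (fun h => ?_) (fun h => ?_) ?_
  rotate_left
  · exact Runs.skip (by omega) ⟨rfl, fun _ _ _ _ => rfl, Or.inr ⟨fun h' => h (htest.2 h'), rfl⟩⟩
  · simp only [orB, BExp.size, NExp.size, gv, glob, var, loc, nmul]
    omega
  rw [htest] at h
  refine Runs.seq (T₁ := 50) (T₂ := (I.n + 1) * 150) (Runs.setNat (A := fp + 6)
    (V := s.nat (fp + 7) + s.nat (fp' + 6) - 1) ?_ ?_ ?_) ?_ (by omega)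
  · rw [eval_var, f]
  · have e7 : (NExp.mem (var 7)).eval I k s = s.nat (fp + 7) := by
      simp only [NExp.eval, eval_var, f]
    change (NExp.mem (var 7)).eval I k s + (NExp.mem (loc 22 5)).eval I k s - 1 = _
    rw [e22, e7]
  · simp [NExp.size, gv, glob, var, loc, nmul]
  rintro s₁ ⟨a₁, a₂, a₃⟩
  refine (runs_fill (A := fp + (16 + 2 * I.n)) (fun v => if s.nat (fp' + (16 + 2 * I.n) + v) ≠ 0 then
    s.nat (fp' + (16 + 2 * I.n) + v) else s.nat (fp + (16 + 3 * I.n) + v)) (by omega) ?_ ?_).mono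
    le_rfl ?_
  · intro s' v hv h₁ h₂ h₃
    have f' : s'.nat (I.n + 0) = fp := by rw [h₂ _ (by omega) (by omega), a₃ _ (by omega), f]
    have g₁ : (elt (loc 32 7) (gv 8)).eval I k s' = s.nat (fp' + (16 + 2 * I.n) + v) := by
      rw [eval_elt, eval_loc, eval_gv, f', h₃, h₂ _ (by omega) (by omega), a₃ _ (by omega)]
      congr 1
      omega
    have g₂ : (elt (loc 16 3) (gv 8)).eval I k s' = s.nat (fp + (16 + 3 * I.n) + v) := by
      rw [eval_elt, eval_loc, eval_gv, f', h₃, h₂ _ (by omega) (by omega), a₃ _ (by omega)]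
    have g₃ : (BExp.natLE (.lit 1) (elt (loc 32 7) (gv 8))).Holds I k s' ↔
        s.nat (fp' + (16 + 2 * I.n) + v) ≠ 0 := by
      rw [BExp.Holds, g₁, NExp.eval]
      omega
    rw [g₁, g₂, g₃, eval_loc, f']
    exact ⟨rfl, fun h => by rw [if_pos h], fun h => by rw [if_neg h]⟩
  · refine Nat.mul_le_mul_left _ ?_
    simp [BExp.size, NExp.size, gv, glob, elt, loc, nmul]
  rintro s₂ ⟨b₁, b₂, b₃⟩
  refine ⟨by rw [b₁, a₁], fun a h₁ h₂ h₃ => by rw [b₃ _ h₂ h₃, a₃ _ h₁], Or.inl ⟨h.1, h.2, ?_, ?_⟩⟩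
  · rw [b₃ _ (by omega) (by omega), a₂]
  · funext v
    exact b₂ v v.2

-- The program counterpart of `Attainable.step`: if both calls of the guess are attainable, with
-- costs `cP` and `cR`, a tree of cost at most `cP + cR` is stored afterwards. Correctness of the
-- stored tree does not depend on the guess being good.
set_option maxRecDepth 4000 in
theorem runs_guessBody {J s' N W e fp l m T Ta Tb : ℕ} {M : ℝ} {s₀ s : Store} {r u : Fin I.n}
    (hg : Globals I fp J N W e M s₀) (hs : Same I fp s₀ s) (hJ : 0 < J)
    (hr : s₀.nat fp = r) (hl : s₀.nat (fp + 1) = l + 1) (hpl : s₀.nat (fp + 2) = rkPl J (l + 1))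
    (hm : s.nat (fp + 3) = m) (hu : s.nat (fp + 4) = u)
    (ha : Spec I k P J s' N W e M (rkPl J (l + 1)) Ta (.call 0))
    (hb : Spec I k P J s' N W e M l Tb (.call 0)) (hT : (I.n + 2) * 1500 + Ta + Tb ≤ T) :
    Runs I k P guessBody s T (fun t => Same I fp s₀ t ∧
      (∀ a, fp + 3 ≤ a → a < fp + 6 → t.nat a = s.nat a) ∧ t.real (fp + 1) = s.real (fp + 1) ∧
      (∀ d, Got fp s d → Got fp t d) ∧
      (Sol I (scaled I e) r (setAt I.n s₀.nat (fp + (16 + 0 * I.n)))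
        (setAt I.n s₀.nat (fp + (16 + 1 * I.n))) (s₀.real fp) fp s →
      Sol I (scaled I e) r (setAt I.n s₀.nat (fp + (16 + 0 * I.n)))
        (setAt I.n s₀.nat (fp + (16 + 1 * I.n))) (s₀.real fp) fp t) ∧
      ∀ cP cR, Attainable I (scaled I e) M N J s' (rkPl J (l + 1)) u
          (maskSet I s₀ (fp + (16 + 0 * I.n)) m) (setAt I.n s₀.nat (fp + (16 + 1 * I.n)))
          (s.real (fp + 1)) cP →
        (∀ X', setAt I.n s₀.nat (fp + (16 + 1 * I.n)) ⊆ X' → s.real (fp + 1) ≤ scaled I e X' →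
          Attainable I (scaled I e) M N J s' l r (insert u (setAt I.n s₀.nat (fp + (16 + 0 * I.n)) \
            maskSet I s₀ (fp + (16 + 0 * I.n)) m)) X' (s₀.real fp) cR) →
        Got fp t (cP + cR)) := by
  have hlow := hg.low
  obtain ⟨fp', hfp⟩ : ∃ fp', fp' = fp + (16 + 5 * I.n) := ⟨_, rfl⟩
  set Y := setAt I.n s₀.nat (fp + (16 + 0 * I.n)) with hY
  set X := setAt I.n s₀.nat (fp + (16 + 1 * I.n)) with hX
  set YP := maskSet I s₀ (fp + (16 + 0 * I.n)) m with hYP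
  refine Runs.seq (T₁ := (I.n + 2) * 400) (T₂ := (I.n + 2) * 1100 + Ta + Tb)
    (runs_prepareFirst hg hs hfp hm hu le_rfl) ?_
    (by omega)
  rintro s₁ ⟨⟨a₁, a₂, a₃, a₄⟩, a₅, a₆, a₇, a₈, a₉⟩
  have hs₁ : Same I fp s₀ s₁ := hs.trans ⟨fun a h => a₈ a (by omega), fun a h h' => a₉ a (by omega)⟩
  refine Runs.seq (T₁ := Ta + 70) (T₂ := (I.n + 2) * 1100 + Tb - 70)
    (runs_callNext ha (hs₁.globals hg) hfp a₁ (by rw [a₂, hpl])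
      (by rw [a₃, hpl, rkPl_rkPl_succ hJ]) le_rfl) ?_ (by omega)
  rintro s₂ ⟨b₁, b₂, b₃, b₄⟩
  rw [a₅, a₆, a₄] at b₃
  rw [a₅, a₆, a₄] at b₄
  have hs₂ : Same I fp s₀ s₂ :=
    hs₁.trans ⟨fun a h => b₁ a (by omega), fun a h h' => b₂ a (by omega) h'⟩
  have q₂ : ∀ a, fp + 3 ≤ a → a < fp + (16 + 4 * I.n) → s₂.nat a = s.nat a := by
    intro a h₁ h₂
    rw [b₁ _ (by omega), a₈ _ (by omega)]
  have f₂ : s₂.nat (I.n + 0) = fp := by rw [hs₂.nat _ (by omega), hg.frame]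
  have hr₂ : s₂.real (fp + 1) = s.real (fp + 1) := by
    rw [b₂ _ (by omega) (by omega), a₉ _ (by omega)]
  have htest : (BExp.natLE (.lit 1) (.mem (loc 22 5))).Holds I k s₂ ↔ s₂.nat (fp' + 6) ≠ 0 := by
    simp only [BExp.Holds, NExp.eval, eval_loc, f₂]
    rw [show fp + (22 + 5 * I.n) = fp' + 6 by omega]
    omega
  refine Runs.ite (T' := (I.n + 2) * 1100 + Tb - 100) (fun h => ?_) (fun h => ?_) ?_
  rotate_left
  · rw [htest, not_not] at h
    refine Runs.skip (by omega) ⟨hs₂, fun a h₁ h₂ => q₂ a h₁ (by omega), hr₂, ?_, ?_, ?_⟩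
    · intro d hd
      rwa [Got, q₂ _ (by omega) (by omega)]
    · exact fun hsol => hsol.congr (q₂ _ (by omega) (by omega))
        fun v hv => q₂ _ (by omega) (by omega)
    · intro cP cR h₁ _
      exact absurd h (b₄ cP h₁).1
  · simp only [BExp.size, NExp.size, gv, glob, loc, nmul]
    omega
  rw [htest] at h
  obtain ⟨c₁, c₂, c₃, c₄⟩ := b₃ h
  refine Runs.seq (T₁ := (I.n + 2) * 500) (T₂ := (I.n + 2) * 600 + Tb - 100)
    (runs_prepareSecond hg hs₂ hfp le_rfl) ?_ (by omega)
  rintro s₃ ⟨⟨d₁, d₂, d₃, d₄⟩, d₅, d₆, d₇, d₈, d₉, d₁₀⟩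
  have hs₃ : Same I fp s₀ s₃ :=
    hs₂.trans ⟨fun a h => d₉ a (by omega), fun a h h' => d₁₀ a (by omega)⟩
  rw [hl, hpl, Nat.add_sub_cancel, ← rkPl_eq hJ] at d₃
  refine Runs.seq (T₁ := Tb + 70) (T₂ := (I.n + 2) * 600 - 170)
    (runs_callNext hb (hs₃.globals hg) hfp (by rw [d₁, hr]) (by rw [d₂, hl, Nat.add_sub_cancel])
      d₃ le_rfl) ?_ (by omega)
  rintro s₄ ⟨e₁, e₂, e₃, e₄⟩
  have hYR : setAt I.n s₂.nat (fp + (16 + 4 * I.n)) = insert u (Y \ YP) := by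
    rw [← a₇]
    exact setAt_congr fun v hv => b₁ _ (by omega)
  rw [d₇, d₈, d₄, hYR] at e₃
  rw [d₇, d₈, d₄, hYR] at e₄
  have hs₄ : Same I fp s₀ s₄ :=
    hs₃.trans ⟨fun a h => e₁ a (by omega), fun a h h' => e₂ a (by omega) h'⟩
  have q₄ : ∀ a, fp + 3 ≤ a → a < fp + 7 ∨ (fp + 16 ≤ a ∧ a < fp + (16 + 3 * I.n)) →
      s₄.nat a = s.nat a := by
    intro a h₁ h₂
    rw [e₁ _ (by omega), d₉ _ (by omega), q₂ _ h₁ (by omega)]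
  have h7 : s₄.nat (fp + 7) = s₂.nat (fp' + 6) := by rw [e₁ _ (by omega), d₅]
  have htP : (fun v : Fin I.n => s₄.nat (fp + (16 + 3 * I.n) + v)) = treeAt I fp' s₂ := by
    funext v
    have hv := v.2
    rw [e₁ _ (by omega), d₆ v hv]
    rfl
  refine (runs_combine (by rw [hs₄.nat _ (by omega), hg.frame]) hlow hfp le_rfl).mono (by omega) ?_
  rintro s₅ ⟨g₁, g₂, g₃⟩
  rw [h7, htP, q₄ (fp + 6) (by omega) (by omega)] at g₃
  have hgot : ∀ cP cR, Attainable I (scaled I e) M N J s' (rkPl J (l + 1)) u YP X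
      (s.real (fp + 1)) cP → (∀ X', X ⊆ X' → s.real (fp + 1) ≤ scaled I e X' →
          Attainable I (scaled I e) M N J s' l r (insert u (Y \ YP)) X' (s₀.real fp) cR) →
      Got fp' s₂ cP ∧ Got fp' s₄ cR :=
    fun cP cR h₁ h₂ => ⟨b₄ cP h₁, e₄ cR (h₂ _ Finset.subset_union_left c₃)⟩
  refine ⟨hs₄.trans ⟨fun a h => g₂ a (by omega) (by omega) (by omega), fun a _ _ => by rw [g₁]⟩,
    fun a h₁ h₂ => by rw [g₂ a (by omega) (by omega) (by omega), q₄ a (by omega) (by omega)],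
    by rw [g₁, e₂ _ (by omega) (by omega), d₁₀ _ (by omega), hr₂], ?_⟩
  rcases g₃ with ⟨i₁, i₂, i₃, i₄⟩ | ⟨i₁, i₂⟩
  · obtain ⟨j₁, j₂, j₃, j₄⟩ := e₃ i₁
    refine ⟨?_, ?_, ?_⟩
    · rintro d ⟨hd₁, hd₂⟩
      rw [Got, i₃]
      omega
    · rintro - -
      rw [i₃, i₄, pverts_pmerge]
      -- The second tree contains `u`, the root of the first one, because `u` was among its required
      -- vertices.
      refine ⟨j₁.merge c₁ (mem_pverts.1 (j₂ (Finset.mem_insert_self _ _))), ?_, ?_, ?_⟩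
      · intro y hy
        rw [Finset.mem_union]
        by_cases hyP : y ∈ YP
        · exact Or.inr (c₂ hyP)
        · exact Or.inl (j₂ (Finset.mem_insert_of_mem (Finset.mem_sdiff.2 ⟨hy, hyP⟩)))
      · rwa [Finset.union_comm (pverts (treeAt I fp' s₄)), ← Finset.union_assoc]
      · have := cost_pmerge_le (treeAt I fp' s₄) (treeAt I fp' s₂)
        omega
    · intro cP cR h₁ h₂
      obtain ⟨⟨k₁, k₂⟩, k₃, k₄⟩ := hgot cP cR h₁ h₂
      rw [Got, i₃]
      omega
  · subst i₂
    have h6 := q₄ (fp + 6) (by omega) (by omega)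
    refine ⟨?_, ?_, ?_⟩
    · intro d hd
      rwa [Got, h6]
    · exact fun hsol => hsol.congr h6 fun v hv => q₄ _ (by omega) (by omega)
    · intro cP cR h₁ h₂
      obtain ⟨⟨k₁, k₂⟩, k₃, k₄⟩ := hgot cP cR h₁ h₂
      rw [Got, h6]
      omega

end

/-- The procedure for positive ranks. -/
def stepCom : Com :=
  .seq (.setNat (var 6) (.lit 0))
    (forN (var 3) (gv 3) (forN (var 4) .numVerts
      (.seq (assign (glob 64) (elt (loc 16 1) (gv 8)))
      (.seq evalF
      (.seq (.setReal (var 1) (.mem (.lit 1)))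
        (forN (var 5) (gv 2)
          (.seq guessBody (.setReal (var 1) (.add (.mem (var 1)) (.mem (.lit 0)))))))))))

/-- The recursive procedure. -/
def proc : Com := .ite (.natLE (.mem (var 1)) (.lit 0)) baseCom stepCom

section
variable {I : Instance} {k : ℕ} {P : List Com}

theorem spec_baseCom {J s N W e T : ℕ} {M : ℝ} (hJ : 0 < J)
    (hT : (I.n + 1) * ((I.n + 2) * 400 + (e + 2) * 50 + 30) + 20 ≤ T) :
    Spec I k P J s N W e M 0 T baseCom := by
  intro s₀ fp r hg hr hl _
  have hlow := hg.low
  have f : s₀.nat (I.n + 0) = fp := hg.frame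
  refine Runs.seq (T₁ := 20) (T₂ := (I.n + 1) * ((I.n + 2) * 400 + (e + 2) * 50 + 30))
    (Runs.setNat (A := fp + 6) (V := 0) (by rw [eval_var, f]) rfl
      (by simp [NExp.size, gv, glob, var])) ?_ (by omega)
  rintro s₁ ⟨a₁, a₂, a₃⟩
  have hs₁ : Same I fp s₀ s₁ := ⟨fun a h => a₃ a (by omega), fun a _ _ => by rw [a₁]⟩
  set Y := setAt I.n s₀.nat (fp + (16 + 0 * I.n)) with hY
  set X := setAt I.n s₀.nat (fp + (16 + 1 * I.n)) with hX
  refine Runs.forN (fun x t => Same I fp s₀ t ∧ t.nat (I.n + 10) = x ∧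
      Sol I (scaled I e) r Y X (s₀.real fp) fp t ∧
      ∀ c : Fin I.n, (c : ℕ) < x → (c = r ∨ (r, c) ∈ I.edges) → Y ⊆ {r, c} →
        s₀.real fp ≤ scaled I e (X ∪ {r, c}) → Got fp t (if c = r then 0 else I.cost (r, c)))
    (N := I.n) (ia := I.n + 10) (Tb := (I.n + 2) * 400 + (e + 2) * 50) rfl ?_ ?_ ?_ ?_ ?_
  · intro s' h₁ h₂ h₃
    have h6 : s'.nat (fp + 6) = 0 := by rw [h₃ _ (by omega), a₂]
    refine ⟨hs₁.trans ⟨fun a h => h₃ a (by omega), fun a _ _ => by rw [h₁]⟩, h₂, ?_, ?_⟩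
    · exact fun h => absurd h6 h
    · intro c hc
      omega
  · rintro x s' ⟨-, h, -⟩
    exact ⟨rfl, h, rfl⟩
  · rintro x t hx ⟨h₁, h₂, h₃, h₄⟩
    refine (runs_baseBody (c := ⟨x, hx⟩) hg h₁ hr h₂ le_rfl).mono le_rfl ?_
    rintro t' ⟨g₁, g₂, g₃, g₄, g₅⟩
    refine ⟨rfl, g₂, fun t₂ m₁ m₂ m₃ => ⟨g₁.trans ⟨fun a h => m₃ a (by omega),
      fun a _ _ => by rw [m₁]⟩, m₂, ?_, ?_⟩⟩
    · exact (g₄ h₃).congr (m₃ _ (by omega)) fun v hv => m₃ _ (by omega)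
    · intro c hc e₁ e₂ e₃
      rw [Got, m₃ _ (by omega)]
      by_cases hcx : (c : ℕ) = x
      · obtain rfl : c = ⟨x, hx⟩ := Fin.ext hcx
        exact g₅ e₁ e₂ e₃
      · exact g₃ _ (h₄ c (by omega) e₁ e₂ e₃)
  · rintro t ⟨h₁, -, h₃, h₄⟩
    refine ⟨h₁, h₃, fun c hc => ?_⟩
    obtain ⟨x, g₁, g₂, g₃, g₄⟩ := hc.base (fun S T hST =>
      mul_le_mul_of_nonneg_left (I.f_mono hST) (by positivity)) hJ
    obtain ⟨q₁, q₂⟩ := h₄ x x.2 g₁ g₃ g₄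
    exact ⟨q₁, by omega⟩
  · refine Nat.mul_le_mul_left _ ?_
    simp [NExp.size, glob]

/-- The invariant of the loops: the guesses in `D` have been treated. -/
structure StepInv (I : Instance) (J s' N e fp l : ℕ) (M : ℝ) (s₀ : Store) (r : Fin I.n)
    (D : ℕ → Fin I.n → ℕ → Prop) (t : Store) : Prop where
  same : Same I fp s₀ t
  sol : Sol I (scaled I e) r (setAt I.n s₀.nat (fp + (16 + 0 * I.n)))
    (setAt I.n s₀.nat (fp + (16 + 1 * I.n))) (s₀.real fp) fp t
  covered : ∀ m u v, D m u v → ∀ cP cR,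
    Attainable I (scaled I e) M N J s' (rkPl J (l + 1)) u
      (maskSet I s₀ (fp + (16 + 0 * I.n)) m) (setAt I.n s₀.nat (fp + (16 + 1 * I.n)))
      (scaled I e (setAt I.n s₀.nat (fp + (16 + 1 * I.n))) + v * M) cP →
    (∀ X', setAt I.n s₀.nat (fp + (16 + 1 * I.n)) ⊆ X' →
      scaled I e (setAt I.n s₀.nat (fp + (16 + 1 * I.n))) + v * M ≤ scaled I e X' →
      Attainable I (scaled I e) M N J s' l r (insert u (setAt I.n s₀.nat (fp + (16 + 0 * I.n)) \
        maskSet I s₀ (fp + (16 + 0 * I.n)) m)) X' (s₀.real fp) cR) → Got fp t (cP + cR)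

theorem StepInv.congr {J s' N e fp l : ℕ} {M : ℝ} {s₀ : Store} {r : Fin I.n}
    {D D' : ℕ → Fin I.n → ℕ → Prop} {t t' : Store} (h : StepInv I J s' N e fp l M s₀ r D t)
    (hD : ∀ m u v, D' m u v → D m u v)
    (hn : ∀ a, a < I.n + 8 ∨ 2 * I.n + 64 ≤ a → a ≠ fp + 3 → a ≠ fp + 4 → a ≠ fp + 5 →
      t'.nat a = t.nat a) (hr : ∀ a, a ≤ fp → a ≠ 1 → t'.real a = t.real a)
    (hlow : 2 * I.n + 64 ≤ fp) : StepInv I J s' N e fp l M s₀ r D' t' := by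
  have h6 : t'.nat (fp + 6) = t.nat (fp + 6) := hn _ (by omega) (by omega) (by omega) (by omega)
  refine ⟨h.same.trans ⟨fun a ha => hn a (by omega) (by omega) (by omega) (by omega), hr⟩,
    h.sol.congr h6 fun v hv => hn _ (by omega) (by omega) (by omega) (by omega), ?_⟩
  intro m u v hDm cP cR h₁ h₂
  rw [Got, h6]
  exact h.covered m u v (hD m u v hDm) cP cR h₁ h₂

/-- The guesses that precede the guess of `m`, `u` and `v` in the lexicographic order. -/
def Before (I : Instance) (N m u v : ℕ) : ℕ → Fin I.n → ℕ → Prop :=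
  fun m' u' v' => v' < N ∧ (m' < m ∨ (m' = m ∧ ((u' : ℕ) < u ∨ ((u' : ℕ) = u ∧ v' < v))))

/-- Exhaustive search over mask, cut vertex and target. The target cell advances by `M` in the inner
loop, so it equals `F X + v * M` without any multiplication. -/
theorem spec_stepCom {J s N W e l Ta Tb T : ℕ} {M : ℝ} (hs : 0 < s) (hJ : 8 * s = J) (hM : 0 < M)
    (hW : 2 ^ (J + 7) ≤ W) (ha : Spec I k P J s N W e M (rkPl J (l + 1)) Ta (.call 0))
    (hb : Spec I k P J s N W e M l Tb (.call 0))
    (hT : (W + 1) * ((I.n + 1) * ((I.n + 1) * 90 + (e + 2) * 50 + 20 +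
      (N + 1) * ((I.n + 2) * 1500 + Ta + Tb + 90) + 40) + 40) + 20 ≤ T) :
    Spec I k P J s N W e M (l + 1) T stepCom := by
  have hJ0 : 0 < J := by omega
  intro s₀ fp r hg hr hl hpl
  have hlow := hg.low
  have f : s₀.nat (I.n + 0) = fp := hg.frame
  refine Runs.seq (T₁ := 20) (T₂ := (W + 1) * ((I.n + 1) * ((I.n + 1) * 90 + (e + 2) * 50 + 20 +
      (N + 1) * ((I.n + 2) * 1500 + Ta + Tb + 90) + 40) + 40))
    (Runs.setNat (A := fp + 6) (V := 0) (by rw [eval_var, f]) rfl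
      (by simp [NExp.size, gv, glob, var])) ?_ (by omega)
  rintro s₁ ⟨a₁, a₂, a₃⟩
  have hs₁ : Same I fp s₀ s₁ := ⟨fun a h => a₃ a (by omega), fun a _ _ => by rw [a₁]⟩
  have hstart : StepInv I J s N e fp l M s₀ r (Before I N 0 0 0) s₁ := by
    refine ⟨hs₁, fun h => absurd a₂ h, ?_⟩
    rintro m u v ⟨-, h⟩
    omega
  have hfp : ∀ {D t}, StepInv I J s N e fp l M s₀ r D t → t.nat (I.n + 0) = fp :=
    fun h => by rw [h.same.nat _ (by omega), f]
  refine Runs.forN (fun m t => StepInv I J s N e fp l M s₀ r (Before I N m 0 0) t ∧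
    t.nat (fp + 3) = m) (N := W) (ia := fp + 3) (Tb := (I.n + 1) * ((I.n + 1) * 90 + (e + 2) * 50 + 20 +
      (N + 1) * ((I.n + 2) * 1500 + Ta + Tb + 90) + 40))
    (by rw [eval_var, hfp hstart]) ?_ ?_ ?_ ?_ ?_
  · intro t h₁ h₂ h₃
    exact ⟨hstart.congr (fun _ _ _ h => h) (fun a _ h _ _ => h₃ a h) (fun a _ _ => by rw [h₁]) hlow,
      h₂⟩
  · rintro m t ⟨h₁, h₂⟩
    exact ⟨by rw [eval_var, hfp h₁], h₂, by rw [eval_gv, h₁.same.nat _ (by omega), hg.masks]⟩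
  · rintro m t₀ hmW ⟨ht₀, hm₀⟩
    refine Runs.forN (fun u t => StepInv I J s N e fp l M s₀ r (Before I N m u 0) t ∧
      t.nat (fp + 3) = m ∧ t.nat (fp + 4) = u) (N := I.n) (ia := fp + 4)
      (Tb := (I.n + 1) * 90 + (e + 2) * 50 + 20 + (N + 1) * ((I.n + 2) * 1500 + Ta + Tb + 90))
      (by rw [eval_var, hfp ht₀]) ?_ ?_ ?_ ?_ ?_
    · intro t h₁ h₂ h₃
      exact ⟨ht₀.congr (fun _ _ _ h => h) (fun a _ _ h _ => h₃ a h) (fun a _ _ => by rw [h₁]) hlow,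
        by rw [h₃ _ (by omega), hm₀], h₂⟩
    · rintro u t ⟨h₁, h₂, h₃⟩
      exact ⟨by rw [eval_var, hfp h₁], h₃, rfl⟩
    · rintro u t₁ huN ⟨ht₁, hm₁, hu₁⟩
      refine Runs.seq (T₁ := (I.n + 1) * 90)
        (T₂ := (e + 2) * 50 + 20 + (N + 1) * ((I.n + 2) * 1500 + Ta + Tb + 90))
        (runs_assign (A := I.n + 64) (fun v => s₀.nat (fp + (16 + 1 * I.n) + v)) (by omega) ?_ ?_)
        ?_ (by omega)
      · intro s' v hv h₁ h₂ h₃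
        have f' : s'.nat (I.n + 0) = fp := by rw [h₂ _ (by omega) (by omega), hfp ht₁]
        rw [eval_elt, eval_loc, eval_gv, f', h₃, h₂ _ (by omega) (by omega),
          ht₁.same.nat _ (by omega)]
        exact ⟨rfl, rfl⟩
      · refine Nat.mul_le_mul_left _ ?_
        simp [NExp.size, gv, glob, elt, loc, nmul]
      rintro t₂ ⟨b₁, b₂, b₃⟩
      refine Runs.seq (T₁ := (e + 2) * 50)
        (T₂ := 20 + (N + 1) * ((I.n + 2) * 1500 + Ta + Tb + 90)) (runs_evalF (e := e) ?_ le_rfl) ?_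
        (by omega)
      · rw [b₃ _ (by omega) (by omega), ht₁.same.nat _ (by omega), hg.scale]
      rintro t₃ ⟨c₁, c₂, c₃⟩
      have hXZ : setAt I.n t₂.nat (I.n + 64) = setAt I.n s₀.nat (fp + (16 + 1 * I.n)) :=
        setAt_congr fun v hv => b₂ v hv
      rw [hXZ] at c₂
      have q₃ : ∀ a, a < I.n + 8 ∨ 2 * I.n + 64 ≤ a → t₃.nat a = t₁.nat a := by
        intro a ha
        rw [c₁ _ (by omega), b₃ _ (by omega) (by omega)]
      have f₃ : t₃.nat (I.n + 0) = fp := by rw [q₃ _ (by omega), hfp ht₁]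
      refine Runs.seq (T₁ := 20) (T₂ := (N + 1) * ((I.n + 2) * 1500 + Ta + Tb + 90))
        (Runs.setReal (A := fp + 1) (by rw [eval_var, f₃]) rfl
          (by simp [RExp.size, NExp.size, gv, glob, var])) ?_ (by omega)
      rintro t₄ ⟨d₁, d₂, d₃⟩
      have d₂' : t₄.real (fp + 1) = scaled I e (setAt I.n s₀.nat (fp + (16 + 1 * I.n))) :=
        d₂.trans c₂
      have ht₄ : StepInv I J s N e fp l M s₀ r (Before I N m u 0) t₄ :=
        ht₁.congr (fun _ _ _ h => h) (fun a h _ _ _ => by rw [d₁, q₃ a h])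
          (fun a h h1 => by rw [d₃ _ (by omega), c₃ _ h1, b₁]) hlow
      refine Runs.forN (fun v t => StepInv I J s N e fp l M s₀ r (Before I N m u v) t ∧
        t.nat (fp + 3) = m ∧ t.nat (fp + 4) = u ∧ t.nat (fp + 5) = v ∧
        t.real (fp + 1) = scaled I e (setAt I.n s₀.nat (fp + (16 + 1 * I.n))) + v * M) (N := N)
        (ia := fp + 5) (Tb := (I.n + 2) * 1500 + Ta + Tb + 30)
        (by rw [eval_var, hfp ht₄]) ?_ ?_ ?_ ?_ ?_
      · intro t h₁ h₂ h₃
        refine ⟨ht₄.congr (fun _ _ _ h => h) (fun a _ _ _ h => h₃ a h) (fun a _ _ => by rw [h₁]) hlow,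
          ?_, ?_, h₂, ?_⟩
        · rw [h₃ _ (by omega), d₁, q₃ _ (by omega), hm₁]
        · rw [h₃ _ (by omega), d₁, q₃ _ (by omega), hu₁]
        · rw [h₁, d₂']; simp
      · rintro v t ⟨h₁, h₂, h₃, h₄, h₅⟩
        exact ⟨by rw [eval_var, hfp h₁], h₄,
          by rw [eval_gv, h₁.same.nat _ (by omega), hg.targets]⟩
      · rintro v t₅ hvN ⟨ht₅, hm₅, hu₅, hv₅, hτ₅⟩
        refine Runs.seq (T₁ := (I.n + 2) * 1500 + Ta + Tb) (T₂ := 30)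
          (runs_guessBody (u := ⟨u, huN⟩) hg ht₅.same hJ0 hr hl hpl hm₅ hu₅ ha hb le_rfl) ?_ le_rfl
        rintro t₆ ⟨i₁, i₂, i₃, i₄, i₅, i₆⟩
        have f₆ : t₆.nat (I.n + 0) = fp := by rw [i₁.nat _ (by omega), f]
        refine (Runs.setReal (A := fp + 1) (by rw [eval_var, f₆]) rfl
          (by simp [RExp.size, NExp.size, gv, glob, var])).mono le_rfl ?_
        rintro t₇ ⟨j₁, j₂, j₃⟩
        have ht₆ : StepInv I J s N e fp l M s₀ r (Before I N m u (v + 1)) t₆ := by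
          refine ⟨i₁, i₅ ht₅.sol, ?_⟩
          rintro m' u' v' ⟨hv', hlex⟩ cP cR h₁ h₂
          by_cases hnew : m' = m ∧ (u' : ℕ) = u ∧ v' = v
          · obtain ⟨rfl, h3, rfl⟩ := hnew
            obtain rfl : u' = ⟨u, huN⟩ := Fin.ext h3
            rw [hτ₅] at i₆
            exact i₆ cP cR h₁ h₂
          · exact i₄ _ (ht₅.covered m' u' v' ⟨hv', by omega⟩ cP cR h₁ h₂)
        refine ⟨by rw [eval_var, j₁, f₆], by rw [j₁, i₂ _ (by omega) (by omega), hv₅],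
          fun t₈ m₁ m₂ m₃ => ⟨?_, ?_, ?_, m₂, ?_⟩⟩
        · exact ht₆.congr (fun _ _ _ h => h) (fun a _ _ _ h => by rw [m₃ a h, j₁])
            (fun a h _ => by rw [m₁, j₃ _ (by omega)]) hlow
        · rw [m₃ _ (by omega), j₁, i₂ _ (by omega) (by omega), hm₅]
        · rw [m₃ _ (by omega), j₁, i₂ _ (by omega) (by omega), hu₅]
        · rw [m₁, j₂]
          simp only [RExp.eval, NExp.eval, eval_var, f₆]
          rw [i₃, hτ₅, i₁.real 0 (Nat.zero_le _) (by omega), hg.unit]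
          push_cast
          ring
      · rintro t ⟨h₁, h₂, h₃, h₄, h₅⟩
        refine ⟨by rw [eval_var, hfp h₁], h₃, fun t' m₁ m₂ m₃ => ⟨?_, ?_, m₂⟩⟩
        · refine h₁.congr ?_ (fun a _ _ h _ => m₃ a h) (fun a _ _ => by rw [m₁]) hlow
          rintro m' u' v' ⟨hv', hlex⟩
          exact ⟨hv', by omega⟩
        · rw [m₃ _ (by omega), h₂]
      · refine Nat.mul_le_mul_left _ ?_
        simp only [NExp.size, gv, glob, var]
        omega
    · rintro t ⟨h₁, h₂, h₃⟩
      refine ⟨by rw [eval_var, hfp h₁], h₂, fun t' m₁ m₂ m₃ => ⟨?_, m₂⟩⟩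
      refine h₁.congr ?_ (fun a _ h _ _ => m₃ a h) (fun a _ _ => by rw [m₁]) hlow
      rintro m' u' v' ⟨hv', hlex⟩
      -- Every vertex is below `n`, so being past all vertices for `m` is the same as being at the
      -- start of `m + 1`.
      have := u'.2
      exact ⟨hv', by omega⟩
    · refine Nat.mul_le_mul_left _ ?_
      simp only [NExp.size, gv, glob, var]
      omega
  · rintro t ⟨h₁, h₂⟩
    refine ⟨h₁.same, h₁.sol, fun c hc => ?_⟩
    obtain ⟨hcard, u, YP, v, cP, cR, g₁, g₂, g₃, g₄, g₅⟩ := hc.step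
      (fun S T hST => mul_le_mul_of_nonneg_left (I.f_mono hST) (by positivity))
      (fun S T => by
        have := mul_le_mul_of_nonneg_left (I.f_submodular S T) (show (0 : ℝ) ≤ 2 ^ e by positivity)
        linarith) hM hs hJ
    -- The good guess of the analysis is one of those tried: `Y` has at most `J + 7` members, so its
    -- subset `YP` has a mask below `2 ^ (J + 7)`.
    obtain ⟨m, hm, hmask⟩ := exists_mask_finset s₀.nat _ _ YP hcard
    have hYP : maskSet I s₀ (fp + (16 + 0 * I.n)) m = YP := by
      ext y
      rw [maskSet, Finset.mem_filter]
      constructor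
      · rintro ⟨h1, h2⟩
        exact (hmask y (mem_setAt.1 h1)).1 h2
      · intro h1
        have h2 := g₁ h1
        exact ⟨h2, (hmask y (mem_setAt.1 h2)).2 h1⟩
    have hgot := h₁.covered m u v ⟨g₂, Or.inl (by omega)⟩ cP cR (by rwa [hYP]) (by rwa [hYP])
    exact ⟨hgot.1, by have := hgot.2; omega⟩
  · refine Nat.mul_le_mul_left _ ?_
    simp only [NExp.size, gv, glob, var]
    omega

/-- The time bound for rank `l` is `timeBase ^ (l + 1)`. -/
def timeBase (n N W e : ℕ) : ℕ := 10000 * ((W + 1) * (n + 2) ^ 2 * (N + 1) * (e + 2))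

/-! ### Solving the recurrence for the running time. -/

set_option maxRecDepth 20000 in
theorem base_le_timeBase (n N W e : ℕ) :
    (n + 1) * ((n + 2) * 400 + (e + 2) * 50 + 30) + 20 + 40 ≤ timeBase n N W e := by
  have h2 : 10000 * (1 * (n + 2) ^ 2 * 1 * (e + 2)) ≤
      10000 * ((W + 1) * (n + 2) ^ 2 * (N + 1) * (e + 2)) := by
    gcongr <;> omega
  refine le_trans ?_ h2
  nlinarith [Nat.zero_le (n * e), Nat.zero_le (n * n * e)]

-- Here `q` bounds the time of either recursive call, since the rank of the first call is no larger
-- than that of the second. The spare `40` pays for the procedure call and the test of the rank.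
set_option maxRecDepth 20000 in
theorem step_le_timeBase (n N W e q : ℕ) (hq : 1 ≤ q) :
    (W + 1) * ((n + 1) * ((n + 1) * 90 + (e + 2) * 50 + 20 +
      (N + 1) * ((n + 2) * 1500 + q + q + 90) + 40) + 40) + 20 + 40 ≤ q * timeBase n N W e := by
  have e1 : (n + 1) * 90 + (e + 2) * 50 + 20 + 40 ≤ 150 * ((n + 2) * (e + 2) * (N + 1) * q) := by
    have : 150 * ((n + 2) * (e + 2) * 1 * 1) ≤ 150 * ((n + 2) * (e + 2) * (N + 1) * q) := by
      gcongr; omega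
    refine le_trans ?_ this
    nlinarith [Nat.zero_le (n * e)]
  have e2 : (n + 2) * 1500 + q + q + 90 ≤ 1600 * ((n + 2) * (e + 2) * q) := by
    have : 1600 * ((n + 2) * 1 * q) ≤ 1600 * ((n + 2) * (e + 2) * q) := by
      gcongr; omega
    refine le_trans ?_ this
    nlinarith [Nat.zero_le (n * q), Nat.mul_le_mul_left n hq]
  have e3 : (n + 1) * 90 + (e + 2) * 50 + 20 + (N + 1) * ((n + 2) * 1500 + q + q + 90) + 40
      ≤ 1750 * ((n + 2) * (e + 2) * (N + 1) * q) := by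
    have h := Nat.mul_le_mul_left (N + 1) e2
    have h' : (N + 1) * (1600 * ((n + 2) * (e + 2) * q)) =
        1600 * ((n + 2) * (e + 2) * (N + 1) * q) := by ring
    rw [h'] at h
    omega
  have e4 : 1 ≤ (n + 2) * (e + 2) * (N + 1) * q := Nat.one_le_iff_ne_zero.2 (by positivity)
  have e5 : q * timeBase n N W e =
      10000 * ((W + 1) * ((n + 2) * ((n + 2) * (e + 2) * (N + 1) * q))) := by
    rw [timeBase]; ring
  rw [e5]
  generalize (n + 2) * (e + 2) * (N + 1) * q = z at e3 e4 ⊢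
  generalize (n + 1) * 90 + (e + 2) * 50 + 20 + (N + 1) * ((n + 2) * 1500 + q + q + 90) + 40 = y
    at e3 ⊢
  have e6 : (n + 1) * y + 40 ≤ 1800 * ((n + 2) * z) := by
    have := Nat.mul_le_mul_left (n + 1) e3
    nlinarith
  have e7 := Nat.mul_le_mul_left (W + 1) e6
  have e8 : 1 ≤ (W + 1) * ((n + 2) * z) := Nat.mul_pos (by omega) (Nat.mul_pos (by omega) e4)
  have e9 : (W + 1) * (1800 * ((n + 2) * z)) = 1800 * ((W + 1) * ((n + 2) * z)) := by ring
  rw [e9] at e7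
  omega

theorem one_le_timeBase (n N W e : ℕ) : 1 ≤ timeBase n N W e :=
  le_trans (by omega) (base_le_timeBase n N W e)

-- Strong induction on the rank: the two recursive calls of rank `l + 1` have ranks `rkPl J (l + 1)`
-- and `l`, both at most `l`.
set_option maxRecDepth 20000 in
theorem spec_call {J s N W e : ℕ} {M : ℝ} (hP : P[0]? = some proc) (hs : 0 < s) (hJ : 8 * s = J)
    (hM : 0 < M) (hW : 2 ^ (J + 7) ≤ W) (l : ℕ) :
    Spec I k P J s N W e M l (timeBase I.n N W e ^ (l + 1)) (.call 0) := by
  have hJ0 : 0 < J := by omega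
  have hB := one_le_timeBase I.n N W e
  have hbase := base_le_timeBase I.n N W e
  have hstep := step_le_timeBase I.n N W e
  generalize timeBase I.n N W e = B at hB hbase hstep ⊢
  induction l using Nat.strong_induction_on with
  | _ l ih =>
    intro s₀ fp r hg hr hl hpl
    have f : s₀.nat (I.n + 0) = fp := hg.frame
    have htest : (BExp.natLE (.mem (var 1)) (.lit 0)).Holds I k s₀ ↔ l = 0 := by
      simp only [BExp.Holds, NExp.eval, eval_var, f, hl, Nat.le_zero]
    have hsize : (BExp.natLE (.mem (var 1)) (.lit 0)).size = 9 := by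
      simp [BExp.size, NExp.size, var, gv, glob]
    cases l with
    | zero =>
      have hT : (I.n + 1) * ((I.n + 2) * 400 + (e + 2) * 50 + 30) + 20 ≤ B ^ (0 + 1) - 20 := by
        rw [zero_add, pow_one]; omega
      refine Runs.call hP (T' := B ^ (0 + 1) - 1)
        (Runs.ite (T' := B ^ (0 + 1) - 20)
          (fun _ => spec_baseCom hJ0 hT s₀ fp r hg hr hl hpl) (fun h => absurd (htest.2 rfl) h)
          ?_) ?_
      · rw [hsize, zero_add, pow_one]; omega
      · rw [zero_add, pow_one]; omega
    | succ l =>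
      have hpos : 1 ≤ B ^ (l + 1) := Nat.one_le_pow _ _ hB
      have ha := (ih (rkPl J (l + 1)) (by have := rkPl_le J l; omega)).mono
        (Nat.pow_le_pow_right hB (Nat.succ_le_succ (rkPl_le J l)))
      have hb := ih l (Nat.lt_succ_self l)
      have hbound := hstep (B ^ (l + 1)) hpos
      rw [← pow_succ B (l + 1)] at hbound
      generalize B ^ (l + 1 + 1) = G at hbound ⊢
      have hT := Nat.le_sub_of_add_le
        (le_trans (Nat.add_le_add_left (show 20 ≤ 40 by norm_num) _) hbound)
      refine Runs.call hP (T' := G - 1)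
        (Runs.ite (T' := G - 20) (fun h => absurd (htest.1 h) (by omega))
          (fun _ => spec_stepCom hs hJ hM hW ha hb hT s₀ fp r hg hr hl hpl) ?_) ?_
      · rw [hsize]; omega
      · omega

end

/-! ### The choice of the parameters -/

/-- `b` times the value of `a`. -/
def times (a : NExp) : ℕ → NExp
  | 0 => .lit 0
  | b + 1 => .add a (times a b)

theorem eval_times {I : Instance} {k : ℕ} {s : Store} (a : NExp) (b : ℕ) :
    (times a b).eval I k s = b * a.eval I k s := by
  induction b with
  | zero => simp [times, NExp.eval]
  | succ b ih => simp only [times, NExp.eval, ih]; ring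

theorem size_times (a : NExp) (b : ℕ) : (times a b).size = b * (1 + a.size) + 1 := by
  induction b with
  | zero => simp [times, NExp.size]
  | succ b ih => simp only [times, NExp.size, ih]; ring

/-- Store the logarithm with base `b`, rounded up, of the global variable `ct` in the global
variable `ca`. -/
def logCom (b ca cp ci ct : ℕ) : Com :=
  .seq (.setNat (glob ca) (.lit 0)) (.seq (.setNat (glob cp) (.lit 1))
    (forN (glob ci) .numVerts (.ite (.natLE (.add (gv cp) (.lit 1)) (gv ct))
      (.seq (.setNat (glob cp) (times (gv cp) b)) (.setNat (glob ca) (.add (gv ca) (.lit 1))))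
      .skip)))

/-- Store `c * 2 ^ x` in the global variable `cp`, where `x` is the global variable `cx`. -/
def powCom (c cp ci cx : ℕ) : Com :=
  .seq (.setNat (glob cp) (.lit c)) (forN (glob ci) (gv cx)
    (.setNat (glob cp) (.add (gv cp) (gv cp))))

section
variable {I : Instance} {k : ℕ} {P : List Com} {s : Store}

/-- Multiply by `b` as long as the power is below `x`. Since `x ≤ 2 ^ n`, the power stops growing
within `n` rounds, so a loop of that fixed length is enough. -/
theorem runs_logCom {b ca cp ci ct x T : ℕ} (hb : 2 ≤ b) (h₁ : ca ≠ cp) (h₂ : ca ≠ ci)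
    (h₃ : ca ≠ ct) (h₄ : cp ≠ ci) (h₅ : cp ≠ ct) (h₆ : ci ≠ ct) (hx : s.nat (I.n + ct) = x)
    (hn : x ≤ 2 ^ I.n) (hT : (I.n + 2) * (5 * b + 60) ≤ T) :
    Runs I k P (logCom b ca cp ci ct) s T (fun s' => s'.nat (I.n + ca) = Nat.clog b x ∧
      ∀ c, c ≠ ca → c ≠ cp → c ≠ ci → s'.nat (I.n + c) = s.nat (I.n + c)) := by
  have hclog : Nat.clog b x ≤ I.n :=
    Nat.clog_le_of_le_pow (hn.trans (Nat.pow_le_pow_left hb _))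
  have hX : 120 ≤ (I.n + 2) * (5 * b + 60) := 
    Nat.mul_le_mul (show 2 ≤ I.n + 2 by omega) (show 60 ≤ 5 * b + 60 by omega)
  refine Runs.seq (T₁ := 5) (T₂ := (I.n + 2) * (5 * b + 60) - 5)
    (Runs.setNat rfl rfl (by simp [glob, NExp.size])) ?_ (by omega)
  rintro s₁ ⟨a₁, a₂, a₃⟩
  rw [eval_glob] at a₂ a₃
  refine Runs.seq (T₁ := 5) (T₂ := (I.n + 2) * (5 * b + 60) - 10)
    (Runs.setNat rfl rfl (by simp [glob, NExp.size])) ?_ (by omega)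
  rintro s₂ ⟨b₁, b₂, b₃⟩
  rw [eval_glob] at b₂ b₃
  refine Runs.forN (fun i t => t.nat (I.n + ci) = i ∧ t.nat (I.n + ca) = min i (Nat.clog b x) ∧
      t.nat (I.n + cp) = b ^ min i (Nat.clog b x) ∧
      ∀ c, c ≠ ca → c ≠ cp → c ≠ ci → t.nat (I.n + c) = s.nat (I.n + c))
    (N := I.n) (ia := I.n + ci) (Tb := 5 * b + 35) rfl ?_ ?_ ?_ ?_ ?_
  · intro t g₁ g₂ g₃
    refine ⟨g₂, ?_, ?_, ?_⟩
    · rw [g₃ _ (by omega), b₃ _ (by omega), a₂, Nat.zero_min]; rfl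
    · rw [g₃ _ (by omega), b₂, Nat.zero_min, pow_zero]; rfl
    · intro c hc hc' hc''
      rw [g₃ _ (by omega), b₃ _ (by omega), a₃ _ (by omega)]
  · rintro i t ⟨g, -⟩
    exact ⟨rfl, g, rfl⟩
  · rintro i t hi ⟨g₁, g₂, g₃, g₄⟩
    have hlt : b ^ min i (Nat.clog b x) < x ↔ i < Nat.clog b x := by
      rw [← Nat.lt_clog_iff_pow_lt (by omega)]
      omega
    have htest : (BExp.natLE (.add (gv cp) (.lit 1)) (gv ct)).Holds I k t ↔ i < Nat.clog b x := by
      simp only [BExp.Holds, NExp.eval, eval_gv]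
      rw [g₃, g₄ ct (by omega) (by omega) (by omega), hx, ← hlt]
      omega
    refine Runs.ite (T' := 5 * b + 20) (fun h => ?_) (fun h => ?_)
      (by simp only [BExp.size, NExp.size, gv, glob]; omega)
    · rw [htest] at h
      have hmin : min (i + 1) (Nat.clog b x) = min i (Nat.clog b x) + 1 := by omega
      refine Runs.seq (T₁ := 5 * b + 6) (T₂ := 12) (Runs.setNat rfl (eval_times _ _)
        (by rw [size_times]; simp only [NExp.size, gv, glob]; omega)) ?_ (by omega)
      rintro t₁ ⟨c₁, c₂, c₃⟩
      rw [eval_glob] at c₂ c₃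
      refine (Runs.setNat rfl rfl (by simp [glob, gv, NExp.size])).mono le_rfl ?_
      rintro t₂ ⟨d₁, d₂, d₃⟩
      rw [eval_glob] at d₂ d₃
      refine ⟨rfl, by rw [d₃ _ (by omega), c₃ _ (by omega), g₁], fun t₃ m₁ m₂ m₃ => ⟨m₂, ?_, ?_, ?_⟩⟩
      · rw [m₃ _ (by omega), d₂, hmin]
        simp only [NExp.eval, eval_gv]
        rw [c₃ _ (by omega), g₂]
      · rw [m₃ _ (by omega), d₃ _ (by omega), c₂, hmin, eval_gv, g₃, pow_succ, mul_comm]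
      · intro c hc hc' hc''
        rw [m₃ _ (by omega), d₃ _ (by omega), c₃ _ (by omega), g₄ c hc hc' hc'']
    · rw [htest] at h
      have hmin : min (i + 1) (Nat.clog b x) = min i (Nat.clog b x) := by omega
      refine Runs.skip (by omega) ⟨rfl, g₁, fun t₃ m₁ m₂ m₃ => ⟨m₂, ?_, ?_, ?_⟩⟩
      · rw [m₃ _ (by omega), g₂, hmin]
      · rw [m₃ _ (by omega), g₃, hmin]
      · intro c hc hc' hc''
        rw [m₃ _ (by omega), g₄ c hc hc' hc'']
  · rintro t ⟨-, g₂, -, g₄⟩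
    exact ⟨by rw [g₂, Nat.min_eq_right hclog], g₄⟩
  · simp only [glob, NExp.size]
    rw [show I.n + 2 = I.n + 1 + 1 from rfl, Nat.succ_mul (I.n + 1)]
    have : (I.n + 1) * (5 * b + 35 + 3 * (1 + 1 + 1) + 1 + 9) ≤ (I.n + 1) * (5 * b + 60) :=
      Nat.mul_le_mul_left _ (by omega)
    omega

theorem runs_powCom {c cp ci cx x T : ℕ} (h₁ : cp ≠ ci) (h₂ : cp ≠ cx) (h₃ : ci ≠ cx)
    (hx : s.nat (I.n + cx) = x) (hT : (x + 2) * 50 ≤ T) :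
    Runs I k P (powCom c cp ci cx) s T (fun s' => s'.nat (I.n + cp) = c * 2 ^ x ∧
      ∀ c, c ≠ cp → c ≠ ci → s'.nat (I.n + c) = s.nat (I.n + c)) := by
  refine Runs.seq (T₁ := 5) (T₂ := (x + 1) * 50)
    (Runs.setNat rfl rfl (by simp [glob, NExp.size])) ?_ (by omega)
  rintro s₁ ⟨a₁, a₂, a₃⟩
  rw [eval_glob] at a₂ a₃
  refine Runs.forN (fun i t => t.nat (I.n + ci) = i ∧ t.nat (I.n + cp) = c * 2 ^ i ∧
      ∀ c, c ≠ cp → c ≠ ci → t.nat (I.n + c) = s.nat (I.n + c))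
    (N := x) (ia := I.n + ci) (Tb := 20) rfl ?_ ?_ ?_ ?_ ?_
  · intro t g₁ g₂ g₃
    refine ⟨g₂, ?_, fun c hc hc' => by rw [g₃ _ (by omega), a₃ _ (by omega)]⟩
    rw [g₃ _ (by omega), a₂, pow_zero, mul_one]; rfl
  · rintro i t ⟨g, -, g'⟩
    exact ⟨rfl, g, by rw [eval_gv, g' _ (by omega) (by omega), hx]⟩
  · rintro i t hi ⟨g₁, g₂, g₃⟩
    refine (Runs.setNat rfl rfl (by simp [glob, gv, NExp.size])).mono le_rfl ?_
    rintro t₁ ⟨c₁, c₂, c₃⟩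
    rw [eval_glob] at c₂ c₃
    refine ⟨rfl, by rw [c₃ _ (by omega), g₁], fun t₂ m₁ m₂ m₃ => ⟨m₂, ?_, ?_⟩⟩
    · rw [m₃ _ (by omega), c₂]
      simp only [NExp.eval, eval_gv]
      rw [g₂, pow_succ]
      ring
    · intro c hc hc'
      rw [m₃ _ (by omega), c₃ _ (by omega), g₃ c hc hc']
  · rintro t ⟨-, g₂, g₃⟩
    exact ⟨g₂, g₃⟩
  · refine Nat.mul_le_mul_left _ ?_
    simp [glob, gv, NExp.size]

/-- Rounding up: store the quotient of the global variables `17` and `19` in the global variable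
`23`, its multiple by the global variable `1` in the global variable `7`, and add a multiple to the
global variable `4`. -/
def divCom : Com :=
  .seq (.setNat (glob 22) (.lit 0)) (.seq (.setNat (glob 7) (.lit 0))
  (.seq (.setNat (glob 4) (.add (gv 19) (.lit 6))) (forN (glob 20) .numVerts
    (.ite (.natLE (.add (gv 22) (.lit 1)) (gv 17))
      (.seq (.setNat (glob 22) (.add (gv 22) (gv 19)))
      (.seq (.setNat (glob 7) (.add (gv 7) (gv 1)))
        (.setNat (glob 4) (.add (gv 4) (.add (gv 19) (.lit 4)))))) .skip))))

/-- Division by repeated addition: `d * a < L` holds exactly for `d` below the rounded-up quotient.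
The quotient is at most `n`, and its two multiples are accumulated along with it because there is no
multiplication. -/
theorem runs_divCom {L a J T : ℕ} (ha : 0 < a) (hL : L ≤ I.n) (h₁ : s.nat (I.n + 17) = L)
    (h₂ : s.nat (I.n + 19) = a) (h₃ : s.nat (I.n + 1) = J) (hT : (I.n + 2) * 100 ≤ T) :
    Runs I k P divCom s T (fun s' => s'.nat (I.n + 7) = J * ((L + a - 1) / a) ∧
      s'.nat (I.n + 4) = (a + 4) * ((L + a - 1) / a + 1) + 2 ∧
      ∀ c, c ≠ 4 → c ≠ 7 → c ≠ 20 → c ≠ 22 → s'.nat (I.n + c) = s.nat (I.n + c)) := by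
  have hlt : ∀ d, d * a < L ↔ d < (L + a - 1) / a := by
    intro d
    rw [← not_iff_not, not_lt, not_lt, ← Nat.lt_succ_iff (n := d), Nat.div_lt_iff_lt_mul ha,
      Nat.succ_mul]
    omega
  have hDn : (L + a - 1) / a ≤ I.n := by
    by_contra h
    have h' := (hlt I.n).2 (by omega)
    have : I.n * 1 ≤ I.n * a := Nat.mul_le_mul_left _ ha
    omega
  generalize (L + a - 1) / a = D at hlt hDn ⊢
  refine Runs.seq (T₁ := 5) (T₂ := (I.n + 1) * 100 + 30)
    (Runs.setNat rfl rfl (by simp [glob, NExp.size])) ?_ (by omega)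
  rintro s₁ ⟨a₁, a₂, a₃⟩
  rw [eval_glob] at a₂ a₃
  refine Runs.seq (T₁ := 5) (T₂ := (I.n + 1) * 100 + 20)
    (Runs.setNat rfl rfl (by simp [glob, NExp.size])) ?_ (by omega)
  rintro s₂ ⟨b₁, b₂, b₃⟩
  rw [eval_glob] at b₂ b₃
  refine Runs.seq (T₁ := 15) (T₂ := (I.n + 1) * 100)
    (Runs.setNat rfl rfl (by simp [glob, gv, NExp.size])) ?_ (by omega)
  rintro s₃ ⟨c₁, c₂, c₃⟩
  rw [eval_glob] at c₂ c₃
  refine Runs.forN (fun i t => t.nat (I.n + 20) = i ∧ t.nat (I.n + 22) = min i D * a ∧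
      t.nat (I.n + 7) = J * min i D ∧ t.nat (I.n + 4) = (a + 4) * (min i D + 1) + 2 ∧
      ∀ c, c ≠ 4 → c ≠ 7 → c ≠ 20 → c ≠ 22 → t.nat (I.n + c) = s.nat (I.n + c))
    (N := I.n) (ia := I.n + 20) (Tb := 70) rfl ?_ ?_ ?_ ?_ ?_
  · intro t g₁ g₂ g₃
    refine ⟨g₂, ?_, ?_, ?_, ?_⟩
    · rw [g₃ _ (by omega), c₃ _ (by omega), b₃ _ (by omega), a₂, Nat.zero_min, Nat.zero_mul]; rfl
    · rw [g₃ _ (by omega), c₃ _ (by omega), b₂, Nat.zero_min, Nat.mul_zero]; rfl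
    · rw [g₃ _ (by omega), c₂, Nat.zero_min]
      simp only [NExp.eval, eval_gv]
      rw [b₃ _ (by omega), a₃ _ (by omega), h₂]
      omega
    · intro c hc hc' hc'' hc'''
      rw [g₃ _ (by omega), c₃ _ (by omega), b₃ _ (by omega), a₃ _ (by omega)]
  · rintro i t ⟨g, -⟩
    exact ⟨rfl, g, rfl⟩
  · rintro i t hi ⟨g₁, g₂, g₃, g₄, g₅⟩
    have htest : (BExp.natLE (.add (gv 22) (.lit 1)) (gv 17)).Holds I k t ↔ i < D := by
      simp only [BExp.Holds, NExp.eval, eval_gv]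
      rw [g₂, g₅ 17 (by omega) (by omega) (by omega) (by omega), h₁, Nat.succ_le_iff, hlt]
      omega
    refine Runs.ite (T' := 50) (fun h => ?_) (fun h => ?_)
      (by simp [BExp.size, NExp.size, gv, glob])
    · rw [htest] at h
      have hmin : min (i + 1) D = min i D + 1 := by omega
      refine Runs.seq (T₁ := 15) (T₂ := 35) (Runs.setNat rfl rfl
        (by simp [NExp.size, gv, glob])) ?_ (by omega)
      rintro t₁ ⟨c₁, c₂, c₃⟩
      rw [eval_glob] at c₂ c₃
      refine Runs.seq (T₁ := 15) (T₂ := 20) (Runs.setNat rfl rfl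
        (by simp [NExp.size, gv, glob])) ?_ (by omega)
      rintro t₂ ⟨d₁, d₂, d₃⟩
      rw [eval_glob] at d₂ d₃
      refine (Runs.setNat rfl rfl (by simp [glob, gv, NExp.size])).mono le_rfl ?_
      rintro t₃ ⟨e₁, e₂, e₃⟩
      rw [eval_glob] at e₂ e₃
      refine ⟨rfl, by rw [e₃ _ (by omega), d₃ _ (by omega), c₃ _ (by omega), g₁],
        fun t₄ m₁ m₂ m₃ => ⟨m₂, ?_, ?_, ?_, ?_⟩⟩
      · rw [m₃ _ (by omega), e₃ _ (by omega), d₃ _ (by omega), c₂, hmin]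
        simp only [NExp.eval, eval_gv]
        rw [g₂, g₅ 19 (by omega) (by omega) (by omega) (by omega), h₂]
        ring
      · rw [m₃ _ (by omega), e₃ _ (by omega), d₂, hmin]
        simp only [NExp.eval, eval_gv]
        rw [c₃ _ (by omega), c₃ _ (by omega), g₃,
          g₅ 1 (by omega) (by omega) (by omega) (by omega), h₃]
        ring
      · rw [m₃ _ (by omega), e₂, hmin]
        simp only [NExp.eval, eval_gv]
        rw [d₃ _ (by omega), c₃ _ (by omega), g₄, d₃ _ (by omega), c₃ _ (by omega),
          g₅ 19 (by omega) (by omega) (by omega) (by omega), h₂]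
        ring
      · intro c hc hc' hc'' hc'''
        rw [m₃ _ (by omega), e₃ _ (by omega), d₃ _ (by omega), c₃ _ (by omega),
          g₅ c hc hc' hc'' hc''']
    · rw [htest] at h
      have hmin : min (i + 1) D = min i D := by omega
      refine Runs.skip (by omega) ⟨rfl, g₁, fun t₃ m₁ m₂ m₃ => ⟨m₂, ?_, ?_, ?_, ?_⟩⟩
      · rw [m₃ _ (by omega), g₂, hmin]
      · rw [m₃ _ (by omega), g₃, hmin]
      · rw [m₃ _ (by omega), g₄, hmin]
      · intro c hc hc' hc'' hc'''
        rw [m₃ _ (by omega), g₅ c hc hc' hc'' hc''']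
  · rintro t ⟨-, -, g₃, g₄, g₅⟩
    rw [Nat.min_eq_right hDn] at g₃ g₄
    exact ⟨g₃, g₄, g₅⟩
  · refine Nat.mul_le_mul_left _ ?_
    simp [glob, NExp.size]

/-- The size bound, on a logarithmic scale. -/
def logSize (n k : ℕ) : ℕ := Nat.clog 2 (min k n)

/-- The logarithm of the branching parameter. -/
def logWidth (b n k : ℕ) : ℕ := Nat.clog b (logSize n k + 2)

/-- The depth of the recursion. -/
def depth (b n k : ℕ) : ℕ := (logSize n k + logWidth b n k - 1) / logWidth b n k

/-- The logarithm of the scaling factor. -/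
def logScale (b n k : ℕ) : ℕ := (logWidth b n k + 4) * (depth b n k + 1) + 2

/-- The values of the global variables, for all frames. -/
structure Params (I : Instance) (J N W e d : ℕ) (s : Store) : Prop where
  period : s.nat (I.n + 1) = J
  targets : s.nat (I.n + 2) = N
  masks : s.nat (I.n + 3) = W
  scale : s.nat (I.n + 4) = e
  plateau : s.nat (I.n + 7) = J * d

/-- Compute the parameters. -/
def paramCom (b : ℕ) : Com :=
  .seq (.ite (.natLE .numVerts .param) (.setNat (glob 16) .numVerts) (.setNat (glob 16) .param))
  (.seq (logCom 2 17 18 20 16)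
  (.seq (.setNat (glob 21) (.add (gv 17) (.lit 2)))
  (.seq (logCom b 19 18 20 21)
  -- The level length `J = 8 s` for `s = 2 ^ a`, where `a` is the logarithm just computed.
  (.seq (powCom 8 1 20 19)
  (.seq divCom
  -- `128 * 2 ^ J = 2 ^ (J + 7)`, one mask for each subset of `J + 7` required vertices.
  (.seq (powCom 128 3 20 1)
  (.seq (.setNat (glob 24) (.add (gv 4) (.add (gv 17) (.lit 1))))
    (powCom 1 2 20 24))))))))

theorem logSize_lt (n k : ℕ) (hn : 0 < n) : logSize n k < n := by
  have : logSize n k ≤ n - 1 := by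
    refine Nat.clog_le_of_le_pow ((min_le_right _ _).trans ?_)
    have := Nat.lt_two_pow_self (n := n - 1)
    omega
  omega

theorem logWidth_pos {b : ℕ} (hb : 2 ≤ b) (n k : ℕ) : 0 < logWidth b n k :=
  Nat.clog_pos (by omega) (by omega)

theorem runs_paramCom {b T : ℕ} (hb : 2 ≤ b)
    (hT : (I.n + 2) * (5 * b + 60) + (I.n + 2) * 300 + (8 * 2 ^ logWidth b I.n k + logWidth b I.n k +
      logScale b I.n k + logSize I.n k + 10) * 50 ≤ T) :
    Runs I k P (paramCom b) s T (Params I (8 * 2 ^ logWidth b I.n k)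
      (2 ^ (logScale b I.n k + logSize I.n k + 1)) (2 ^ (8 * 2 ^ logWidth b I.n k + 7))
      (logScale b I.n k) (depth b I.n k)) := by
  have hn : 0 < I.n := I.root.pos
  have hL := logSize_lt I.n k hn
  have ha := logWidth_pos hb I.n k
  have hpow : I.n + 1 ≤ 2 ^ I.n := Nat.lt_two_pow_self
  have hLdef : logSize I.n k = Nat.clog 2 (min k I.n) := rfl
  have hadef : logWidth b I.n k = Nat.clog b (logSize I.n k + 2) := rfl
  have hddef : depth b I.n k = (logSize I.n k + logWidth b I.n k - 1) / logWidth b I.n k := rfl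
  have hedef : logScale b I.n k = (logWidth b I.n k + 4) * (depth b I.n k + 1) + 2 := rfl
  generalize logScale b I.n k = e at *
  generalize depth b I.n k = d at *
  generalize logWidth b I.n k = a at *
  generalize logSize I.n k = L at *
  obtain ⟨Tb, hTb⟩ : ∃ Tb, (I.n + 2) * (5 * b + 60) = Tb := ⟨_, rfl⟩
  obtain ⟨J, hJ⟩ : ∃ J, 8 * 2 ^ a = J := ⟨_, rfl⟩
  rw [hTb, hJ] at hT
  rw [hJ]
  refine Runs.seq (T₁ := 20) (T₂ := T - 20) (Q₁ := fun s' => s'.nat (I.n + 16) = min k I.n)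
    (Runs.ite (T' := 10) (fun h => ?_) (fun h => ?_) (by simp [BExp.size, NExp.size])) ?_ (by omega)
  · refine (Runs.setNat rfl rfl (by simp [glob, NExp.size])).mono le_rfl ?_
    rintro s' ⟨-, h', -⟩
    rw [eval_glob] at h'
    simp only [BExp.Holds, NExp.eval] at h h'
    rw [h', Nat.min_eq_right h]
  · refine (Runs.setNat rfl rfl (by simp [glob, NExp.size])).mono le_rfl ?_
    rintro s' ⟨-, h', -⟩
    rw [eval_glob] at h'
    simp only [BExp.Holds, NExp.eval] at h h'
    rw [h', Nat.min_eq_left (by omega)]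
  intro s₁ h₁
  refine Runs.seq (T₁ := (I.n + 2) * 70) (T₂ := T - 20 - (I.n + 2) * 70) (runs_logCom le_rfl
    (by omega) (by omega) (by omega) (by omega) (by omega) (by omega) h₁ (by omega) (by omega)) ?_
    (by omega)
  rintro s₂ ⟨a₁, a₂⟩
  rw [← hLdef] at a₁
  refine Runs.seq (T₁ := 20) (T₂ := T - 40 - (I.n + 2) * 70)
    (Runs.setNat (A := I.n + 21) (V := L + 2) rfl
      (by simp only [NExp.eval, eval_gv, a₁]) (by simp [glob, gv, NExp.size])) ?_ (by omega)
  rintro s₃ ⟨-, b₁, b₂⟩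
  refine Runs.seq (T₁ := Tb) (T₂ := T - 40 - (I.n + 2) * 70 - Tb) (runs_logCom hb
    (by omega) (by omega) (by omega) (by omega) (by omega) (by omega) b₁ (by omega) hTb.le) ?_
    (by omega)
  rintro s₄ ⟨c₁, c₂⟩
  rw [← hadef] at c₁
  refine Runs.seq (T₁ := (a + 2) * 50) (T₂ := T - 40 - (I.n + 2) * 70 - Tb - (a + 2) * 50)
    (runs_powCom (by omega) (by omega) (by omega) c₁ le_rfl) ?_ (by omega)
  rintro s₅ ⟨d₁, d₂⟩
  rw [hJ] at d₁
  have L₅ : s₅.nat (I.n + 17) = L := by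
    rw [d₂ _ (by omega) (by omega), c₂ _ (by omega) (by omega) (by omega), b₂ _ (by omega), a₁]
  refine Runs.seq (T₁ := (I.n + 2) * 100) (T₂ := T - 40 - (I.n + 2) * 170 - Tb - (a + 2) * 50)
    (runs_divCom ha hL.le L₅ (by rw [d₂ _ (by omega) (by omega), c₁]) d₁ le_rfl) ?_ (by omega)
  rintro s₆ ⟨e₁, e₂, e₃⟩
  rw [← hddef] at e₁ e₂
  rw [← hedef] at e₂
  have J₆ : s₆.nat (I.n + 1) = J := by
    rw [e₃ _ (by omega) (by omega) (by omega) (by omega), d₁]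
  refine Runs.seq (T₁ := (J + 2) * 50)
    (T₂ := T - 40 - (I.n + 2) * 170 - Tb - (a + 2) * 50 - (J + 2) * 50)
    (runs_powCom (by omega) (by omega) (by omega) J₆ le_rfl) ?_ (by omega)
  rintro s₇ ⟨f₁, f₂⟩
  refine Runs.seq (T₁ := 30) (T₂ := (e + (L + 1) + 2) * 50)
    (Runs.setNat (A := I.n + 24) (V := e + (L + 1)) rfl ?_
      (by simp [glob, gv, NExp.size])) ?_ (by omega)
  · simp only [NExp.eval, eval_gv]
    rw [f₂ _ (by omega) (by omega), f₂ _ (by omega) (by omega),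
      e₃ 17 (by omega) (by omega) (by omega) (by omega), e₂, L₅]
  rintro s₈ ⟨-, g₁, g₂⟩
  refine (runs_powCom (by omega) (by omega) (by omega) g₁ le_rfl).mono le_rfl ?_
  rintro s₉ ⟨i₁, i₂⟩
  refine ⟨?_, ?_, ?_, ?_, ?_⟩
  · rw [i₂ _ (by omega) (by omega), g₂ _ (by omega), f₂ _ (by omega) (by omega), J₆]
  · rw [i₁, one_mul, add_assoc]
  · rw [i₂ _ (by omega) (by omega), g₂ _ (by omega), f₁, pow_add, mul_comm]
    norm_num
  · rw [i₂ _ (by omega) (by omega), g₂ _ (by omega), f₂ _ (by omega) (by omega), e₂]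
  · rw [i₂ _ (by omega) (by omega), g₂ _ (by omega), f₂ _ (by omega) (by omega), e₁]

end

/-! ### The main program -/

/-- Call the procedure for the target in the real-number cell `2`, and keep the tree that is found if
it is better than the present output. -/
def tryCom : Com :=
  .seq (.setNat (glob 0) (.add (nmul 2) (.lit 64)))
  (.seq (assign (loc 16 0) (.lit 0))
  (.seq (assign (loc 16 1) (.lit 0))
  (.seq (.setNat (var 0) .root)
  (.seq (.setNat (var 1) (.add (gv 7) (gv 1)))
  (.seq (.setNat (var 2) (gv 7))
  (.seq (.setReal (gv 0) (.mem (.lit 2)))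
  (.seq (.call 0)
  (.seq (.ite (.and (.natLE (.lit 1) (.mem (var 6))) (.and (.natLE (.mem (var 6))
      (.add .budget (.lit 1))) (.not (.realLE (.value (loc 16 2)) (.value (.lit 0))))))
    (assign (.lit 0) (elt (loc 16 2) (gv 8))) .skip)
    (.setReal (.lit 2) (.add (.mem (.lit 2)) (.mem (.lit 0))))))))))))

/-- The treatment of one guess of the most valuable vertex. -/
def vertexCom : Com :=
  .seq (fill (glob 64) (eqB (gv 8) (gv 5)) (.lit 1) (.lit 0))
  (.seq (.setReal (.lit 0) (.value (glob 64)))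
    -- The unit `M` has to be positive; a vertex of value zero is useless as the guess.
    (.ite (.realLE (.mem (.lit 0)) (.ofNat (.lit 0))) .skip
      (.seq (.setReal (.lit 2) (.ofNat (.lit 0))) (forN (glob 6) (gv 2) tryCom))))

/-- The main command. -/
def mainCom (b : ℕ) : Com :=
  .seq (paramCom b) (.seq (assign (.lit 0) (.lit 0)) (.seq (.setNat .root (.lit 1))
    (forN (glob 5) .numVerts vertexCom)))

section
variable {I : Instance} {k : ℕ} {P : List Com}

/-- The parent map in the output cells. -/
def outMap (I : Instance) (s : Store) : Fin I.n → ℕ := fun v => s.nat v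

/-- The output describes a feasible solution. -/
structure OutFeasible (I : Instance) (s : Store) : Prop where
  isParentMap : IsParentMap I I.root (outMap I s)
  cost_le : ∑ e ∈ pedges (outMap I s), I.cost e ≤ I.budget

theorem OutFeasible.congr {s s' : Store} (h : OutFeasible I s)
    (he : outMap I s' = outMap I s) : OutFeasible I s' := by
  obtain ⟨h₁, h₂⟩ := h
  rw [← he] at h₁ h₂
  exact ⟨h₁, h₂⟩

/-- The output meets the target `τ`, if this is what the recursion has to achieve. -/
def OutGood (I : Instance) (J s N e d : ℕ) (M τ : ℝ) (t : Store) : Prop :=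
  ∀ c, c ≤ I.budget → Attainable I (scaled I e) M N J s (J * (d + 1)) I.root ∅ ∅ τ c →
    τ ≤ scaled I e (pverts (outMap I t))

theorem OutGood.mono {J s N e d : ℕ} {M τ : ℝ} {t t' : Store} (h : OutGood I J s N e d M τ t)
    (ht : I.f (pverts (outMap I t)) ≤ I.f (pverts (outMap I t'))) : OutGood I J s N e d M τ t' :=
  fun c hc ha => (h c hc ha).trans (mul_le_mul_of_nonneg_left ht (by positivity))

/-- The output is replaced only by a tree within the budget and of strictly larger reward. Thus the
output never gets worse, and a target once met stays met. -/
theorem runs_tryCom {J s N W e d Tc T : ℕ} {M τ : ℝ} (hJ : 0 < J)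
    (hspec : Spec I k P J s N W e M (J * (d + 1)) Tc (.call 0)) {t : Store}
    (hp : Params I J N W e d t) (hM : t.real 0 = M) (hτ : t.real 2 = τ) (ho : OutFeasible I t)
    (hT : (I.n + 2) * 400 + Tc ≤ T) :
    Runs I k P tryCom t T (fun t' => (∀ c, 1 ≤ c → c < 8 → t'.nat (I.n + c) = t.nat (I.n + c)) ∧
      t'.real 0 = M ∧ t'.real 2 = τ + M ∧ OutFeasible I t' ∧
      I.f (pverts (outMap I t)) ≤ I.f (pverts (outMap I t')) ∧ OutGood I J s N e d M τ t') := by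
  obtain ⟨fp, hfp⟩ : ∃ fp, fp = 2 * I.n + 64 := ⟨_, rfl⟩
  refine Runs.seq (T₁ := 30) (T₂ := (I.n + 2) * 400 + Tc - 30) (Runs.setNat (A := I.n + 0) (V := fp)
    rfl (by simp only [NExp.eval, eval_nmul, hfp]) (by simp [glob, nmul, NExp.size])) ?_ (by omega)
  rintro s₁ ⟨a₁, a₂, a₃⟩
  refine Runs.seq (T₁ := (I.n + 1) * 70) (T₂ := (I.n + 2) * 330 + Tc - 30)
    (runs_assign (A := fp + (16 + 0 * I.n)) (fun _ => 0) (by omega) ?_ ?_) ?_ (by omega)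
  · intro s' v hv h₁ h₂ h₃
    rw [eval_loc, h₂ _ (by omega) (by omega), a₂]
    exact ⟨rfl, rfl⟩
  · refine Nat.mul_le_mul_left _ ?_
    simp [NExp.size, gv, glob, loc, nmul]
  rintro s₂ ⟨b₁, b₂, b₃⟩
  have f₂ : s₂.nat (I.n + 0) = fp := by rw [b₃ _ (by omega) (by omega), a₂]
  refine Runs.seq (T₁ := (I.n + 1) * 70) (T₂ := (I.n + 2) * 260 + Tc - 30)
    (runs_assign (A := fp + (16 + 1 * I.n)) (fun _ => 0) (by omega) ?_ ?_) ?_ (by omega)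
  · intro s' v hv h₁ h₂ h₃
    rw [eval_loc, h₂ _ (by omega) (by omega), f₂]
    exact ⟨rfl, rfl⟩
  · refine Nat.mul_le_mul_left _ ?_
    simp [NExp.size, gv, glob, loc, nmul]
  rintro s₃ ⟨c₁, c₂, c₃⟩
  have f₃ : s₃.nat (I.n + 0) = fp := by rw [c₃ _ (by omega) (by omega), f₂]
  refine Runs.seq (T₁ := 20) (T₂ := (I.n + 2) * 260 + Tc - 50) (Runs.setNat (A := fp + 0)
    (V := I.root) (by rw [eval_var, f₃]) rfl (by simp [glob, gv, var, NExp.size])) ?_ (by omega)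
  rintro s₄ ⟨d₁, d₂, d₃⟩
  have q₄ : ∀ c, 1 ≤ c → c < 8 → s₄.nat (I.n + c) = t.nat (I.n + c) := by
    intro c hc hc'
    rw [d₃ _ (by omega), c₃ _ (by omega) (by omega), b₃ _ (by omega) (by omega), a₃ _ (by omega)]
  have f₄ : s₄.nat (I.n + 0) = fp := by rw [d₃ _ (by omega), f₃]
  refine Runs.seq (T₁ := 30) (T₂ := (I.n + 2) * 260 + Tc - 80) (Runs.setNat (A := fp + 1)
    (V := J * (d + 1)) (by rw [eval_var, f₄]) ?_ (by simp [glob, gv, var, NExp.size])) ?_ (by omega)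
  · simp only [NExp.eval, eval_gv]
    rw [q₄ _ (by omega) (by omega), q₄ _ (by omega) (by omega), hp.plateau, hp.period, Nat.mul_succ]
  rintro s₅ ⟨e₁, e₂, e₃⟩
  have f₅ : s₅.nat (I.n + 0) = fp := by rw [e₃ _ (by omega), f₄]
  refine Runs.seq (T₁ := 30) (T₂ := (I.n + 2) * 260 + Tc - 110) (Runs.setNat (A := fp + 2)
    (V := J * d) (by rw [eval_var, f₅]) ?_ (by simp [glob, gv, var, NExp.size])) ?_ (by omega)
  · rw [eval_gv, e₃ _ (by omega), q₄ _ (by omega) (by omega), hp.plateau]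
  rintro s₆ ⟨g₁, g₂, g₃⟩
  have f₆ : s₆.nat (I.n + 0) = fp := by rw [g₃ _ (by omega), f₅]
  have hr₆ : s₆.real = t.real := by rw [g₁, e₁, d₁, c₁, b₁, a₁]
  refine Runs.seq (T₁ := 30) (T₂ := (I.n + 2) * 260 + Tc - 140) (Runs.setReal (A := fp)
    (V := τ) (by rw [eval_gv, f₆]) ?_ (by simp [glob, gv, RExp.size, NExp.size])) ?_ (by omega)
  · simp only [RExp.eval, NExp.eval, hr₆, hτ]
  rintro s₇ ⟨i₁, i₂, i₃⟩
  have q₇ : ∀ c, 1 ≤ c → c < 8 → s₇.nat (I.n + c) = t.nat (I.n + c) := by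
    intro c hc hc'
    rw [i₁, g₃ _ (by omega), e₃ _ (by omega), q₄ c hc hc']
  have o₇ : outMap I s₇ = outMap I t := by
    funext v
    have := v.2
    rw [outMap, outMap, i₁, g₃ _ (by omega), e₃ _ (by omega), d₃ _ (by omega),
      c₃ _ (by omega) (by omega), b₃ _ (by omega) (by omega), a₃ _ (by omega)]
  have f₇ : s₇.nat (I.n + 0) = fp := by rw [i₁, f₆]
  have hg : Globals I fp J N W e M s₇ :=
    ⟨f₇, by rw [q₇ _ (by omega) (by omega), hp.period], by rw [q₇ _ (by omega) (by omega), hp.targets],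
      by rw [q₇ _ (by omega) (by omega), hp.masks], by rw [q₇ _ (by omega) (by omega), hp.scale],
      by rw [i₃ _ (by omega), hr₆, hM], by omega⟩
  have hY : setAt I.n s₇.nat (fp + (16 + 0 * I.n)) = ∅ := by
    rw [Finset.eq_empty_iff_forall_notMem]
    intro v
    have := v.2
    rw [mem_setAt, i₁, g₃ _ (by omega), e₃ _ (by omega), d₃ _ (by omega), c₃ _ (by omega) (by omega),
      b₂ v v.2]
    exact not_not.2 rfl
  have hX : setAt I.n s₇.nat (fp + (16 + 1 * I.n)) = ∅ := by
    rw [Finset.eq_empty_iff_forall_notMem]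
    intro v
    have := v.2
    rw [mem_setAt, i₁, g₃ _ (by omega), e₃ _ (by omega), d₃ _ (by omega), c₂ v v.2]
    exact not_not.2 rfl
  have hpl : rkPl J (J * (d + 1)) = J * d := by
    rw [mul_succ_eq hJ, rkPl_level hJ (by omega)]
  refine Runs.seq (T₁ := Tc) (T₂ := (I.n + 2) * 260 - 140) (hspec s₇ fp I.root hg
    (by rw [i₁, g₃ _ (by omega), e₃ _ (by omega)]; exact d₂)
    (by rw [i₁, g₃ _ (by omega), e₂]) (by rw [i₁, g₂, hpl])) ?_ (by omega)
  rw [hY, hX, i₂]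
  rintro s₈ ⟨j₁, j₂, j₃⟩
  have f₈ : s₈.nat (I.n + 0) = fp := by rw [j₁.nat _ (by omega), f₇]
  have o₈ : outMap I s₈ = outMap I t := by
    rw [← o₇]
    funext v
    exact j₁.nat _ (by omega)
  have q₈ : ∀ c, 1 ≤ c → c < 8 → s₈.nat (I.n + c) = t.nat (I.n + c) := by
    intro c hc hc'
    rw [j₁.nat _ (by omega), q₇ c hc hc']
  have r₈ : s₈.real 0 = M ∧ s₈.real 2 = τ := by
    refine ⟨?_, ?_⟩
    · rw [j₁.real _ (by omega) (by omega), i₃ _ (by omega), hr₆, hM]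
    · rw [j₁.real _ (by omega) (by omega), i₃ _ (by omega), hr₆, hτ]
  refine Runs.seq (T₁ := (I.n + 2) * 180) (T₂ := 20) (Q₁ := fun t' => t'.real = s₈.real ∧
    (∀ c, 1 ≤ c → c < 8 → t'.nat (I.n + c) = t.nat (I.n + c)) ∧ OutFeasible I t' ∧
      I.f (pverts (outMap I t)) ≤ I.f (pverts (outMap I t')) ∧ OutGood I J s N e d M τ t') ?_ ?_
    (by omega)
  · have htest : (BExp.and (.natLE (.lit 1) (.mem (var 6))) (.and (.natLE (.mem (var 6))
        (.add .budget (.lit 1))) (.not (.realLE (.value (loc 16 2)) (.value (.lit 0)))))).Holds I k s₈ ↔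
        1 ≤ s₈.nat (fp + 6) ∧ s₈.nat (fp + 6) ≤ I.budget + 1 ∧
          I.f (pverts (outMap I t)) < I.f (pverts (treeAt I fp s₈)) := by
      simp only [BExp.Holds, NExp.eval, RExp.eval, eval_var, eval_loc, f₈, zero_add, not_le]
      rw [← o₈]
      rfl
    refine Runs.ite (T' := (I.n + 1) * 100) (fun h => ?_) (fun h => ?_) ?_
    · rw [htest] at h
      obtain ⟨h₁, h₂, h₃⟩ := h
      refine (runs_assign (A := 0) (fun v => s₈.nat (fp + (16 + 2 * I.n) + v)) (by omega) ?_
        ?_).mono le_rfl ?_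
      · intro s' v hv m₁ m₂ m₃
        rw [eval_elt, eval_loc, eval_gv, m₂ (I.n + 0) (by omega) (by omega), f₈, m₃,
          m₂ _ (by omega) (by omega)]
        exact ⟨rfl, rfl⟩
      · refine Nat.mul_le_mul_left _ ?_
        simp [NExp.size, gv, glob, elt, loc, nmul]
      rintro s₉ ⟨m₁, m₂, m₃⟩
      have o₉ : outMap I s₉ = treeAt I fp s₈ := by
        funext v
        have := m₂ v v.2
        rw [zero_add] at this
        exact this
      obtain ⟨w₁, -, w₃, w₄⟩ := j₂ (by omega)
      refine ⟨m₁, fun c hc hc' => by rw [m₃ _ (by omega) (by omega), q₈ c hc hc'],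
        ⟨by rwa [o₉], by rw [o₉]; omega⟩, by rw [o₉]; exact h₃.le, ?_⟩
      intro c _ _
      rw [o₉]
      rwa [Finset.empty_union] at w₃
    · rw [htest] at h
      refine Runs.skip (by omega) ⟨rfl, q₈, ho.congr o₈, by rw [o₈], ?_⟩
      intro c hc hatt
      obtain ⟨w₁, w₂⟩ := j₃ c hatt
      obtain ⟨-, -, w₃, -⟩ := j₂ w₁
      rw [Finset.empty_union] at w₃
      refine w₃.trans (mul_le_mul_of_nonneg_left ?_ (by positivity))
      rw [o₈]
      by_contra hlt
      exact h ⟨by omega, by omega, not_le.1 hlt⟩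
    · simp only [BExp.size, NExp.size, RExp.size, gv, glob, var, loc, nmul]
      omega
  rintro s₉ ⟨k₁, k₂, k₃, k₄, k₅⟩
  refine (Runs.setReal (A := 2) (V := τ + M) rfl
    (by simp only [RExp.eval, NExp.eval, k₁, r₈.1, r₈.2]) (by simp [RExp.size, NExp.size])).mono
    le_rfl ?_
  rintro s₁₀ ⟨l₁, l₂, l₃⟩
  have o₁₀ : outMap I s₁₀ = outMap I s₉ := by
    funext v
    rw [outMap, outMap, l₁]
  refine ⟨fun c hc hc' => by rw [l₁, k₂ c hc hc'], by rw [l₃ _ (by omega), k₁, r₈.1], l₂,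
    k₃.congr o₁₀, by rwa [o₁₀], k₅.mono (by rw [o₁₀])⟩

theorem Params.congr {J N W e d : ℕ} {t t' : Store} (h : Params I J N W e d t)
    (ht : ∀ c, c = 1 ∨ c = 2 ∨ c = 3 ∨ c = 4 ∨ c = 7 → t'.nat (I.n + c) = t.nat (I.n + c)) :
    Params I J N W e d t' :=
  ⟨by rw [ht _ (by omega), h.period], by rw [ht _ (by omega), h.targets],
    by rw [ht _ (by omega), h.masks], by rw [ht _ (by omega), h.scale],
    by rw [ht _ (by omega), h.plateau]⟩

theorem runs_vertexCom {J s N W e d Tc T : ℕ} {x : Fin I.n} (hJ : 0 < J)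
    (hspec : ∀ M : ℝ, 0 < M → Spec I k P J s N W e M (J * (d + 1)) Tc (.call 0)) {t : Store}
    (hp : Params I J N W e d t) (hx : t.nat (I.n + 5) = x) (ho : OutFeasible I t)
    (hT : (N + 2) * ((I.n + 2) * 500 + Tc) ≤ T) :
    Runs I k P vertexCom t T (fun t' => Params I J N W e d t' ∧ t'.nat (I.n + 5) = x ∧
      OutFeasible I t' ∧ I.f (pverts (outMap I t)) ≤ I.f (pverts (outMap I t')) ∧
      (0 < I.f {x} → ∀ v, v < N → OutGood I J s N e d (I.f {x}) (v * I.f {x}) t')) := by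
  have hTN : (N + 2) * ((I.n + 2) * 500 + Tc) =
    (N + 1) * ((I.n + 2) * 500 + Tc) + ((I.n + 2) * 500 + Tc) := Nat.succ_mul _ _
  rw [hTN] at hT
  refine Runs.seq (T₁ := (I.n + 1) * 100)
    (T₂ := (N + 1) * ((I.n + 2) * 500 + Tc) + ((I.n + 2) * 400)) (runs_fill (A := I.n + 64)
      (fun v => if v = x then 1 else 0) (by omega) ?_ ?_) ?_ (by omega)
  · intro s' v hv h₁ h₂ h₃
    rw [holds_eqB, eval_gv, eval_gv, h₃, h₂ _ (by omega) (by omega), hx]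
    exact ⟨rfl, fun h => (if_pos h).symm, fun h => (if_neg h).symm⟩
  · refine Nat.mul_le_mul_left _ ?_
    simp [BExp.size, NExp.size, gv, glob, eqB]
  rintro s₁ ⟨a₁, a₂, a₃⟩
  have hZ : setAt I.n s₁.nat (I.n + 64) = {x} := by
    ext v
    rw [mem_setAt, a₂ v v.2, Finset.mem_singleton, Fin.ext_iff]
    simp
  refine Runs.seq (T₁ := 10)
    (T₂ := (N + 1) * ((I.n + 2) * 500 + Tc) + ((I.n + 2) * 300)) (Runs.setReal (A := 0)
      (V := I.f {x}) rfl ?_ (by simp [RExp.size, NExp.size, glob])) ?_ (by omega)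
  · rw [← hZ]; rfl
  rintro s₂ ⟨b₁, b₂, b₃⟩
  have q₂ : ∀ c, c < 8 → s₂.nat (I.n + c) = t.nat (I.n + c) := fun c hc => by
    rw [b₁, a₃ _ (by omega) (by omega)]
  have o₂ : outMap I s₂ = outMap I t := by
    funext v
    have := v.2
    rw [outMap, outMap, b₁, a₃ _ (by omega) (by omega)]
  have p₂ : Params I J N W e d s₂ := hp.congr fun c hc => q₂ c (by omega)
  have htest : (BExp.realLE (.mem (.lit 0)) (.ofNat (.lit 0))).Holds I k s₂ ↔ I.f {x} ≤ 0 := by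
    simp only [BExp.Holds, RExp.eval, NExp.eval, b₂, Nat.cast_zero]
  refine Runs.ite (T' := (N + 1) * ((I.n + 2) * 500 + Tc) + ((I.n + 2) * 200)) (fun h => ?_)
    (fun h => ?_) (by simp only [BExp.size, RExp.size, NExp.size]; omega)
  · rw [htest] at h
    exact Runs.skip (by omega) ⟨p₂, by rw [q₂ _ (by omega), hx], ho.congr o₂, by rw [o₂],
      fun h' => absurd h' (not_lt.2 h)⟩
  rw [htest, not_le] at h
  refine Runs.seq (T₁ := 10) (T₂ := (N + 1) * ((I.n + 2) * 500 + Tc))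
    (Runs.setReal (A := 2) (V := 0) rfl (by simp [RExp.eval, NExp.eval])
      (by simp [RExp.size, NExp.size])) ?_ (by omega)
  rintro s₃ ⟨c₁, c₂, c₃⟩
  refine Runs.forN (fun v t' => Params I J N W e d t' ∧ t'.nat (I.n + 5) = x ∧
      t'.nat (I.n + 6) = v ∧ t'.real 0 = I.f {x} ∧ t'.real 2 = v * I.f {x} ∧ OutFeasible I t' ∧
      I.f (pverts (outMap I t)) ≤ I.f (pverts (outMap I t')) ∧
      (∀ v', v' < v → OutGood I J s N e d (I.f {x}) (v' * I.f {x}) t')) (N := N) (ia := I.n + 6)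
      (Tb := (I.n + 2) * 400 + Tc) rfl ?_ ?_ ?_ ?_ ?_
  · intro s₄ g₁ g₂ g₃
    have o₄ : outMap I s₄ = outMap I t := by
      rw [← o₂]
      funext v
      have := v.2
      rw [outMap, outMap, g₃ _ (by omega), c₁]
    refine ⟨p₂.congr fun c hc => by rw [g₃ _ (by omega), c₁], ?_, g₂, ?_, ?_, ho.congr o₄,
      by rw [o₄], fun v' h' => absurd h' (Nat.not_lt_zero _)⟩
    · rw [g₃ _ (by omega), c₁, q₂ _ (by omega), hx]
    · rw [g₁, c₃ _ (by omega), b₂]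
    · rw [g₁, c₂, Nat.cast_zero, zero_mul]
  · rintro v t' ⟨h₁, h₂, h₃, -⟩
    exact ⟨rfl, h₃, by rw [eval_gv, h₁.targets]⟩
  · rintro v t' hv ⟨h₁, h₂, h₃, h₄, h₅, h₆, h₇, h₈⟩
    refine (runs_tryCom hJ (hspec _ h) h₁ h₄ h₅ h₆ le_rfl).mono le_rfl ?_
    rintro t₁ ⟨g₁, g₂, g₃, g₄, g₅, g₆⟩
    refine ⟨rfl, by rw [g₁ _ (by omega) (by omega), h₃], fun t₂ m₁ m₂ m₃ => ?_⟩
    have o₂ : outMap I t₂ = outMap I t₁ := by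
      funext v
      have := v.2
      rw [outMap, outMap, m₃ _ (by omega)]
    refine ⟨h₁.congr fun c hc => by rw [m₃ _ (by omega), g₁ _ (by omega) (by omega)], ?_, m₂, ?_, ?_,
      g₄.congr o₂, by rw [o₂]; exact h₇.trans g₅, ?_⟩
    · rw [m₃ _ (by omega), g₁ _ (by omega) (by omega), h₂]
    · rw [m₁, g₂]
    · rw [m₁, g₃]; push_cast; ring
    · intro v' hv'
      rcases Nat.lt_succ_iff_lt_or_eq.1 hv' with hv' | rfl
      · exact (h₈ v' hv').mono (by rw [o₂]; exact g₅)
      · exact g₆.mono (by rw [o₂])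
  · rintro t' ⟨h₁, h₂, -, -, -, h₆, h₇, h₈⟩
    exact ⟨h₁, h₂, h₆, h₇, fun _ => h₈⟩
  · refine Nat.mul_le_mul_left _ ?_
    simp only [glob, gv, NExp.size]
    omega

theorem runs_mainCom {b J s N W e d Tc Tp T : ℕ} (hJ : 0 < J)
    (hparam : Runs I k P (paramCom b) Store.zero Tp (Params I J N W e d))
    (hspec : ∀ M : ℝ, 0 < M → Spec I k P J s N W e M (J * (d + 1)) Tc (.call 0))
    (hT : Tp + (I.n + 2) * ((N + 2) * ((I.n + 2) * 500 + Tc) + 100) ≤ T) :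
    Runs I k P (mainCom b) Store.zero T (fun t => OutFeasible I t ∧
      ∀ x : Fin I.n, 0 < I.f {x} → ∀ v, v < N →
        OutGood I J s N e d (I.f {x}) (v * I.f {x}) t) := by
  obtain ⟨Tb, hTb⟩ : ∃ Tb, (N + 2) * ((I.n + 2) * 500 + Tc) = Tb := ⟨_, rfl⟩
  have hTb' : (I.n + 1) * 100 ≤ Tb := by
    rw [← hTb]
    have : 1 * ((I.n + 2) * 500 + Tc) ≤ (N + 2) * ((I.n + 2) * 500 + Tc) :=
      Nat.mul_le_mul_right _ (by omega)
    omega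
  rw [hTb, show I.n + 2 = I.n + 1 + 1 from rfl, Nat.succ_mul] at hT
  refine Runs.seq (T₁ := Tp) (T₂ := (I.n + 1) * (Tb + 100) + (Tb + 100)) hparam ?_ hT
  intro s₁ p₁
  refine Runs.seq (T₁ := (I.n + 1) * 40) (T₂ := (I.n + 1) * (Tb + 100) + 40)
    (runs_assign (A := 0) (fun _ => 0) (by omega) (fun _ _ _ _ _ _ => ⟨rfl, rfl⟩)
      (Nat.mul_le_mul_left _ (by simp [NExp.size]))) ?_ (by omega)
  rintro s₂ ⟨a₁, a₂, a₃⟩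
  refine Runs.seq (T₁ := 10) (T₂ := (I.n + 1) * (Tb + 100)) (Runs.setNat (A := I.root) (V := 1) rfl rfl
    (by simp [NExp.size])) ?_ (by omega)
  rintro s₃ ⟨b₁, b₂, b₃⟩
  have hroot := I.root.2
  have p₃ : Params I J N W e d s₃ :=
    p₁.congr fun c hc => by rw [b₃ _ (by omega), a₃ _ (by omega) (by omega)]
  -- The initial output is the root alone, written as the degenerate edge from the root to itself;
  -- it has cost zero.
  have o₃ : outMap I s₃ = pedge I.root I.root := by
    funext v
    by_cases hv : v = I.root
    · rw [outMap, hv, b₂]; simp [pedge]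
    · have h₁ : (v : ℕ) ≠ I.root := fun h => hv (Fin.ext h)
      have h₂ := a₂ v v.2
      rw [zero_add] at h₂
      rw [outMap, b₃ _ h₁, h₂]
      simp [pedge, hv]
  have f₃ : OutFeasible I s₃ := by
    refine ⟨by rw [o₃]; exact isParentMap_pedge (Or.inl rfl), ?_⟩
    rw [o₃]
    refine (cost_pedge_le _ _).trans ?_
    simp
  refine Runs.forN (fun x t => Params I J N W e d t ∧ t.nat (I.n + 5) = x ∧ OutFeasible I t ∧
      ∀ x' : Fin I.n, (x' : ℕ) < x → 0 < I.f {x'} → ∀ v, v < N →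
        OutGood I J s N e d (I.f {x'}) (v * I.f {x'}) t) (N := I.n) (ia := I.n + 5)
      (Tb := Tb) rfl ?_ ?_ ?_ ?_ ?_
  · intro t g₁ g₂ g₃
    refine ⟨p₃.congr fun c hc => g₃ _ (by omega), g₂, f₃.congr ?_,
      fun x' h' => absurd h' (Nat.not_lt_zero _)⟩
    funext v
    have := v.2
    exact g₃ _ (by omega)
  · rintro x t ⟨-, h, -⟩
    exact ⟨rfl, h, rfl⟩
  · rintro x t hx ⟨h₁, h₂, h₃, h₄⟩
    refine (runs_vertexCom (x := ⟨x, hx⟩) hJ hspec h₁ h₂ h₃ hTb.le).mono le_rfl ?_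
    rintro t₁ ⟨g₁, g₂, g₃, g₄, g₅⟩
    refine ⟨rfl, g₂, fun t₂ m₁ m₂ m₃ => ?_⟩
    have o₂ : outMap I t₂ = outMap I t₁ := by
      funext v
      have := v.2
      exact m₃ _ (by omega)
    refine ⟨g₁.congr fun c hc => m₃ _ (by omega), m₂, g₃.congr o₂, ?_⟩
    intro x' hx' hpos v hv
    by_cases hxx : (x' : ℕ) = x
    · obtain rfl : x' = ⟨x, hx⟩ := Fin.ext hxx
      exact (g₅ hpos v hv).mono (by rw [o₂])
    · exact (h₄ x' (by omega) hpos v hv).mono (by rw [o₂]; exact g₄)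
  · rintro t ⟨-, -, h₃, h₄⟩
    exact ⟨h₃, fun x => h₄ x x.2⟩
  · refine Nat.mul_le_mul_left _ ?_
    simp [glob, NExp.size]

end

/-! ### The approximation guarantee -/

/-- Subadditivity, from submodularity and nonnegativity. The empty set has to be excluded because
its reward may be positive. -/
theorem Instance.f_le_sum (I : Instance) {S : Finset (Fin I.n)} (hS : S.Nonempty) :
    I.f S ≤ ∑ x ∈ S, I.f {x} := by
  induction hS using Finset.Nonempty.cons_induction with
  | singleton a => simp
  | cons a S ha hS ih =>
    have h := I.f_submodular {a} S
    have h' := I.f_nonneg ({a} ∩ S)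
    rw [Finset.sum_cons, Finset.cons_eq_insert, Finset.insert_eq]
    linarith

/-- With `M` the largest value of a vertex in the optimum, the scaled optimum lies between `2 ^ e *
M` and `2 ^ (e + L) * M`. The upper bound shows that `N` grid points reach far enough; the lower
bound makes the additive error at most half the optimum. Hence the largest attainable target is at
least the optimum divided by `2 (d + 2)`. -/
theorem le_of_outGood {I : Instance} {Topt : Subgraph I.n} (hT : I.IsFeasible Topt)
    {L a d J N e : ℕ} (hcard : Topt.verts.card ≤ 2 ^ L) (hL : L ≤ a * d) (hJ : 8 * 2 ^ a = J)
    (he : (a + 4) * (d + 1) + 2 = e) (hN : 2 ^ (e + L + 1) = N) {t : Store}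
    (ht : ∀ x : Fin I.n, 0 < I.f {x} → ∀ v, v < N →
      OutGood I J (2 ^ a) N e d (I.f {x}) (v * I.f {x}) t) :
    I.f Topt.verts ≤ 2 * (d + 2) * I.f (pverts (outMap I t)) := by
  have hs : 0 < 2 ^ a := by positivity
  have hJ0 : 0 < J := by omega
  have hne : Topt.verts.Nonempty := ⟨_, hT.isArborescence.root_mem⟩
  obtain ⟨x, hx, hmax⟩ := Finset.exists_max_image Topt.verts (fun x => I.f {x}) hne
  set M := I.f {x} with hM
  have hout := I.f_nonneg (pverts (outMap I t))
  have hsum : I.f Topt.verts ≤ 2 ^ L * M := by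
    refine (I.f_le_sum hne).trans ((Finset.sum_le_card_nsmul _ _ M hmax).trans ?_)
    rw [nsmul_eq_mul]
    refine mul_le_mul_of_nonneg_right ?_ (I.f_nonneg _)
    exact_mod_cast hcard
  -- If no vertex of the optimum has positive value, the optimum is zero and any output will do.
  rcases (I.f_nonneg {x}).eq_or_lt with h0 | hpos
  · rw [hM, ← h0, mul_zero] at hsum
    exact hsum.trans (by positivity)
  rw [← hM] at hpos
  obtain ⟨b, hb₁, hb₃, hb₂, hb₄⟩ := hT.exists_branching
  have hA : rkA J (J * (d + 1)) = d + 2 := rkA_mul hJ0 _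
  -- This fixes `e`: error and one grid step, doubled, stay below `2 ^ e`, since `J + 2 ≤ 2 ^ (a +
  -- 4)`.
  have hE : 2 * (rkE J (J * (d + 1)) + (d + 2)) ≤ 2 ^ e := by
    have h₁ := rkE_add_rkA_le hJ0 d
    rw [hA] at h₁
    have h₂ : J + 2 ≤ 2 ^ (a + 4) := by rw [pow_add]; omega
    have h₃ : (J + 2) ^ (d + 1) ≤ 2 ^ ((a + 4) * (d + 1)) := by
      rw [pow_mul]
      exact Nat.pow_le_pow_left h₂ _
    rw [← he, pow_add]
    omega
  have hER : (2 : ℝ) * (rkE J (J * (d + 1)) + (d + 2)) ≤ 2 ^ e := by exact_mod_cast hE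
  have hFM : 2 ^ e * M ≤ scaled I e Topt.verts :=
    mul_le_mul_of_nonneg_left (I.f_mono (Finset.singleton_subset_iff.2 hx)) (by positivity)
  have hFN : scaled I e Topt.verts < N * M := by
    refine (mul_le_mul_of_nonneg_left hsum (by positivity)).trans_lt ?_
    rw [← hN, ← mul_assoc, ← pow_add]
    push_cast
    refine mul_lt_mul_of_pos_right ?_ hpos
    exact pow_lt_pow_right₀ (by norm_num) (by omega)
  have hFe : 0 ≤ scaled I e ∅ := mul_nonneg (by positivity) (I.f_nonneg _)
  obtain ⟨v, hv, hv₁, hv₂⟩ := exists_grid_point (p := ((d + 2 : ℕ) : ℝ))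
    (e := rkE J (J * (d + 1))) (g := scaled I e Topt.verts) (N := N) hpos
    (by exact_mod_cast Nat.succ_le_succ (Nat.zero_le _)) (by positivity)
    (mul_nonneg (by positivity) (I.f_nonneg _)) hFN
  -- The whole optimal tree fits the top rank: it has fewer than `2 ^ L` edges, and `L ≤ a * d`.
  have hcap : b.size ≤ rkCap J (2 ^ a) (J * (d + 1)) := by
    refine le_trans ?_ (rkCap_mul_succ hs hJ d)
    have h₁ : 2 ^ L ≤ (2 ^ a) ^ (d + 1) := by
      rw [← pow_mul]
      exact Nat.pow_le_pow_right (by norm_num) (hL.trans (Nat.mul_le_mul_left _ (by omega)))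
    omega
  have hatt : Attainable I (scaled I e) M N J (2 ^ a) (J * (d + 1)) I.root ∅ ∅ (v * M)
      I.budget := by
    refine ⟨b, hb₁, hb₄, Finset.empty_subset _, by simpa using hcap, ?_, ?_⟩
    · rw [Finset.empty_union, hb₃]
      linarith
    · rw [Finset.empty_union, hb₃, hA]
      rcases hv₁ with rfl | hv₁
      · left
        rw [Nat.cast_zero, zero_mul]
        exact hFe
      · right
        -- The recursion measures gains over the empty set, whose reward may be positive.
        -- Subtracting it from both sides is harmless because the target side subtracts it `d + 2`
        -- times.
        have : scaled I e ∅ ≤ ((d + 2 : ℕ) : ℝ) * scaled I e ∅ :=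
          le_mul_of_one_le_left hFe (by exact_mod_cast Nat.succ_le_succ (Nat.zero_le _))
        rw [mul_sub]
        linarith
  have hgood := ht x hpos v hv _ le_rfl hatt
  rw [← hM] at hgood
  have hd : (0 : ℝ) ≤ d + 2 := by positivity
  -- The optimum is at most `(d + 2) * v * M` plus an error of at most half of itself, and the
  -- output is worth at least `v * M`; absorbing the error doubles the factor.
  have key : scaled I e Topt.verts ≤ 2 * (d + 2) * scaled I e (pverts (outMap I t)) := by
    have h₁ := mul_le_mul_of_nonneg_left hgood hd
    have h₂ := mul_le_mul_of_nonneg_right hER hpos.le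
    push_cast at hv₂
    nlinarith
  have he0 : (0 : ℝ) < 2 ^ e := by positivity
  unfold scaled at key
  have : (2 : ℝ) ^ e * I.f Topt.verts ≤ 2 ^ e * (2 * (d + 2) * I.f (pverts (outMap I t))) := by
    linarith
  exact le_of_mul_le_mul_left this he0

/-- The program; `m` is the number of times by which the logarithm of the size bound is rounded. -/
def program (m : ℕ) : Program := ⟨[proc], mainCom (2 ^ m)⟩

/-- A bound on the running time. -/
def totalTime (m n k : ℕ) : ℕ :=
  (n + 2) * (5 * 2 ^ m + 60) + (n + 2) * 300 + (8 * 2 ^ logWidth (2 ^ m) n k +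
    logWidth (2 ^ m) n k + logScale (2 ^ m) n k + logSize n k + 10) * 50 +
  (n + 2) * ((2 ^ (logScale (2 ^ m) n k + logSize n k + 1) + 2) * ((n + 2) * 500 +
    timeBase n (2 ^ (logScale (2 ^ m) n k + logSize n k + 1))
      (2 ^ (8 * 2 ^ logWidth (2 ^ m) n k + 7)) (logScale (2 ^ m) n k) ^
        (8 * 2 ^ logWidth (2 ^ m) n k * (depth (2 ^ m) n k + 1) + 1)) + 100)

theorem logSize_le_mul_depth {b : ℕ} (hb : 2 ≤ b) (n k : ℕ) :
    logSize n k ≤ logWidth b n k * depth b n k := by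
  have ha := logWidth_pos hb n k
  rw [depth]
  generalize logWidth b n k = a at *
  generalize logSize n k = L
  have := Nat.lt_mul_div_succ (L + a - 1) ha
  rw [Nat.mul_succ] at this
  omega

theorem program_returns {m : ℕ} (hm : 1 ≤ m) {I : Instance} {k : ℕ} {Topt : Subgraph I.n}
    (hopt : I.IsFeasible Topt) (hk : Topt.verts.card ≤ k) :
    ∃ t T, (program m).Returns I k t T ∧ I.IsFeasible T ∧
      I.f Topt.verts ≤ 2 * (depth (2 ^ m) I.n k + 2) * I.f T.verts ∧ t ≤ totalTime m I.n k := by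
  have hb : 2 ≤ 2 ^ m := by
    calc 2 = 2 ^ 1 := rfl
      _ ≤ 2 ^ m := Nat.pow_le_pow_right (by norm_num) hm
  have hs : 0 < 2 ^ logWidth (2 ^ m) I.n k := by positivity
  obtain ⟨t, st, he, ht, ⟨h₁, h₂⟩, h₃⟩ := runs_mainCom (I := I) (k := k) (P := [proc])
    (b := 2 ^ m) (by omega) (runs_paramCom hb le_rfl)
    (fun M hM => spec_call rfl hs rfl hM le_rfl _) (T := totalTime m I.n k) le_rfl
  refine ⟨t, ⟨pverts (outMap I st), pedges (outMap I st)⟩, ⟨st, he, rfl⟩, h₁.isFeasible h₂, ?_, ht⟩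
  refine le_of_outGood hopt (L := logSize I.n k) ?_ (logSize_le_mul_depth hb _ _) rfl rfl rfl h₃
  refine le_trans (le_min hk ?_) (Nat.le_pow_clog (by norm_num) _)
  simpa using Finset.card_le_univ Topt.verts

/-! ### Numerical estimates -/

/-- Lets `2 ^ L` be absorbed into the base `2 * n` of the time bound, so that the size of the target
grid costs only a bounded multiple of `s` in the exponent. -/
theorem two_pow_logSize_le {n : ℕ} (hn : 0 < n) (k : ℕ) : 2 ^ logSize n k ≤ 2 * n := by
  rcases Nat.eq_zero_or_pos (logSize n k) with h | h
  · rw [h]; omega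
  · have h₁ : 2 ^ (logSize n k - 1) < min k n :=
      (Nat.lt_clog_iff_pow_lt (by norm_num)).1 (Nat.sub_lt h (by norm_num))
    have h₂ : 2 ^ logSize n k = 2 ^ (logSize n k - 1) * 2 := by
      rw [← pow_succ, Nat.sub_add_cancel h]
    omega

theorem mul_depth_le (b n k : ℕ) :
    logWidth b n k * depth b n k ≤ logSize n k + logWidth b n k - 1 := Nat.mul_div_le _ _

theorem depth_le {b : ℕ} (hb : 2 ≤ b) (n k : ℕ) : depth b n k ≤ logSize n k := by
  have ha := logWidth_pos hb n k
  have h := mul_depth_le b n k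
  generalize depth b n k = d at *
  generalize logWidth b n k = a at *
  generalize logSize n k = L at *
  by_contra hlt
  have h₁ : a * (L + 1) ≤ a * d := Nat.mul_le_mul_left _ (by omega)
  have h₂ : 1 * L ≤ a * L := Nat.mul_le_mul_right _ ha
  rw [Nat.mul_succ] at h₁
  omega

theorem logScale_le {b : ℕ} (hb : 2 ≤ b) (n k : ℕ) :
    logScale b n k ≤ 5 * logSize n k + (2 * logWidth b n k + 5) := by
  have ha := logWidth_pos hb n k
  have h := mul_depth_le b n k
  have h' := depth_le hb n k
  rw [logScale]
  generalize depth b n k = d at *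
  generalize logWidth b n k = a at *
  have : (a + 4) * (d + 1) = a * d + a + 4 * d + 4 := by ring
  omega

-- Here `p x` stands for `(2 * n) ^ x`. Keeping it abstract leaves only additivity in the exponent,
-- monotonicity and a few numerical values, and the rest is linear arithmetic.
set_option maxRecDepth 10000 in
theorem sum_le_of_bounds {p : ℕ → ℕ} (hadd : ∀ x y, p (x + y) = p x * p y) (hmono : Monotone p)
    (h₂ : 4 ≤ p 2) (h₉ : 500 ≤ p 9) (h₁₀ : 1000 ≤ p 10) {m n s Q N M Z X : ℕ} (hM : M ≤ p m)
    (hM1 : 1 ≤ M) (hn : n + 2 ≤ p 2) (hN : N + 2 ≤ p (2 * s + 11)) (hZ : Z ≤ p (675 * Q))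
    (hX : X ≤ 20 * p (2 * s + 10)) (hs : 1 ≤ s) (hsQ : s ≤ Q) :
    (n + 2) * (5 * M + 60) + (n + 2) * 300 + X * 50 +
      (n + 2) * ((N + 2) * ((n + 2) * 500 + Z) + 100) ≤ p ((m + 700) * Q) := by
  have hmQ : m * 1 ≤ m * Q := Nat.mul_le_mul_left _ (hs.trans hsQ)
  have hexp : (m + 700) * Q = m * Q + 700 * Q := by ring
  have t₀ : (n + 2) * 500 ≤ p 11 := (Nat.mul_le_mul hn h₉).trans_eq (hadd 2 9).symm
  have t₁ : (n + 2) * (5 * M + 60) ≤ p (2 + (m + 9)) := by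
    rw [hadd, hadd]
    have h : M * 500 ≤ p m * p 9 := Nat.mul_le_mul hM h₉
    exact Nat.mul_le_mul hn (by omega)
  have t₃ : X * 50 ≤ p (2 * s + 10 + 10) := by
    rw [hadd]
    have h : p (2 * s + 10) * 1000 ≤ p (2 * s + 10) * p 10 := Nat.mul_le_mul_left _ h₁₀
    omega
  have t₄ : (n + 2) * ((N + 2) * ((n + 2) * 500 + Z) + 100) ≤
      p (2 + (2 + (2 * s + 11 + 675 * Q))) := by
    have e₁ : p 11 ≤ p (675 * Q) := hmono (by omega)
    have e₂ : p 9 ≤ p (675 * Q) := hmono (by omega)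
    have e₃ : (N + 2) * ((n + 2) * 500 + Z) ≤ (N + 2) * (2 * p (675 * Q)) :=
      Nat.mul_le_mul_left _ (by omega)
    have e₄ : 2 * p (675 * Q) ≤ (N + 2) * p (675 * Q) := Nat.mul_le_mul_right _ (by omega)
    have e₅ : (N + 2) * (2 * p (675 * Q)) = 2 * ((N + 2) * p (675 * Q)) := by ring
    have e₆ : (N + 2) * p (675 * Q) ≤ p (2 * s + 11) * p (675 * Q) := Nat.mul_le_mul_right _ hN
    have e₇ : 4 * (p (2 * s + 11) * p (675 * Q)) ≤ p 2 * (p (2 * s + 11) * p (675 * Q)) :=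
      Nat.mul_le_mul_right _ h₂
    rw [hadd, hadd, hadd]
    exact Nat.mul_le_mul hn (by omega)
  have g₀ : p 11 ≤ p (m * Q + 698 * Q) := hmono (by omega)
  have g₁ : p (2 + (m + 9)) ≤ p (m * Q + 698 * Q) := hmono (by omega)
  have g₃ : p (2 * s + 10 + 10) ≤ p (m * Q + 698 * Q) := hmono (by omega)
  have g₄ : p (2 + (2 + (2 * s + 11 + 675 * Q))) ≤ p (m * Q + 698 * Q) := hmono (by omega)
  have g₅ : p (2 + (m * Q + 698 * Q)) ≤ p ((m + 700) * Q) := hmono (by omega)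
  have g₆ : 4 * p (m * Q + 698 * Q) ≤ p 2 * p (m * Q + 698 * Q) := Nat.mul_le_mul_right _ h₂
  rw [hadd 2] at g₅
  omega

/-- Everything is bounded by powers of `u = 2 * n`. The masks dominate: `W` is about `2 ^ (8 s)`, so
`timeBase` is at most `u ^ (75 * s)`. It is raised to the power `J * (d + 1) + 1`, at most `9 * s *
(d + 1)`, which gives `675 * s ^ 2 * (d + 1)`. -/
theorem totalTime_le_aux {m n L a d e s J N W : ℕ} (hn : 0 < n) (hL : 2 ^ L ≤ 2 * n)
    (he : e ≤ 5 * L + (2 * a + 5)) (hs : 2 ^ a = s) (hJ : 8 * s = J) (hN : 2 ^ (e + L + 1) = N)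
    (hW : 2 ^ (J + 7) = W) :
    (n + 2) * (5 * 2 ^ m + 60) + (n + 2) * 300 + (J + a + e + L + 10) * 50 +
      (n + 2) * ((N + 2) * ((n + 2) * 500 + timeBase n N W e ^ (J * (d + 1) + 1)) + 100) ≤
    (2 * n) ^ ((m + 700) * (s ^ 2 * (d + 1))) := by
  obtain ⟨u, hu⟩ : ∃ u, u = 2 * n := ⟨_, rfl⟩
  have hu2 : 2 ≤ u := by omega
  rw [← hu] at hL ⊢
  have hpw : ∀ {x y : ℕ}, x ≤ y → u ^ x ≤ u ^ y := fun h => Nat.pow_le_pow_right (by omega) h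
  have h2 : ∀ x, 2 ^ x ≤ u ^ x := fun x => Nat.pow_le_pow_left hu2 x
  have has : a < s := by rw [← hs]; exact Nat.lt_two_pow_self
  have hpe : 2 ^ (e + L + 1) ≤ u ^ (2 * s + 10) := by
    calc 2 ^ (e + L + 1) ≤ 2 ^ (L * 6 + (2 * a + 6)) := Nat.pow_le_pow_right (by norm_num) (by omega)
      _ = (2 ^ L) ^ 6 * 2 ^ (2 * a + 6) := by rw [pow_add, pow_mul]
      _ ≤ u ^ 6 * u ^ (2 * a + 6) := Nat.mul_le_mul (Nat.pow_le_pow_left hL 6) (h2 _)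
      _ ≤ u ^ (2 * s + 10) := by rw [← pow_add]; exact hpw (by omega)
  have hN2 : N + 2 ≤ u ^ (2 * s + 11) := by
    have h₁ : 2 ^ 1 ≤ 2 ^ (e + L + 1) := Nat.pow_le_pow_right (by norm_num) (by omega)
    have h₂ : 2 * u ^ (2 * s + 10) ≤ u * u ^ (2 * s + 10) := Nat.mul_le_mul_right _ hu2
    rw [pow_succ' u (2 * s + 10)]
    omega
  have hW1 : W + 1 ≤ u ^ (8 * s + 8) := by
    have h₁ := Nat.one_le_two_pow (n := J + 7)
    have h₂ := h2 (J + 8)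
    rw [pow_succ 2 (J + 7), hW] at h₂
    rw [hW] at h₁
    rw [hJ]
    omega
  have hn2 : n + 2 ≤ u ^ 2 := by rw [hu]; nlinarith
  have he2 : e + 2 ≤ u ^ (2 * s + 10) := by
    have h₁ : e + L + 1 < 2 ^ (e + L + 1) := Nat.lt_two_pow_self
    omega
  have hbase : timeBase n N W e ≤ u ^ (75 * s) := by
    calc timeBase n N W e ≤ u ^ 14 * (u ^ (8 * s + 8) * (u ^ 2) ^ 2 * u ^ (2 * s + 11) *
          u ^ (2 * s + 10)) := by
          unfold timeBase
          have : 10000 ≤ u ^ 14 := le_trans (by norm_num) (h2 14)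
          gcongr
          omega
      _ = u ^ (14 + (8 * s + 8 + 2 * 2 + (2 * s + 11) + (2 * s + 10))) := by
          rw [← pow_mul]; simp only [← pow_add]
      _ ≤ u ^ (75 * s) := hpw (by omega)
  obtain ⟨Q, hQ⟩ : ∃ Q, s ^ 2 * (d + 1) = Q := ⟨_, rfl⟩
  have hsQ : s ≤ Q := by
    rw [← hQ, pow_two, mul_assoc]
    exact Nat.le_mul_of_pos_right _ (Nat.mul_pos (by omega) (Nat.succ_pos d))
  have hpow : timeBase n N W e ^ (J * (d + 1) + 1) ≤ u ^ (675 * Q) := by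
    calc timeBase n N W e ^ (J * (d + 1) + 1) ≤ (u ^ (75 * s)) ^ (J * (d + 1) + 1) :=
          Nat.pow_le_pow_left hbase _
      _ = u ^ (75 * s * (J * (d + 1) + 1)) := (pow_mul _ _ _).symm
      _ ≤ u ^ (675 * Q) := hpw (by
          rw [← hJ, ← hQ]
          have : s * 1 ≤ s * (s * (d + 1)) := Nat.mul_le_mul_left _ (by nlinarith)
          nlinarith)
  rw [hQ]
  have hX : J + a + e + L + 10 ≤ 20 * u ^ (2 * s + 10) := by
    have h₁ : e + L + 1 < 2 ^ (e + L + 1) := Nat.lt_two_pow_self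
    have h₂ : s < 2 ^ s := Nat.lt_two_pow_self
    have h₃ := h2 s
    have h₄ : u ^ s ≤ u ^ (2 * s + 10) := hpw (by omega)
    linarith
  exact sum_le_of_bounds (p := fun x => u ^ x) (pow_add u) (fun _ _ => hpw) (h2 2)
    (le_trans (by norm_num) (h2 9)) (le_trans (by norm_num) (h2 10)) (h2 m) Nat.one_le_two_pow hn2
    hN2 hpow hX (by omega) hsQ

theorem totalTime_le {m n : ℕ} (hm : 1 ≤ m) (hn : 0 < n) (k : ℕ) :
    totalTime m n k ≤
      (2 * n) ^ ((m + 700) * ((2 ^ logWidth (2 ^ m) n k) ^ 2 * (depth (2 ^ m) n k + 1))) :=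
  totalTime_le_aux hn (two_pow_logSize_le hn k)
    (logScale_le (by calc 2 = 2 ^ 1 := rfl
                      _ ≤ 2 ^ m := Nat.pow_le_pow_right (by norm_num) hm) n k) rfl rfl rfl rfl

theorem logSize_le_log (n k : ℕ) : (logSize n k : ℝ) ≤ 1 + 2 * Real.log k := by
  rcases Nat.eq_zero_or_pos (logSize n k) with h | h
  · rw [h]
    have := Real.log_natCast_nonneg k
    push_cast
    linarith
  · have h₁ : 2 ^ (logSize n k - 1) < min k n :=
      (Nat.lt_clog_iff_pow_lt (by norm_num)).1 (Nat.sub_lt h (by norm_num))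
    have h₂ : ((2 : ℝ) ^ (logSize n k - 1)) ≤ k := by
      exact_mod_cast (h₁.le.trans (min_le_left _ _))
    have h₃ := Real.log_le_log (by positivity) h₂
    rw [Real.log_pow, Nat.cast_sub h, Nat.cast_one] at h₃
    have h₄ := Real.log_two_gt_d9
    have h₅ : (1 : ℝ) ≤ logSize n k := by exact_mod_cast h
    nlinarith

/-- Since `a` is a logarithm rounded up, `(2 ^ m) ^ (a - 1)` is below `L + 2`. The power `ε` of this
bound contains `2 ^ (2 * (a - 1))` because `m * ε ≥ 2`; the rounding costs the factor `4`. -/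
theorem width_sq_le {ε : ℝ} {m : ℕ} (hm : 1 ≤ m) (hmε : 2 ≤ m * ε) (n k : ℕ) :
    ((2 : ℝ) ^ logWidth (2 ^ m) n k) ^ 2 ≤ 4 * ((logSize n k : ℝ) + 2) ^ ε := by
  have hb : 2 ≤ 2 ^ m := by
    calc 2 = 2 ^ 1 := rfl
      _ ≤ 2 ^ m := Nat.pow_le_pow_right (by norm_num) hm
  have ha := logWidth_pos hb n k
  have h₁ : (2 ^ m) ^ (logWidth (2 ^ m) n k - 1) < logSize n k + 2 :=
    (Nat.lt_clog_iff_pow_lt (by omega)).1 (Nat.sub_lt ha (by norm_num))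
  obtain ⟨a, ha'⟩ : ∃ a, logWidth (2 ^ m) n k = a + 1 := ⟨_, (Nat.sub_add_cancel ha).symm⟩
  rw [ha'] at h₁ ⊢
  rw [Nat.add_sub_cancel] at h₁
  have h₂ : ((2 : ℝ) ^ m) ^ a ≤ (logSize n k : ℝ) + 2 := by exact_mod_cast h₁.le
  have hε : 0 ≤ ε := by
    by_contra h
    have : (m : ℝ) * ε ≤ 0 := mul_nonpos_of_nonneg_of_nonpos (by positivity) (not_le.1 h).le
    linarith
  have h₃ := Real.rpow_le_rpow (by positivity) h₂ hε
  have h₄ : (((2 : ℝ) ^ m) ^ a) ^ ε = (2 : ℝ) ^ ((m : ℝ) * ε * a) := by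
    rw [← pow_mul, ← Real.rpow_natCast, ← Real.rpow_mul (by norm_num)]
    push_cast
    ring_nf
  have h₅ : ((2 : ℝ) ^ (2 * a)) ≤ (2 : ℝ) ^ ((m : ℝ) * ε * a) := by
    rw [← Real.rpow_natCast]
    refine Real.rpow_le_rpow_of_exponent_le (by norm_num) ?_
    push_cast
    exact mul_le_mul_of_nonneg_right hmε (by positivity)
  calc ((2 : ℝ) ^ (a + 1)) ^ 2 = 4 * 2 ^ (2 * a) := by ring
    _ ≤ _ := by rw [h₄] at h₃; linarith

/-- The exponent `s ^ 2 * (d + 1)` is at most `4 * (L + 2) ^ ε * (L + 2)`, as `d ≤ L`, and `L + 2 ≤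
3 * (1 + log k)`. -/
theorem totalTime_le_rpow {ε : ℝ} {m : ℕ} (hε : 0 < ε) (hm : 1 ≤ m) (hmε : 2 ≤ m * ε) {n : ℕ}
    (hn : 0 < n) (k : ℕ) {x : ℝ} (hx : 2 * (n : ℝ) ≤ x) :
    (totalTime m n k : ℝ) ≤
      x ^ (((m : ℝ) + 700) * 4 * 3 ^ (1 + ε) * (1 + Real.log k) ^ (1 + ε)) := by
  have hn1 : (1 : ℝ) ≤ n := by exact_mod_cast hn
  have hb : 2 ≤ 2 ^ m := by
    calc 2 = 2 ^ 1 := rfl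
      _ ≤ 2 ^ m := Nat.pow_le_pow_right (by norm_num) hm
  have hlog := Real.log_natCast_nonneg k
  have hL := logSize_le_log n k
  have hd : (depth (2 ^ m) n k : ℝ) ≤ logSize n k := by exact_mod_cast depth_le hb n k
  have hexp : ((2 : ℝ) ^ logWidth (2 ^ m) n k) ^ 2 * (depth (2 ^ m) n k + 1) ≤
      4 * (3 ^ (1 + ε) * (1 + Real.log k) ^ (1 + ε)) := by
    have hz : (0 : ℝ) < logSize n k + 2 := by positivity
    calc ((2 : ℝ) ^ logWidth (2 ^ m) n k) ^ 2 * (depth (2 ^ m) n k + 1)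
        ≤ 4 * ((logSize n k : ℝ) + 2) ^ ε * (logSize n k + 2) :=
          mul_le_mul (width_sq_le hm hmε n k) (by linarith) (by positivity) (by positivity)
      _ = 4 * ((logSize n k : ℝ) + 2) ^ (1 + ε) := by
          rw [add_comm 1 ε, Real.rpow_add_one hz.ne', mul_assoc]
      _ ≤ 4 * (3 * (1 + Real.log k)) ^ (1 + ε) := by
          gcongr
          linarith
      _ = _ := by rw [Real.mul_rpow (by norm_num) (by linarith)]
  have h₁ : (totalTime m n k : ℝ) ≤
      (2 * (n : ℝ)) ^ ((m + 700) * ((2 ^ logWidth (2 ^ m) n k) ^ 2 * (depth (2 ^ m) n k + 1))) := by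
    exact_mod_cast totalTime_le hm hn k
  refine h₁.trans ?_
  rw [← Real.rpow_natCast]
  refine (Real.rpow_le_rpow (by positivity) hx (by positivity)).trans ?_
  refine Real.rpow_le_rpow_of_exponent_le (by linarith) ?_
  push_cast
  have := mul_le_mul_of_nonneg_left hexp (show (0 : ℝ) ≤ (m : ℝ) + 700 by positivity)
  linarith

theorem one_le_logRatio (k : ℕ) : 1 ≤ logRatio k := by
  rw [logRatio]
  split_ifs with h
  · exact le_rfl
  · have hk : (3 : ℝ) ≤ k := by exact_mod_cast (not_le.1 h)
    have h₁ : 1 < Real.log k := by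
      rw [Real.lt_log_iff_exp_lt (by linarith)]
      have := Real.exp_one_lt_d9
      linarith
    rw [one_le_div (Real.log_pos h₁)]
    have := Real.log_le_sub_one_of_pos (show 0 < Real.log k by linarith)
    linarith

/-- Up to one unit of rounding, `d` is `L / a`, and `a * m` is at least `log (L + 2)`; so `d - 1` is
at most `m * L / log (L + 2)`. It remains to compare this with `ℓ / log ℓ` for `ℓ = log k`. The
rounding and the constant `2` are absorbed by `logRatio k ≥ 1`. -/
theorem depth_le_logRatio {m : ℕ} (hm : 1 ≤ m) (n k : ℕ) :
    2 * ((depth (2 ^ m) n k : ℝ) + 2) ≤ (10 * m + 6) * logRatio k := by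
  have hb : 2 ≤ 2 ^ m := by
    calc 2 = 2 ^ 1 := rfl
      _ ≤ 2 ^ m := Nat.pow_le_pow_right (by norm_num) hm
  have hratio := one_le_logRatio k
  have hm1 : (1 : ℝ) ≤ m := by exact_mod_cast hm
  by_cases hd1 : depth (2 ^ m) n k ≤ 1
  · have : (depth (2 ^ m) n k : ℝ) ≤ 1 := by exact_mod_cast hd1
    nlinarith
  have hk : ¬ k ≤ 2 := by
    intro hk
    have h₁ : logSize n k ≤ 1 := Nat.clog_le_of_le_pow ((min_le_left _ _).trans hk)
    exact hd1 ((depth_le hb n k).trans h₁)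
  have hL := logSize_le_log n k
  have ha := Nat.le_pow_clog (show 1 < 2 ^ m by omega) (logSize n k + 2)
  have hmul := mul_depth_le (2 ^ m) n k
  have hpos := logWidth_pos hb n k
  change logSize n k + 2 ≤ (2 ^ m) ^ logWidth (2 ^ m) n k at ha
  have hk3 : (3 : ℝ) ≤ k := by exact_mod_cast (not_le.1 hk)
  rw [logRatio, if_neg hk] at hratio ⊢
  have hℓ : 1 < Real.log k := by
    rw [Real.lt_log_iff_exp_lt (by linarith)]
    have := Real.exp_one_lt_d9
    linarith
  generalize depth (2 ^ m) n k = d at *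
  generalize logWidth (2 ^ m) n k = a at *
  generalize logSize n k = L at *
  generalize Real.log k = ℓ at *
  have hll : 0 < Real.log ℓ := Real.log_pos hℓ
  obtain ⟨c, rfl⟩ : ∃ c, d = c + 1 := ⟨d - 1, by omega⟩
  have hacL : (a : ℝ) * c ≤ L := by
    rw [Nat.mul_succ] at hmul
    exact_mod_cast (show a * c ≤ L by omega)
  set y := Real.log ((L : ℝ) + 2) with hy
  have hL2 : (2 : ℝ) ≤ (L : ℝ) + 2 := by linarith [Nat.cast_nonneg (α := ℝ) L]
  have hy1 : 1 / 2 ≤ y := by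
    have := Real.log_le_log (by norm_num) hL2
    have := Real.log_two_gt_d9
    linarith
  have hya : y ≤ a * m := by
    have h₁ : ((L : ℝ) + 2) ≤ ((2 : ℝ) ^ m) ^ a := by exact_mod_cast ha
    have h₂ := Real.log_le_log (by linarith) h₁
    rw [Real.log_pow, Real.log_pow] at h₂
    have h₃ := Real.log_two_lt_d9
    have h₄ : (0 : ℝ) ≤ a * m := by positivity
    nlinarith
  have hcy : c * y ≤ m * L := by
    calc (c : ℝ) * y ≤ c * (a * m) := mul_le_mul_of_nonneg_left hya (by positivity)
      _ = m * (a * c) := by ring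
      _ ≤ m * L := mul_le_mul_of_nonneg_left hacL (by positivity)
  -- Because of the minimum with `n`, `L` may be much smaller than `ℓ`. The bound `log t ≤ t - 1` at
  -- `t = ℓ / (L + 2)` covers this, together with `L ≤ 3 ℓ` and `y ≥ 1 / 2`.
  have hLℓ : L * Real.log ℓ ≤ 5 * ℓ * y := by
    have h₁ := Real.log_le_sub_one_of_pos (show 0 < ℓ / ((L : ℝ) + 2) by positivity)
    rw [Real.log_div (by linarith) (by linarith)] at h₁
    have h₂ : L * (ℓ / ((L : ℝ) + 2)) ≤ ℓ := by
      rw [← mul_div_assoc, div_le_iff₀ (by linarith)]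
      nlinarith [Nat.cast_nonneg (α := ℝ) L]
    have h₃ : (L : ℝ) * Real.log ℓ ≤ L * (ℓ / ((L : ℝ) + 2) + y) :=
      mul_le_mul_of_nonneg_left (by linarith) (Nat.cast_nonneg _)
    have h₄ : (L : ℝ) * y ≤ 3 * ℓ * y := mul_le_mul_of_nonneg_right (by linarith) (by linarith)
    have h₅ : ℓ * 1 ≤ ℓ * (2 * y) := mul_le_mul_of_nonneg_left (by linarith) (by linarith)
    linarith
  have hfin : c * Real.log ℓ ≤ 5 * m * ℓ := by
    have h₁ : (c * Real.log ℓ) * y ≤ (5 * m * ℓ) * y := by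
      calc (c * Real.log ℓ) * y = (c * y) * Real.log ℓ := by ring
        _ ≤ m * L * Real.log ℓ := mul_le_mul_of_nonneg_right hcy hll.le
        _ = m * (L * Real.log ℓ) := by ring
        _ ≤ m * (5 * ℓ * y) := mul_le_mul_of_nonneg_left hLℓ (by positivity)
        _ = _ := by ring
    exact le_of_mul_le_mul_right h₁ (by linarith)
  have hc : (c : ℝ) ≤ 5 * m * (ℓ / Real.log ℓ) := by
    rw [← mul_div_assoc, le_div_iff₀ hll]
    exact hfin
  push_cast
  linarith

end STO

theorem theorem1 (ε : ℝ) (hε : 0 < ε) :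
    ∃ (P : STO.Program) (C : ℝ), 0 < C ∧
      ∀ p : Polynomial ℕ, ∃ D : ℝ, 0 < D ∧
        ∀ I : STO.Instance, (∀ S, I.f S ≤ ((p.eval I.n : ℕ) : ℝ)) →
          ∀ (Topt : STO.Subgraph I.n) (k : ℕ), I.IsOptimal Topt → Topt.verts.card ≤ k →
            ∃ (t : ℕ) (T : STO.Subgraph I.n),
              P.Returns I k t T ∧
              I.IsFeasible T ∧
              I.f Topt.verts ≤ C * STO.logRatio k * I.f T.verts ∧
              (t : ℝ) ≤ (2 * (I.n : ℝ) * (1 + Real.log ((I.budget : ℝ) + 1))) ^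
                (D * (1 + Real.log k) ^ (1 + ε)) := by
  -- The logarithm base `2 ^ m` makes `s` of order at most `(L + 2) ^ (1 / m)`; `m ≥ 2 / ε` keeps `s
  -- ^ 2` within order `(L + 2) ^ ε`, and the added one gives `m ≥ 1`.
  obtain ⟨m, hm⟩ := exists_nat_ge (2 / ε + 1)
  have hm1 : 1 ≤ m := by
    have h : (1 : ℝ) ≤ m := le_trans (by linarith [div_pos two_pos hε]) hm
    exact_mod_cast h
  have hmε : 2 ≤ m * ε := by
    rw [← div_le_iff₀ hε]
    linarith
  refine ⟨STO.program m, 10 * m + 6, by positivity, fun _ =>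
    ⟨((m : ℝ) + 700) * 4 * 3 ^ (1 + ε), by positivity, ?_⟩⟩
  intro I _ Topt k hopt hk
  obtain ⟨t, T, h₁, h₂, h₃, h₄⟩ := STO.program_returns hm1 hopt.1 hk
  refine ⟨t, T, h₁, h₂, h₃.trans ?_, ?_⟩
  · exact mul_le_mul_of_nonneg_right (STO.depth_le_logRatio hm1 I.n k) (I.f_nonneg _)
  -- The time is bounded by a power of `2 * n` alone, and the factor `1 + log (B + 1)` in the base
  -- is at least one.
  · refine le_trans (by exact_mod_cast h₄) (STO.totalTime_le_rpow hε hm1 hmε I.root.pos k ?_)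
    refine le_mul_of_one_le_right (by positivity) ?_
    have : 0 ≤ Real.log ((I.budget : ℝ) + 1) := Real.log_nonneg (by simp)
    linarith
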